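/- **Theorem 3.1.** *Setting.* Let $\Theta\subseteq\mathbb R^d$ be open, $\{p(\cdot\,|\theta):\theta\in\Theta\}$ a family of probability densities with respect to a measure $\mu$, and $S(x;\theta)=S(x;p(\cdot\,|\theta))$ a scoring rule that is proper relative to this family and measurable in $\theta$. Let $X_1,X_2,\dots$ be i.i.d. with density $p(\cdot\,|\theta_0)$, $\theta_0\in\Theta$, and let $S(\theta)=\sum_{i=1}^nS(X_i;\theta)$. Subscripts denote partial derivatives in $\theta$, $s=\partial S(x;\theta)/\partial\theta$, $K(\theta)=E_\theta(\partial s/\partial\theta^T)$, $J(\theta)=E_\theta(ss^T)$, and $G(\theta)=\big(K(\theta)^{-1}J(\theta)K(\theta)^{-1}\big)^{-1}$ is the Godambe information. *Regularity conditions.* 1. For every $x$, $S(x;\cdot)$ is $C^5$ on a ball around $\theta_0$ contained in $\Theta$ (the same ball for all $x$), and there the norm of its fifth derivative is at most $M(x)$ with $E_{\theta_0}M(X)<\infty$. At $\theta_0$ the first partial derivatives are square integrable, and those of orders 2, 3, 4 integrable, under $p(\cdot\,|\theta_0)$. $K(\theta_0)$ and $J(\theta_0)$ are positive definite. 2. The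 prior density $\pi$ is nonnegative on $\Theta$, $C^3$ near $\theta_0$, $\pi(\theta_0)>0$, and for some $r\ge0$, $\int_\Theta\pi(\theta)(1+\|\theta\|)^{-r}d\theta<\infty$ ($r=0$: proper prior). 3. With this $r$: for every $\delta>0$ there is $\varepsilon>0$ such that, with probability tending to one, $S(\theta)-S(\theta_0)\ge n\varepsilon\{1+r\log(1+\|\theta\|)\}$ for all $\theta\in\Theta$ with $\|\theta-\theta_0\|\ge\delta$. 4. The scoring rule estimator $\tilde\theta=\tilde\theta_n(X_1,\dots,X_n)$ is consistent for $\theta_0$ (in probability), and $\partial S(\theta)/\partial\theta=0$ at $\theta=\tilde\theta$ with probability tending to one. *Posterior.* Let $C$ be a fixed $d\times d$ matrix with $C^TK(\theta_0)C=G(\theta_0)$, let $\theta^*=\tilde\theta+C(\theta-\tilde\theta)$, and let $\pi_{SR}(\theta|x)\propto\pi(\theta)\exp\{-S(\theta^*)\}$ for $\theta\in\Theta$ with $\theta^*\in\Theta$, and zero for other $\theta$. Let $\pi_{SR}(w|x)$ be the corresponding density of $w=\sqrt n(\theta-\tilde\theta)$. Put $H(\theta)=C^T(\partial^2S(\theta)/\partial\theta\partial\theta^T)C/n$.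 A tilde denotes evaluation at $\tilde\theta$, $\tilde h^{ij}$ and $c_{ij}$ are the entries of $\tilde H^{-1}$ and $C$, $\phi_d(\cdot\,;V)$ is the density of $N_d(0,V)$, and repeated indices are summed. Let $$A_1(w)=\frac{\tilde\pi_i}{\tilde\pi}w^i-\frac16\frac{\tilde S_{ijk}}{n}c_{ir}c_{js}c_{kt}w^rw^sw^t,$$ $$\begin{aligned}A_2(w)={}&\frac12\frac{\tilde\pi_{ij}}{\tilde\pi}(w^iw^j-\tilde h^{ij})-\frac16\frac{\tilde\pi_i}{\tilde\pi}\frac{\tilde S_{jkh}}{n}c_{jr}c_{ks}c_{ht}(w^iw^rw^sw^t-3\tilde h^{ir}\tilde h^{st})\\&-\frac1{24}\frac{\tilde S_{ijkh}}{n}c_{ir}c_{js}c_{kt}c_{hu}(w^rw^sw^tw^u-3\tilde h^{rs}\tilde h^{tu})\\&+\frac1{72}\frac{\tilde S_{ijk}\tilde S_{rst}}{n^2}c_{ia}c_{jb}c_{kc}c_{rd}c_{se}c_{tf}\big(w^aw^bw^cw^dw^ew^f-9\tilde h^{ab}\tilde h^{cd}\tilde h^{ef}-6\tilde h^{ad}\tilde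 h^{be}\tilde h^{cf}\big).\end{aligned}$$ *Conclusion.* As $n\to\infty$, with probability tending to one $\pi(\theta)\exp\{-S(\theta^*)\}$ has a finite positive integral and $\tilde H$ is positive definite, and: (a) $\pi_{SR}(w|x)=\phi_d(w;\tilde H^{-1})\big[1+n^{-1/2}A_1(w)+n^{-1}A_2(w)\big]+O_p(n^{-3/2})$, uniformly over $\|w\|\le\delta\sqrt n$ for some $\delta>0$, and also in $L^1(dw)$. (b) In particular the SR-posterior is asymptotically normal with mean $\tilde\theta$ and variance $\tilde H^{-1}/n$: $\int\big|\pi_{SR}(\theta|x)-\phi_d(\theta-\tilde\theta;\tilde H^{-1}/n)\big|\,d\theta=O_p(n^{-1/2})$. (c) It has the Godambe curvature: $\tilde H\to G(\theta_0)$ in probability, and almost surely if $\tilde\theta\to\theta_0$ almost surely. -/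

import Mathlib

open MeasureTheory ProbabilityTheory Filter Topology
open scoped ENNReal Matrix BigOperators

noncomputable section

/-- The space `ℝ^d` (with the Euclidean norm) in which parameters live. -/
abbrev Par (d : ℕ) : Type := EuclideanSpace ℝ (Fin d)

/-! ### Partial derivatives -/

/-- The partial derivative `∂^k f / ∂θ^{I 0} ⋯ ∂θ^{I (k-1)}` at `θ`. -/
def pd {d k : ℕ} (f : Par d → ℝ) (I : Fin k → Fin d) (θ : Par d) : ℝ :=
  iteratedFDeriv ℝ k f θ (fun m => EuclideanSpace.single (I m) (1 : ℝ))

/-- The Hessian matrix. -/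
def hessMat {d : ℕ} (f : Par d → ℝ) (θ : Par d) : Matrix (Fin d) (Fin d) ℝ :=
  Matrix.of fun i j => pd f ![i, j] θ

/-! ### Scoring rules

As usual, a distribution is identified with its density `q` with respect to a dominating
measure `μ`, and a scoring rule is a real function `S x q` of an observation and a density. -/

/-- The distribution with density `q` with respect to `μ`. -/
def distOf {𝒳 : Type*} [MeasurableSpace 𝒳] (μ : Measure 𝒳) (q : 𝒳 → ℝ) : Measure 𝒳 :=
  μ.withDensity fun x => ENNReal.ofReal (q x)

/-- `q` is a probability density with respect to `μ`. -/
def IsProbDensity {𝒳 : Type*} [MeasurableSpace 𝒳] (μ : Measure 𝒳) (q : 𝒳 → ℝ) : Prop :=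
  Measurable q ∧ (∀ x, 0 ≤ q x) ∧ IsProbabilityMeasure (distOf μ q)

/-- The expected score `S(P;Q)`, where `P` and `Q` have densities `p` and `q`. -/
def expectedScore {𝒳 : Type*} [MeasurableSpace 𝒳] (μ : Measure 𝒳) (S : 𝒳 → (𝒳 → ℝ) → ℝ)
    (p q : 𝒳 → ℝ) : ℝ :=
  ∫ x, S x q ∂(distOf μ p)

/-- `S` is proper relative to the class `𝒬` of densities: `S(P;P)` is finite and
`S(P;P) ≤ S(P;Q)` for `P, Q` in the class (there is nothing to compare where `S(P;Q)` is not a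
finite expectation). -/
def IsProperScore {𝒳 : Type*} [MeasurableSpace 𝒳] (μ : Measure 𝒳) (S : 𝒳 → (𝒳 → ℝ) → ℝ)
    (𝒬 : Set (𝒳 → ℝ)) : Prop :=
  ∀ p ∈ 𝒬, Integrable (fun x => S x p) (distOf μ p) ∧
    ∀ q ∈ 𝒬, Integrable (fun x => S x q) (distOf μ p) →
      expectedScore μ S p p ≤ expectedScore μ S p q

/-- The total empirical score `S(θ) = ∑ S(x_i; θ)` of the sample `x = (x_1, …, x_n)`. -/
def totalScore {𝒳 : Type*} {d n : ℕ} (S : 𝒳 → (𝒳 → ℝ) → ℝ) (p : Par d → 𝒳 → ℝ)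
    (x : Fin n → 𝒳) (θ : Par d) : ℝ :=
  ∑ i, S (x i) (p θ)

/-- The sensitivity matrix `K(θ) = E_θ(∂s(X;θ)/∂θᵀ)`, where `s = ∂S/∂θ`. -/
def sensitivity {𝒳 : Type*} [MeasurableSpace 𝒳] {d : ℕ} (μ : Measure 𝒳)
    (S : 𝒳 → (𝒳 → ℝ) → ℝ) (p : Par d → 𝒳 → ℝ) (θ : Par d) : Matrix (Fin d) (Fin d) ℝ :=
  Matrix.of fun i j => ∫ x, pd (fun η => S x (p η)) ![i, j] θ ∂(distOf μ (p θ))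

/-- The variability matrix `J(θ) = E_θ(s(X;θ) s(X;θ)ᵀ)`. -/
def variability {𝒳 : Type*} [MeasurableSpace 𝒳] {d : ℕ} (μ : Measure 𝒳)
    (S : 𝒳 → (𝒳 → ℝ) → ℝ) (p : Par d → 𝒳 → ℝ) (θ : Par d) : Matrix (Fin d) (Fin d) ℝ :=
  Matrix.of fun i j => ∫ x, pd (fun η => S x (p η)) ![i] θ * pd (fun η => S x (p η)) ![j] θ
    ∂(distOf μ (p θ))

/-- The Godambe information `G(θ) = V(θ)⁻¹`, where `V(θ) = K(θ)⁻¹ J(θ) K(θ)⁻¹`. -/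
def godambe {𝒳 : Type*} [MeasurableSpace 𝒳] {d : ℕ} (μ : Measure 𝒳)
    (S : 𝒳 → (𝒳 → ℝ) → ℝ) (p : Par d → 𝒳 → ℝ) (θ : Par d) : Matrix (Fin d) (Fin d) ℝ :=
  ((sensitivity μ S p θ)⁻¹ * variability μ S p θ * (sensitivity μ S p θ)⁻¹)⁻¹

/-! ### The calibrated SR-posterior

In this part `Sx` is the total empirical score of the data at hand, `t` is the value of the
scoring rule estimator, `C` is the calibration matrix and `prior` is the prior density. -/

/-- `θ* = t + C (θ - t)`. -/
def calib {d : ℕ} (C : Matrix (Fin d) (Fin d) ℝ) (t θ : Par d) : Par d :=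
  t + WithLp.toLp 2 (C *ᵥ (fun i => θ i - t i))

open Classical in
/-- The unnormalized posterior density `π(θ) exp(-S(θ*))`, on the set of the `θ ∈ Θ` for which
`S(θ*)` is defined, i.e. `θ* ∈ Θ`; it is zero elsewhere. -/
def srKernel {d : ℕ} (Θ : Set (Par d)) (prior Sx : Par d → ℝ) (C : Matrix (Fin d) (Fin d) ℝ)
    (t θ : Par d) : ℝ :=
  if θ ∈ Θ ∧ calib C t θ ∈ Θ then prior θ * Real.exp (-Sx (calib C t θ)) else 0

/-- The SR-posterior density `π_SR(θ|x)`. -/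
def srPosterior {d : ℕ} (Θ : Set (Par d)) (prior Sx : Par d → ℝ)
    (C : Matrix (Fin d) (Fin d) ℝ) (t θ : Par d) : ℝ :=
  srKernel Θ prior Sx C t θ / ∫ η, srKernel Θ prior Sx C t η

/-- The SR-posterior density of `w = √n (θ - t)`. -/
def srPosteriorW {d : ℕ} (n : ℕ) (Θ : Set (Par d)) (prior Sx : Par d → ℝ)
    (C : Matrix (Fin d) (Fin d) ℝ) (t w : Par d) : ℝ :=
  ((Real.sqrt n)⁻¹) ^ d * srPosterior Θ prior Sx C t (t + (Real.sqrt n)⁻¹ • w)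

/-- `H(θ) = Cᵀ (∂²S(θ)/∂θ∂θᵀ) C / n`. -/
def Hmat {d : ℕ} (n : ℕ) (Sx : Par d → ℝ) (C : Matrix (Fin d) (Fin d) ℝ) (θ : Par d) :
    Matrix (Fin d) (Fin d) ℝ :=
  (n : ℝ)⁻¹ • (Cᵀ * hessMat Sx θ * C)

/-- The density `φ_d(w; V)` of the `d`-variate normal distribution with zero mean and variance
matrix `V`. -/
def gaussDensity {d : ℕ} (V : Matrix (Fin d) (Fin d) ℝ) (w : Par d) : ℝ :=
  (Real.sqrt ((2 * Real.pi) ^ d * V.det))⁻¹ *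
    Real.exp (-(1 / 2) * ∑ i, ∑ j, w i * V⁻¹ i j * w j)

/-- `(S_{ijk}(t)/n) c_{ir} c_{js} c_{kt}`, summed over `i, j, k`. -/
def calD3 {d : ℕ} (n : ℕ) (Sx : Par d → ℝ) (C : Matrix (Fin d) (Fin d) ℝ) (t : Par d)
    (r s u : Fin d) : ℝ :=
  ∑ i, ∑ j, ∑ k, pd Sx ![i, j, k] t / n * (C i r * C j s * C k u)

/-- `(S_{ijkh}(t)/n) c_{ir} c_{js} c_{kt} c_{hu}`, summed over `i, j, k, h`. -/
def calD4 {d : ℕ} (n : ℕ) (Sx : Par d → ℝ) (C : Matrix (Fin d) (Fin d) ℝ) (t : Par d)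
    (r s u v : Fin d) : ℝ :=
  ∑ i, ∑ j, ∑ k, ∑ h, pd Sx ![i, j, k, h] t / n * (C i r * C j s * C k u * C h v)

/-- The polynomial `A₁(w)`. -/
def A1 {d : ℕ} (n : ℕ) (prior Sx : Par d → ℝ) (C : Matrix (Fin d) (Fin d) ℝ) (t w : Par d) :
    ℝ :=
  (∑ i, pd prior ![i] t / prior t * w i)
    - 1 / 6 * ∑ r, ∑ s, ∑ u, calD3 n Sx C t r s u * (w r * w s * w u)

/-- The polynomial `A₂(w)`; `h` is the inverse of `H(t)`. -/
def A2 {d : ℕ} (n : ℕ) (prior Sx : Par d → ℝ) (C : Matrix (Fin d) (Fin d) ℝ) (t w : Par d) :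
    ℝ :=
  let h : Matrix (Fin d) (Fin d) ℝ := (Hmat n Sx C t)⁻¹
  1 / 2 * (∑ i, ∑ j, pd prior ![i, j] t / prior t * (w i * w j - h i j))
    - 1 / 6 * (∑ i, ∑ r, ∑ s, ∑ u, pd prior ![i] t / prior t * calD3 n Sx C t r s u *
        (w i * w r * w s * w u - 3 * h i r * h s u))
    - 1 / 24 * (∑ r, ∑ s, ∑ u, ∑ v, calD4 n Sx C t r s u v *
        (w r * w s * w u * w v - 3 * h r s * h u v))
    + 1 / 72 * (∑ a, ∑ b, ∑ c, ∑ e, ∑ f, ∑ g, calD3 n Sx C t a b c * calD3 n Sx C t e f g *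
        (w a * w b * w c * w e * w f * w g
          - 9 * h a b * h c e * h f g - 6 * h a e * h b f * h c g))

/-- The third-order approximation `φ_d(w; H(t)⁻¹) [1 + n^{-1/2} A₁(w) + n^{-1} A₂(w)]`. -/
def srExpansion {d : ℕ} (n : ℕ) (prior Sx : Par d → ℝ) (C : Matrix (Fin d) (Fin d) ℝ)
    (t w : Par d) : ℝ :=
  gaussDensity (Hmat n Sx C t)⁻¹ w *
    (1 + (Real.sqrt n)⁻¹ * A1 n prior Sx C t w + (n : ℝ)⁻¹ * A2 n prior Sx C t w)

/-! ### Stochastic orders -/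

/-- The events `A n` hold with probability tending to one (outer probability is used, so that
no measurability is presupposed). -/
def Whp {Ω : Type*} [MeasurableSpace Ω] (Pr : Measure Ω) (A : ℕ → Ω → Prop) : Prop :=
  Tendsto (fun n => Pr {ω | ¬ A n ω}) atTop (𝓝 0)

/-- `Y n = O_p(a n)` for nonnegative, possibly infinite, `Y n`. -/
def IsBigOp {Ω : Type*} [MeasurableSpace Ω] (Pr : Measure Ω) (Y : ℕ → Ω → ℝ≥0∞) (a : ℕ → ℝ) :
    Prop :=
  ∀ ε : ℝ, 0 < ε → ∃ B : ℝ, ∀ᶠ n in atTop,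
    Pr {ω | ENNReal.ofReal (B * a n) < Y n ω} ≤ ENNReal.ofReal ε

/-! ### Regularity conditions -/

/-- Smoothness and moment conditions on the score `S(x;θ)` near the true value `θ₀`: on some
ball around `θ₀` it has five continuous derivatives in `θ`, the fifth one being dominated by an
integrable function of `x`; at `θ₀` the first derivatives are square integrable and those of
orders two, three and four are integrable; and `K(θ₀)` and `J(θ₀)` are positive definite. -/
structure SmoothScore {𝒳 : Type*} [MeasurableSpace 𝒳] {d : ℕ} (μ : Measure 𝒳)
    (S : 𝒳 → (𝒳 → ℝ) → ℝ) (p : Par d → 𝒳 → ℝ) (Θ : Set (Par d)) (θ₀ : Par d) : Prop where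
  smooth_dominated : ∃ ρ : ℝ, 0 < ρ ∧ Metric.ball θ₀ ρ ⊆ Θ ∧
    (∀ x, ContDiffOn ℝ 5 (fun θ => S x (p θ)) (Metric.ball θ₀ ρ)) ∧
    ∃ M : 𝒳 → ℝ, Integrable M (distOf μ (p θ₀)) ∧
      ∀ x, ∀ θ ∈ Metric.ball θ₀ ρ, ‖iteratedFDeriv ℝ 5 (fun η => S x (p η)) θ‖ ≤ M x
  memLp_first : ∀ i : Fin d,
    MemLp (fun x => pd (fun η => S x (p η)) ![i] θ₀) 2 (distOf μ (p θ₀))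
  integrable_second : ∀ I : Fin 2 → Fin d,
    Integrable (fun x => pd (fun η => S x (p η)) I θ₀) (distOf μ (p θ₀))
  integrable_third : ∀ I : Fin 3 → Fin d,
    Integrable (fun x => pd (fun η => S x (p η)) I θ₀) (distOf μ (p θ₀))
  integrable_fourth : ∀ I : Fin 4 → Fin d,
    Integrable (fun x => pd (fun η => S x (p η)) I θ₀) (distOf μ (p θ₀))
  posDef_sensitivity : (sensitivity μ S p θ₀).PosDef
  posDef_variability : (variability μ S p θ₀).PosDef

/-- Conditions on the prior density: it is nonnegative on `Θ`, positive and three times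
continuously differentiable near `θ₀`, and `π(θ) (1 + ‖θ‖)^{-r}` is integrable over `Θ`
(`r = 0` is the case of a proper prior; `r > 0` admits improper ones). -/
structure SmoothPrior {d : ℕ} (Θ : Set (Par d)) (prior : Par d → ℝ) (r : ℝ) (θ₀ : Par d) :
    Prop where
  nonneg : ∀ θ ∈ Θ, 0 ≤ prior θ
  pos : 0 < prior θ₀
  smooth : ContDiffAt ℝ 3 prior θ₀
  exponent_nonneg : 0 ≤ r
  integrable : IntegrableOn (fun θ => prior θ * (1 + ‖θ‖) ^ (-r)) Θ

/-- The true value is well separated by the empirical score: for every `δ > 0` there is `ε > 0`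
such that, with probability tending to one,
`S(θ) - S(θ₀) ≥ n ε (1 + r log (1 + ‖θ‖))` for all `θ ∈ Θ` with `‖θ - θ₀‖ ≥ δ`. -/
def SeparatedScore {Ω 𝒳 : Type*} [MeasurableSpace Ω] {d : ℕ} (Pr : Measure Ω) (X : ℕ → Ω → 𝒳)
    (S : 𝒳 → (𝒳 → ℝ) → ℝ) (p : Par d → 𝒳 → ℝ) (Θ : Set (Par d)) (r : ℝ) (θ₀ : Par d) : Prop :=
  ∀ δ : ℝ, 0 < δ → ∃ ε : ℝ, 0 < ε ∧ Whp Pr fun n ω =>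
    ∀ θ ∈ Θ, δ ≤ ‖θ - θ₀‖ →
      n * ε * (1 + r * Real.log (1 + ‖θ‖)) ≤
        totalScore S p (fun i : Fin n => X i ω) θ - totalScore S p (fun i : Fin n => X i ω) θ₀

end

/-! This is Laplace's method with constants kept uniform over the random data. Write `t` for the
estimator, u = n^(-1/2) and w = (θ - t)/u. Since θ* - t = C(θ - t), calibration only pulls the
derivative tensors of the score back along `C`. Divide π(θ) exp(-S(θ*)) by its value at θ = t. The
estimating equation removes the linear term of the score, so a Taylor expansion with fifth-order
remainder leaves exp(-wᵀHw/2) times the exponential of ua + u²b + O(u³), where a is minus one sixth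
of the cubic form and b minus one twenty-fourth of the quartic form. Multiplying by the prior ratio
1 + up + u²q + O(u³) gives a Gaussian weight times 1 + u(p + a) + u²(q + pa + b + a²/2). The two
coefficients are A₁(w) and A₂(w) - A₂(0): the subtraction of A₂(0) removes exactly the centring
constants of A₂.

This holds for ‖w‖ ≤ δ√n with δ small, where the perturbation of the exponent is dominated by half
of the Gaussian decay (`exists_local_expansion`). Farther out the expansion is negligible by itself,
and the separation condition makes the kernel exponentially small relative to an integrable multiple
of the prior (`srKernel_tail_le`). The resulting L¹ error is O(u³).

Normalization puts the centring back. A₁ is odd, and A₂ has Gaussian mean zero: Stein's identity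
gives the moments of orders two, four and six as sums over pairings, and the symmetry of the
derivative tensors identifies equivalent pairings, whence the factors 3, 9 and 6
(`gaussInt_centredSextic`). So the normalizing constant is the Gaussian one times 1 - u²A₂(0), up to
O(u³), and division by it turns A₂ - A₂(0) into A₂ (`exists_normalized_expansion`). Asymptotic
normality follows by dropping the terms of order u and u².

All this is deterministic, with constants depending on a few bounds (`LocalRegularity`,
`exists_posterior_expansion`). Probability enters only at the end: the laws of large numbers and
consistency make the bounds hold with probability tending to one, and make H converge to CᵀKC = G.
Events of probability tending to one form a filter, so convergence in probability is handled as
ordinary convergence, and the same lemmas with `atTop` and a frozen sample point give the almost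
sure statement. -/

noncomputable section

/-! ### Functions of polynomial growth -/

/-- Continuous functions of at most polynomial growth. -/
def PolyGrowth {d : ℕ} (g : Par d → ℝ) : Prop :=
  Continuous g ∧ ∃ K : ℝ, ∃ N : ℕ, 0 ≤ K ∧ ∀ w, |g w| ≤ K * (1 + ‖w‖) ^ N

namespace PolyGrowth

variable {d : ℕ} {f g : Par d → ℝ}

lemma const (c : ℝ) : PolyGrowth (fun _ : Par d => c) :=
  ⟨continuous_const, |c|, 0, abs_nonneg c, fun w => by simp⟩

lemma coord (i : Fin d) : PolyGrowth (fun w : Par d => w i) := by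
  refine ⟨by fun_prop, 1, 1, zero_le_one, fun w => ?_⟩
  have := EuclideanSpace.norm_eq w
  have h1 : ‖w i‖ ≤ ‖w‖ := PiLp.norm_apply_le w i
  rw [Real.norm_eq_abs] at h1
  linarith

lemma mul (hf : PolyGrowth f) (hg : PolyGrowth g) : PolyGrowth (fun w => f w * g w) := by
  obtain ⟨cf, K, N, hK, hf⟩ := hf
  obtain ⟨cg, L, M, hL, hg⟩ := hg
  refine ⟨cf.mul cg, K * L, N + M, by positivity, fun w => ?_⟩
  rw [abs_mul, pow_add]
  calc |f w| * |g w| ≤ (K * (1 + ‖w‖) ^ N) * (L * (1 + ‖w‖) ^ M) :=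
        mul_le_mul (hf w) (hg w) (abs_nonneg _) (by positivity)
    _ = _ := by ring

lemma add (hf : PolyGrowth f) (hg : PolyGrowth g) : PolyGrowth (fun w => f w + g w) := by
  obtain ⟨cf, K, N, hK, hf⟩ := hf
  obtain ⟨cg, L, M, hL, hg⟩ := hg
  refine ⟨cf.add cg, K + L, N + M, by positivity, fun w => ?_⟩
  have h1 : (1:ℝ) ≤ 1 + ‖w‖ := by linarith [norm_nonneg w]
  have h2 : (1 + ‖w‖) ^ N ≤ (1 + ‖w‖) ^ (N + M) := pow_le_pow_right₀ h1 (by omega)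
  have h3 : (1 + ‖w‖) ^ M ≤ (1 + ‖w‖) ^ (N + M) := pow_le_pow_right₀ h1 (by omega)
  calc |f w + g w| ≤ |f w| + |g w| := abs_add_le _ _
    _ ≤ K * (1 + ‖w‖) ^ N + L * (1 + ‖w‖) ^ M := add_le_add (hf w) (hg w)
    _ ≤ K * (1 + ‖w‖) ^ (N + M) + L * (1 + ‖w‖) ^ (N + M) := by gcongr
    _ = _ := by ring

lemma neg (hf : PolyGrowth f) : PolyGrowth (fun w => -f w) := by
  simpa using (const (-1)).mul hf

lemma sub (hf : PolyGrowth f) (hg : PolyGrowth g) : PolyGrowth (fun w => f w - g w) := by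
  simpa [sub_eq_add_neg] using hf.add hg.neg

lemma sum {ι : Type*} (s : Finset ι) {F : ι → Par d → ℝ} (h : ∀ i, PolyGrowth (F i)) :
    PolyGrowth (fun w => ∑ i ∈ s, F i w) := by
  classical
  induction s using Finset.induction_on with
  | empty => simpa using const 0
  | insert a s ha ih => simpa [Finset.sum_insert ha] using (h a).add ih

end PolyGrowth

/-! ### Gaussian weights -/

/-- The quadratic form of a matrix. -/
def quadForm {d : ℕ} (H : Matrix (Fin d) (Fin d) ℝ) (w : Par d) : ℝ :=
  ∑ i, ∑ j, w i * H i j * w j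

/-- `exp(-wᵀ H w / 2)`. -/
def gaussWeight {d : ℕ} (H : Matrix (Fin d) (Fin d) ℝ) (w : Par d) : ℝ :=
  Real.exp (-(1 / 2) * quadForm H w)

lemma continuous_quadForm {d : ℕ} (H : Matrix (Fin d) (Fin d) ℝ) : Continuous (quadForm H) := by
  unfold quadForm; fun_prop

lemma continuous_gaussWeight {d : ℕ} (H : Matrix (Fin d) (Fin d) ℝ) :
    Continuous (gaussWeight H) := by
  unfold gaussWeight; have := continuous_quadForm H; fun_prop

lemma gaussWeight_pos {d : ℕ} (H : Matrix (Fin d) (Fin d) ℝ) (w : Par d) : 0 < gaussWeight H w :=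
  Real.exp_pos _

lemma quadForm_eq_dotProduct {d : ℕ} (H : Matrix (Fin d) (Fin d) ℝ) (w : Par d) :
    quadForm H w = w.ofLp ⬝ᵥ (H *ᵥ w.ofLp) := by
  simp only [quadForm, dotProduct, Matrix.mulVec, Finset.mul_sum, mul_assoc]

lemma quadForm_neg {d : ℕ} (H : Matrix (Fin d) (Fin d) ℝ) (w : Par d) :
    quadForm H (-w) = quadForm H w := by
  simp [quadForm]

lemma gaussWeight_neg {d : ℕ} (H : Matrix (Fin d) (Fin d) ℝ) (w : Par d) :
    gaussWeight H (-w) = gaussWeight H w := by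
  simp [gaussWeight, quadForm_neg]

/-- A power is absorbed by a Gaussian factor. -/
lemma exists_pow_mul_exp_le (N : ℕ) {c : ℝ} (hc : 0 < c) :
    ∃ K : ℝ, 0 < K ∧ ∀ x : ℝ, 0 ≤ x →
      (1 + x) ^ N * Real.exp (-c * x ^ 2) ≤ K * Real.exp (-(c / 2) * x ^ 2) := by
  -- From (1 + x)^N ≤ N! exp(1 + x), together with x ≤ cx²/2 + 1/(2c), which is (cx - 1)² ≥ 0.
  refine ⟨(N.factorial : ℝ) * Real.exp (1 + 1 / (2 * c)), by positivity, fun x hx => ?_⟩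
  have h1 : (1 + x) ^ N ≤ N.factorial * Real.exp (1 + x) := by
    have := Real.pow_div_factorial_le_exp (1 + x) (by linarith) N
    rwa [div_le_iff₀ (by positivity), mul_comm] at this
  have h2 : 1 + x ≤ 1 + 1 / (2 * c) + c / 2 * x ^ 2 := by
    have h3 : 0 ≤ (c * x - 1) ^ 2 / (2 * c) := by positivity
    have h4 : (c * x - 1) ^ 2 / (2 * c) = c / 2 * x ^ 2 - x + 1 / (2 * c) := by
      field_simp; ring
    linarith
  calc (1 + x) ^ N * Real.exp (-c * x ^ 2)
      ≤ (N.factorial * Real.exp (1 + 1 / (2 * c) + c / 2 * x ^ 2)) * Real.exp (-c * x ^ 2) := by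
        gcongr
        exact h1.trans (by gcongr)
    _ = N.factorial * Real.exp (1 + 1 / (2 * c)) * Real.exp (-(c / 2) * x ^ 2) := by
        rw [mul_assoc, mul_assoc, ← Real.exp_add, ← Real.exp_add]; congr 2; ring

lemma integrable_exp_neg_mul_sq_norm {d : ℕ} {c : ℝ} (hc : 0 < c) :
    Integrable (fun w : Par d => Real.exp (-c * ‖w‖ ^ 2)) := by
  have := (GaussianFourier.integrable_cexp_neg_mul_sq_norm_add (V := Par d)
    (b := (c : ℂ)) (by simpa using hc) 0 0).norm
  refine this.congr (ae_of_all _ fun w => ?_)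
  simp only [zero_mul, add_zero]
  rw [Complex.norm_exp]
  congr 1
  rw [← Complex.ofReal_neg, ← Complex.ofReal_pow, ← Complex.ofReal_mul, Complex.ofReal_re]

lemma integrable_pow_mul_exp {d : ℕ} (N : ℕ) {c : ℝ} (hc : 0 < c) :
    Integrable (fun w : Par d => (1 + ‖w‖) ^ N * Real.exp (-c * ‖w‖ ^ 2)) := by
  obtain ⟨K, hK, h⟩ := exists_pow_mul_exp_le N hc
  refine ((integrable_exp_neg_mul_sq_norm (d := d) (half_pos hc)).const_mul K).mono'
    (by fun_prop) (ae_of_all _ fun w => ?_)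
  rw [Real.norm_of_nonneg (by positivity)]
  exact h _ (norm_nonneg w)

/-- Integration against the Gaussian weight. -/
def gaussInt {d : ℕ} (H : Matrix (Fin d) (Fin d) ℝ) (g : Par d → ℝ) : ℝ :=
  ∫ w, g w * gaussWeight H w

section Weight

variable {d : ℕ} {H : Matrix (Fin d) (Fin d) ℝ} {c : ℝ}

/-- Positivity of `H` is always used through an explicit lower bound `c`, so that estimates depend
on `c` and not on the random matrix. -/
lemma gaussWeight_le (hH : ∀ w, c * ‖w‖ ^ 2 ≤ quadForm H w) (w : Par d) :
    gaussWeight H w ≤ Real.exp (-(c / 2) * ‖w‖ ^ 2) := by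
  unfold gaussWeight
  have := hH w
  exact Real.exp_le_exp.2 (by linarith)

lemma PolyGrowth.integrable_mul_gaussWeight {g : Par d → ℝ} (hg : PolyGrowth g) (hc : 0 < c)
    (hH : ∀ w, c * ‖w‖ ^ 2 ≤ quadForm H w) :
    Integrable (fun w => g w * gaussWeight H w) := by
  obtain ⟨cg, K, N, hK, hg⟩ := hg
  refine ((integrable_pow_mul_exp (d := d) N (half_pos hc)).const_mul K).mono'
    (cg.mul (continuous_gaussWeight H)).aestronglyMeasurable (ae_of_all _ fun w => ?_)
  rw [norm_mul, Real.norm_eq_abs, Real.norm_of_nonneg (gaussWeight_pos H w).le, ← mul_assoc]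
  exact mul_le_mul (hg w) (gaussWeight_le hH w) (gaussWeight_pos H w).le (by positivity)

lemma integrable_gaussWeight (hc : 0 < c) (hH : ∀ w, c * ‖w‖ ^ 2 ≤ quadForm H w) :
    Integrable (gaussWeight H) := by
  simpa using (PolyGrowth.const 1).integrable_mul_gaussWeight hc hH

lemma integral_odd_mul_gaussWeight {g : Par d → ℝ} (hg : ∀ w, g (-w) = -g w) :
    ∫ w, g w * gaussWeight H w = 0 := by
  have h := integral_neg_eq_self (fun w => g w * gaussWeight H w) (volume : Measure (Par d))
  simp only [hg, gaussWeight_neg, neg_mul, integral_neg] at h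
  linarith

/-- Along a line the quadratic form is a quadratic polynomial in the parameter; symmetry of `H`
merges the two cross terms. -/
lemma hasLineDerivAt_gaussWeight (hs : H.IsSymm) (v w : Par d) :
    HasLineDerivAt ℝ (gaussWeight H) (-(v.ofLp ⬝ᵥ (H *ᵥ w.ofLp)) * gaussWeight H w) w v := by
  have hsym : w.ofLp ⬝ᵥ (H *ᵥ v.ofLp) = v.ofLp ⬝ᵥ (H *ᵥ w.ofLp) := by
    rw [Matrix.dotProduct_mulVec, ← Matrix.mulVec_transpose, hs.eq, dotProduct_comm]
  have hq : ∀ s : ℝ, quadForm H (w + s • v) =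
      quadForm H w + s * (2 * (v.ofLp ⬝ᵥ (H *ᵥ w.ofLp))) + s ^ 2 * quadForm H v := by
    intro s
    simp only [quadForm_eq_dotProduct, WithLp.ofLp_add, WithLp.ofLp_smul, Matrix.mulVec_add,
      Matrix.mulVec_smul, dotProduct_add, add_dotProduct, smul_dotProduct, dotProduct_smul,
      smul_eq_mul, hsym]
    ring
  unfold HasLineDerivAt gaussWeight
  simp only [hq]
  have h1 : HasDerivAt (fun s : ℝ => -(1 / 2) * (quadForm H w +
      s * (2 * (v.ofLp ⬝ᵥ (H *ᵥ w.ofLp))) + s ^ 2 * quadForm H v))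
      (-(v.ofLp ⬝ᵥ (H *ᵥ w.ofLp))) 0 := by
    have := ((((hasDerivAt_id (0:ℝ)).mul_const (2 * (v.ofLp ⬝ᵥ (H *ᵥ w.ofLp)))).const_add
      (quadForm H w)).add (((hasDerivAt_id (0:ℝ)).pow 2).mul_const (quadForm H v))).const_mul
      (-(1 / 2))
    convert! this using 1
    simp
  convert! h1.exp using 1
  simp [mul_comm]

/-- Stein's identity. -/
lemma integral_dotProduct_mul_gaussWeight (hs : H.IsSymm) (hc : 0 < c)
    (hH : ∀ w, c * ‖w‖ ^ 2 ≤ quadForm H w) {g g' : Par d → ℝ} (v : Par d)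
    (hg : PolyGrowth g) (hg' : PolyGrowth g') (hd : ∀ w, HasLineDerivAt ℝ g (g' w) w v) :
    ∫ w, (v.ofLp ⬝ᵥ (H *ᵥ w.ofLp)) * g w * gaussWeight H w = ∫ w, g' w * gaussWeight H w := by
  have hl : PolyGrowth (fun w : Par d => v.ofLp ⬝ᵥ (H *ᵥ w.ofLp)) := by
    simp only [dotProduct, Matrix.mulVec]
    exact PolyGrowth.sum _ fun i => (PolyGrowth.const _).mul
      (PolyGrowth.sum _ fun j => (PolyGrowth.const _).mul (PolyGrowth.coord j))
  -- Integration by parts along `v`; there is no boundary term because all three products are of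
  -- polynomial growth times the Gaussian weight.
  have h := integral_bilinear_hasLineDerivAt_right_eq_neg_left_of_integrable
    (f := g) (f' := g') (g := gaussWeight H)
    (g' := fun w => -(v.ofLp ⬝ᵥ (H *ᵥ w.ofLp)) * gaussWeight H w) (v := v)
    (B := ContinuousLinearMap.mul ℝ ℝ) (μ := (volume : Measure (Par d)))
    (by simpa using hg'.integrable_mul_gaussWeight hc hH)
    (by
      have := (hg.mul hl.neg).integrable_mul_gaussWeight hc hH
      refine this.congr (ae_of_all _ fun w => ?_)
      simp [mul_assoc])
    (by simpa using hg.integrable_mul_gaussWeight hc hH)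
    (fun w _ => hd w) (fun w _ => hasLineDerivAt_gaussWeight hs v w)
  simp only [ContinuousLinearMap.mul_apply'] at h
  rw [eq_comm, neg_eq_iff_eq_neg] at h
  rw [h, ← integral_neg]
  refine integral_congr_ae (ae_of_all _ fun w => ?_)
  simp only; ring

/-- Stein's identity in the direction v = row `a` of `H⁻¹`, for which vᵀHw is the coordinate `w a`.
Each use trades a coordinate factor for a derivative, which is the recursion behind Wick's formula.
-/
lemma gaussInt_coord_mul (hs : H.IsSymm) (hu : IsUnit H.det) (hc : 0 < c)
    (hH : ∀ w, c * ‖w‖ ^ 2 ≤ quadForm H w) {g g' : Par d → ℝ} (a : Fin d)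
    (hg : PolyGrowth g) (hg' : PolyGrowth g')
    (hd : ∀ w, HasLineDerivAt ℝ g (g' w) w (WithLp.toLp 2 (H⁻¹.row a))) :
    gaussInt H (fun w => w a * g w) = gaussInt H g' := by
  unfold gaussInt
  rw [← integral_dotProduct_mul_gaussWeight hs hc hH _ hg hg' hd]
  refine integral_congr_ae (ae_of_all _ fun w => ?_)
  have : H⁻¹.row a ⬝ᵥ (H *ᵥ w.ofLp) = w a := by
    change (H⁻¹ *ᵥ (H *ᵥ w.ofLp)) a = w a
    rw [Matrix.mulVec_mulVec, Matrix.nonsing_inv_mul _ hu, Matrix.one_mulVec]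
  simp only [this]

lemma gaussInt_add (hc : 0 < c) (hH : ∀ w, c * ‖w‖ ^ 2 ≤ quadForm H w) {f g : Par d → ℝ}
    (hf : PolyGrowth f) (hg : PolyGrowth g) :
    gaussInt H (fun w => f w + g w) = gaussInt H f + gaussInt H g := by
  unfold gaussInt
  rw [← integral_add (hf.integrable_mul_gaussWeight hc hH) (hg.integrable_mul_gaussWeight hc hH)]
  simp only [add_mul]

lemma gaussInt_sub (hc : 0 < c) (hH : ∀ w, c * ‖w‖ ^ 2 ≤ quadForm H w) {f g : Par d → ℝ}
    (hf : PolyGrowth f) (hg : PolyGrowth g) :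
    gaussInt H (fun w => f w - g w) = gaussInt H f - gaussInt H g := by
  unfold gaussInt
  rw [← integral_sub (hf.integrable_mul_gaussWeight hc hH) (hg.integrable_mul_gaussWeight hc hH)]
  simp only [sub_mul]

lemma gaussInt_const_mul (H : Matrix (Fin d) (Fin d) ℝ) (k : ℝ) (g : Par d → ℝ) :
    gaussInt H (fun w => k * g w) = k * gaussInt H g := by
  unfold gaussInt
  rw [← integral_const_mul]
  simp only [mul_assoc]

lemma gaussInt_const (H : Matrix (Fin d) (Fin d) ℝ) (k : ℝ) :
    gaussInt H (fun _ => k) = k * gaussInt H (fun _ => 1) := by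
  unfold gaussInt
  rw [← integral_const_mul]
  simp

lemma gaussInt_sum (hc : 0 < c) (hH : ∀ w, c * ‖w‖ ^ 2 ≤ quadForm H w) {ι : Type*} [Fintype ι]
    {F : ι → Par d → ℝ} (hF : ∀ i, PolyGrowth (F i)) :
    gaussInt H (fun w => ∑ i, F i w) = ∑ i, gaussInt H (F i) := by
  unfold gaussInt
  rw [← integral_finsetSum _ fun i _ => (hF i).integrable_mul_gaussWeight hc hH]
  simp only [Finset.sum_mul]

end Weight

lemma hasLineDerivAt_coord {d : ℕ} (b : Fin d) (w v : Par d) :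
    HasLineDerivAt ℝ (fun w : Par d => w b) (v b) w v := by
  unfold HasLineDerivAt
  simpa using ((hasDerivAt_id (0:ℝ)).mul_const (v b)).const_add (w b)

lemma HasLineDerivAt.mul_fun {d : ℕ} {f g : Par d → ℝ} {f' g' : ℝ} {w v : Par d}
    (hf : HasLineDerivAt ℝ f f' w v) (hg : HasLineDerivAt ℝ g g' w v) :
    HasLineDerivAt ℝ (fun w => f w * g w) (f' * g w + f w * g') w v := by
  unfold HasLineDerivAt at *
  simpa using hf.fun_mul hg

section Moments

variable {d : ℕ} {H : Matrix (Fin d) (Fin d) ℝ} {c : ℝ}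

lemma gaussInt_coord_two (hs : H.IsSymm) (hu : IsUnit H.det) (hc : 0 < c)
    (hH : ∀ w, c * ‖w‖ ^ 2 ≤ quadForm H w) (i j : Fin d) :
    gaussInt H (fun w => w i * w j) = H⁻¹ i j * gaussInt H (fun _ => 1) := by
  rw [← gaussInt_const]
  exact gaussInt_coord_mul hs hu hc hH i (PolyGrowth.coord j)
    (PolyGrowth.const (H⁻¹ i j)) fun w => hasLineDerivAt_coord j w _

/-- Stein's identity peels off `w i`; the product rule pairs `i` with each remaining index and
leaves second moments. -/
lemma gaussInt_coord_four (hs : H.IsSymm) (hu : IsUnit H.det) (hc : 0 < c)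
    (hH : ∀ w, c * ‖w‖ ^ 2 ≤ quadForm H w) (i j k l : Fin d) :
    gaussInt H (fun w => w i * (w j * (w k * w l))) =
      (H⁻¹ i j * H⁻¹ k l + H⁻¹ i k * H⁻¹ j l + H⁻¹ i l * H⁻¹ j k) * gaussInt H (fun _ => 1) := by
  have p2 : ∀ a b : Fin d, PolyGrowth fun w : Par d => w a * w b :=
    fun a b => (PolyGrowth.coord a).mul (PolyGrowth.coord b)
  have q2 : ∀ (x : ℝ) (a b : Fin d), PolyGrowth fun w : Par d => x * (w a * w b) :=
    fun x a b => (PolyGrowth.const x).mul (p2 a b)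
  rw [gaussInt_coord_mul hs hu hc hH i (g := fun w => w j * (w k * w l))
    (g' := fun w => H⁻¹ i j * (w k * w l) + (H⁻¹ i k * (w j * w l) + H⁻¹ i l * (w j * w k)))
    ((PolyGrowth.coord j).mul (p2 k l)) ((q2 _ _ _).add ((q2 _ _ _).add (q2 _ _ _)))
    (fun w => by
      convert! (hasLineDerivAt_coord j w _).mul_fun
        ((hasLineDerivAt_coord k w _).mul_fun (hasLineDerivAt_coord l w _)) using 1
      simp only [Matrix.row_apply]; ring),
    gaussInt_add hc hH (q2 _ _ _) ((q2 _ _ _).add (q2 _ _ _)),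
    gaussInt_add hc hH (q2 _ _ _) (q2 _ _ _)]
  simp only [gaussInt_const_mul, gaussInt_coord_two hs hu hc hH]
  ring

/-- One more round of the same recursion: five partners for `i`, and three pairings of the other
four indices. -/
lemma gaussInt_coord_six (hs : H.IsSymm) (hu : IsUnit H.det) (hc : 0 < c)
    (hH : ∀ w, c * ‖w‖ ^ 2 ≤ quadForm H w) (i j k l m n : Fin d) :
    gaussInt H (fun w => w i * (w j * (w k * (w l * (w m * w n))))) =
      (H⁻¹ i j * (H⁻¹ k l * H⁻¹ m n + H⁻¹ k m * H⁻¹ l n + H⁻¹ k n * H⁻¹ l m)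
      + H⁻¹ i k * (H⁻¹ j l * H⁻¹ m n + H⁻¹ j m * H⁻¹ l n + H⁻¹ j n * H⁻¹ l m)
      + H⁻¹ i l * (H⁻¹ j k * H⁻¹ m n + H⁻¹ j m * H⁻¹ k n + H⁻¹ j n * H⁻¹ k m)
      + H⁻¹ i m * (H⁻¹ j k * H⁻¹ l n + H⁻¹ j l * H⁻¹ k n + H⁻¹ j n * H⁻¹ k l)
      + H⁻¹ i n * (H⁻¹ j k * H⁻¹ l m + H⁻¹ j l * H⁻¹ k m + H⁻¹ j m * H⁻¹ k l))
      * gaussInt H (fun _ => 1) := by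
  have pc := @PolyGrowth.coord d
  have p4 : ∀ a b e f : Fin d, PolyGrowth fun w : Par d => w a * (w b * (w e * w f)) :=
    fun a b e f => (pc a).mul ((pc b).mul ((pc e).mul (pc f)))
  have q4 : ∀ (x : ℝ) (a b e f : Fin d),
      PolyGrowth fun w : Par d => x * (w a * (w b * (w e * w f))) :=
    fun x a b e f => (PolyGrowth.const x).mul (p4 a b e f)
  rw [gaussInt_coord_mul hs hu hc hH i
    (g := fun w => w j * (w k * (w l * (w m * w n))))
    (g' := fun w => H⁻¹ i j * (w k * (w l * (w m * w n))) + (H⁻¹ i k * (w j * (w l * (w m * w n)))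
      + (H⁻¹ i l * (w j * (w k * (w m * w n))) + (H⁻¹ i m * (w j * (w k * (w l * w n)))
      + H⁻¹ i n * (w j * (w k * (w l * w m)))))))
    ((pc j).mul (p4 _ _ _ _))
    ((q4 _ _ _ _ _).add ((q4 _ _ _ _ _).add ((q4 _ _ _ _ _).add
      ((q4 _ _ _ _ _).add (q4 _ _ _ _ _)))))
    (fun w => by
      convert! (hasLineDerivAt_coord j w _).mul_fun ((hasLineDerivAt_coord k w _).mul_fun
        ((hasLineDerivAt_coord l w _).mul_fun
          ((hasLineDerivAt_coord m w _).mul_fun (hasLineDerivAt_coord n w _)))) using 1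
      simp only [Matrix.row_apply]; ring),
    gaussInt_add hc hH (q4 _ _ _ _ _) ((q4 _ _ _ _ _).add ((q4 _ _ _ _ _).add
      ((q4 _ _ _ _ _).add (q4 _ _ _ _ _)))),
    gaussInt_add hc hH (q4 _ _ _ _ _) ((q4 _ _ _ _ _).add ((q4 _ _ _ _ _).add (q4 _ _ _ _ _))),
    gaussInt_add hc hH (q4 _ _ _ _ _) ((q4 _ _ _ _ _).add (q4 _ _ _ _ _)),
    gaussInt_add hc hH (q4 _ _ _ _ _) (q4 _ _ _ _ _)]
  simp only [gaussInt_const_mul, gaussInt_coord_four hs hu hc hH]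
  ring

end Moments

/-! ### The normalizing constant -/

lemma posDef_of_quadForm {d : ℕ} {H : Matrix (Fin d) (Fin d) ℝ} {c : ℝ} (hs : H.IsSymm)
    (hc : 0 < c) (hH : ∀ w, c * ‖w‖ ^ 2 ≤ quadForm H w) : H.PosDef := by
  refine Matrix.PosDef.of_dotProduct_mulVec_pos (by
    rw [Matrix.IsHermitian, Matrix.conjTranspose_eq_transpose_of_trivial]; exact hs) fun x hx => ?_
  have h := hH (WithLp.toLp 2 x)
  rw [quadForm_eq_dotProduct] at h
  have hx' : 0 < ‖(WithLp.toLp 2 x : Par d)‖ := by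
    rw [norm_pos_iff]; simpa using hx
  have : 0 < c * ‖(WithLp.toLp 2 x : Par d)‖ ^ 2 := by positivity
  simpa using this.trans_le h

-- With B the positive square root of `H`, wᵀHw = ‖Bw‖², so the substitution y = Bw reduces to the
-- standard Gaussian integral at the cost of |det B|⁻¹ = (det H)^(-1/2).
open scoped MatrixOrder in
lemma integral_gaussWeight {d : ℕ} {H : Matrix (Fin d) (Fin d) ℝ} (hH : H.PosDef) :
    ∫ w, gaussWeight H w = Real.sqrt ((2 * Real.pi) ^ d * (H⁻¹).det) := by
  obtain ⟨B, hB⟩ : ∃ B : Matrix (Fin d) (Fin d) ℝ, H = Bᵀ * B := by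
    refine ⟨CFC.sqrt H, ?_⟩
    have h1 : (CFC.sqrt H)ᵀ = CFC.sqrt H := by
      have := (CFC.sqrt_nonneg H).isSelfAdjoint.star_eq
      rwa [Matrix.star_eq_conjTranspose, Matrix.conjTranspose_eq_transpose_of_trivial] at this
    rw [h1, CFC.sqrt_mul_sqrt_self _ hH.posSemidef.nonneg]
  have hdet : H.det = B.det ^ 2 := by rw [hB, Matrix.det_mul, Matrix.det_transpose]; ring
  have hB0 : B.det ≠ 0 := by
    intro h; have := hH.det_pos; rw [hdet, h] at this; simp at this
  set L : Par d →ₗ[ℝ] Par d := Matrix.toLpLin 2 2 B with hL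
  have hLdet : LinearMap.det L = B.det := by
    rw [hL, Matrix.toLpLin_eq_toLin, LinearMap.det_toLin]
  have hq : ∀ w, gaussWeight H w = Real.exp (-(1 / 2) * ‖L w‖ ^ 2) := by
    intro w
    have h1 : ‖L w‖ ^ 2 = quadForm H w := by
      rw [quadForm_eq_dotProduct, EuclideanSpace.norm_sq_eq, hB, ← Matrix.mulVec_mulVec,
        Matrix.dotProduct_mulVec, ← Matrix.mulVec_transpose, Matrix.transpose_transpose]
      simp [hL, dotProduct, Matrix.toLpLin_apply, sq]
    rw [h1, gaussWeight]
  have hmap := Measure.map_linearMap_addHaar_eq_smul_addHaar (volume : Measure (Par d))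
    (f := L) (by rwa [hLdet])
  have hLc : Continuous L := L.continuous_of_finiteDimensional
  calc ∫ w, gaussWeight H w = ∫ w, Real.exp (-(1 / 2) * ‖L w‖ ^ 2) := by simp_rw [hq]
    _ = ∫ y, Real.exp (-(1 / 2) * ‖y‖ ^ 2) ∂(Measure.map L volume) := by
        rw [integral_map hLc.aemeasurable (by fun_prop)]
    _ = |(B.det)⁻¹| * (Real.pi / (1 / 2)) ^ (d / 2 : ℝ) := by
        rw [hmap, integral_smul_measure,
          GaussianFourier.integral_rexp_neg_mul_sq_norm (by norm_num), hLdet,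
          ENNReal.toReal_ofReal (abs_nonneg _), finrank_euclideanSpace_fin, smul_eq_mul]
    _ = _ := by
        rw [Matrix.det_nonsing_inv, Ring.inverse_eq_inv', hdet, Real.sqrt_mul (by positivity),
          ← inv_pow, Real.sqrt_sq_eq_abs, mul_comm]
        congr 1
        rw [Real.sqrt_eq_rpow, ← Real.rpow_natCast, ← Real.rpow_mul (by positivity)]
        congr 1 <;> ring

lemma gaussDensity_inv {d : ℕ} {H : Matrix (Fin d) (Fin d) ℝ} (hH : H.PosDef) (w : Par d) :
    gaussDensity H⁻¹ w = gaussWeight H w / ∫ v, gaussWeight H v := by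
  rw [integral_gaussWeight hH, gaussDensity, gaussWeight,
    Matrix.nonsing_inv_nonsing_inv _ (Matrix.isUnit_iff_isUnit_det _ |>.1 hH.isUnit)]
  simp only [quadForm, div_eq_inv_mul]

/-! ### Contractions of symmetric tensors -/

section Contraction

variable {d : ℕ} {D : Fin d → Fin d → Fin d → ℝ} {E : Fin d → Fin d → Fin d → Fin d → ℝ}

/-- Contraction with a symmetric tensor does not see a permutation of the arguments of the other
factor: rename the summation indices, then use the symmetry of `D`. -/
lemma sum_three_swap_left (h : ∀ a b c, D b a c = D a b c) (φ : Fin d → Fin d → Fin d → ℝ) :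
    ∑ a, ∑ b, ∑ c, D a b c * φ b a c = ∑ a, ∑ b, ∑ c, D a b c * φ a b c := by
  rw [Finset.sum_comm]
  simp only [h]

lemma sum_three_swap_right (h : ∀ a b c, D a c b = D a b c) (φ : Fin d → Fin d → Fin d → ℝ) :
    ∑ a, ∑ b, ∑ c, D a b c * φ a c b = ∑ a, ∑ b, ∑ c, D a b c * φ a b c := by
  refine Finset.sum_congr rfl fun a _ => ?_
  rw [Finset.sum_comm]
  simp only [h]

lemma sum_three_rotate (h : ∀ a b c, D b a c = D a b c) (h' : ∀ a b c, D a c b = D a b c)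
    (φ : Fin d → Fin d → Fin d → ℝ) :
    ∑ a, ∑ b, ∑ c, D a b c * φ b c a = ∑ a, ∑ b, ∑ c, D a b c * φ a b c := by
  rw [sum_three_swap_left h fun a b c => φ a c b, sum_three_swap_right h']

variable {h : Fin d → Fin d → ℝ}

/-- The three pairings differ only in which index of the symmetric `D` is joined to `i`, so each
contributes the same amount. -/
lemma sum_pairing_one_three (h₁ : ∀ a b c, D b a c = D a b c) (h₂ : ∀ a b c, D a c b = D a b c)
    (hh : ∀ a b, h b a = h a b) (i : Fin d) :
    ∑ r, ∑ s, ∑ u, D r s u * (h i r * h s u + h i s * h r u + h i u * h r s - 3 * h i r * h s u)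
      = 0 := by
  have e1 := sum_three_swap_left h₁ fun r s u => h i r * h s u
  have e2 := sum_three_rotate h₁ h₂ fun r s u => h i s * h u r
  have e3 := sum_three_swap_left h₁ fun r s u => h i r * h s u
  simp only [mul_sub, mul_add, Finset.sum_add_distrib, Finset.sum_sub_distrib]
  have e4 : ∑ r, ∑ s, ∑ u, D r s u * (h i u * h r s) =
      ∑ r, ∑ s, ∑ u, D r s u * (h i s * h u r) := by
    rw [← e2]
  have e5 : ∑ r, ∑ s, ∑ u, D r s u * (h i s * h u r) =
      ∑ r, ∑ s, ∑ u, D r s u * (h i s * h r u) := by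
    refine Finset.sum_congr rfl fun r _ => Finset.sum_congr rfl fun s _ =>
      Finset.sum_congr rfl fun u _ => ?_
    rw [hh u r]
  have e6 : ∑ r, ∑ s, ∑ u, D r s u * (3 * h i r * h s u) =
      3 * ∑ r, ∑ s, ∑ u, D r s u * (h i r * h s u) := by
    simp only [Finset.mul_sum]
    refine Finset.sum_congr rfl fun r _ => Finset.sum_congr rfl fun s _ =>
      Finset.sum_congr rfl fun u _ => by ring
  rw [e4, e5, e6, e1]; ring

/-- With the first index frozen this is the preceding cancellation; only symmetry in the last three
indices is needed. -/
lemma sum_pairing_four (h₁ : ∀ a b c e, E a c b e = E a b c e)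
    (h₂ : ∀ a b c e, E a b e c = E a b c e) (hh : ∀ a b, h b a = h a b) :
    ∑ r, ∑ s, ∑ u, ∑ v, E r s u v *
      (h r s * h u v + h r u * h s v + h r v * h s u - 3 * h r s * h u v) = 0 :=
  Finset.sum_eq_zero fun r _ => sum_pairing_one_three (h₁ r) (h₂ r) hh r

/-- Of the fifteen pairings of two triples, nine have a single link between the triples and six have
three. Pairings of the same kind have equal contractions with the two copies of `D`, which explains
9 and 6. -/
lemma sum_pairing_six (h₁ : ∀ a b c, D b a c = D a b c) (h₂ : ∀ a b c, D a c b = D a b c)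
    (hh : ∀ a b, h b a = h a b) :
    ∑ i, ∑ j, ∑ k, ∑ l, ∑ m, ∑ n, D i j k * D l m n *
      ((h i j * (h k l * h m n + h k m * h l n + h k n * h l m)
      + h i k * (h j l * h m n + h j m * h l n + h j n * h l m)
      + h i l * (h j k * h m n + h j m * h k n + h j n * h k m)
      + h i m * (h j k * h l n + h j l * h k n + h j n * h k l)
      + h i n * (h j k * h l m + h j l * h k m + h j m * h k l))
      - 9 * h i j * h k l * h m n - 6 * h i l * h j m * h k n) = 0 := by
  -- one contraction between the triples
  let P : Fin d → Fin d → Fin d → ℝ := fun i j k =>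
    ∑ l, ∑ m, ∑ n, D l m n * (h i j * h k l * h m n)
  -- three contractions between the triples
  let Q : Fin d → Fin d → Fin d → ℝ := fun i j k =>
    ∑ l, ∑ m, ∑ n, D l m n * (h i l * h j m * h k n)
  have hP : ∀ i j k, ∑ l, ∑ m, ∑ n, D l m n *
      (h i j * (h k l * h m n + h k m * h l n + h k n * h l m)) = 3 * P i j k := by
    intro i j k
    have h0 := sum_pairing_one_three (h := h) h₁ h₂ hh k
    have : ∑ l, ∑ m, ∑ n, D l m n *
      (h i j * (h k l * h m n + h k m * h l n + h k n * h l m)) - 3 * P i j k = h i j *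
      ∑ l, ∑ m, ∑ n, D l m n *
        (h k l * h m n + h k m * h l n + h k n * h l m - 3 * h k l * h m n) := by
      simp only [P, Finset.mul_sum, ← Finset.sum_sub_distrib]
      refine Finset.sum_congr rfl fun l _ => Finset.sum_congr rfl fun m _ =>
        Finset.sum_congr rfl fun n _ => by ring
    rw [h0, mul_zero] at this
    linarith
  have hQ : ∀ i j k, ∑ l, ∑ m, ∑ n, D l m n *
      (h i l * (h j m * h k n + h j n * h k m) + h i m * (h j l * h k n + h j n * h k l)
        + h i n * (h j l * h k m + h j m * h k l)) = 6 * Q i j k := by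
    intro i j k
    have a1 := sum_three_swap_right h₂ fun l m n => h i l * h j m * h k n
    have a2 := sum_three_swap_left h₁ fun l m n => h i l * h j m * h k n
    have a3 := sum_three_rotate h₁ h₂ fun l m n => h i l * h j m * h k n
    have a4 := sum_three_rotate h₁ h₂ fun l m n => h i m * h j n * h k l
    have a5 := sum_three_rotate h₁ h₂ fun l m n => h i l * h j n * h k m
    have : ∑ l, ∑ m, ∑ n, D l m n *
      (h i l * (h j m * h k n + h j n * h k m) + h i m * (h j l * h k n + h j n * h k l)
        + h i n * (h j l * h k m + h j m * h k l)) =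
      ∑ l, ∑ m, ∑ n, D l m n * (h i l * h j m * h k n)
      + ∑ l, ∑ m, ∑ n, D l m n * (h i l * h j n * h k m)
      + ∑ l, ∑ m, ∑ n, D l m n * (h i m * h j l * h k n)
      + ∑ l, ∑ m, ∑ n, D l m n * (h i m * h j n * h k l)
      + ∑ l, ∑ m, ∑ n, D l m n * (h i n * h j l * h k m)
      + ∑ l, ∑ m, ∑ n, D l m n * (h i n * h j m * h k l) := by
      simp only [← Finset.sum_add_distrib]
      refine Finset.sum_congr rfl fun l _ => Finset.sum_congr rfl fun m _ =>
        Finset.sum_congr rfl fun n _ => by ring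
    have a6 := sum_three_rotate h₁ h₂ fun l m n => h i m * h j l * h k n
    simp only [Q]
    linarith
  have hP1 := sum_three_swap_right h₂ P
  have hP2 := sum_three_rotate h₁ h₂ P
  -- Pairing `i` inside its triple yields `P i j k` and `P i k j`; joining it to the other triple
  -- yields `P j k i` when `j`, `k` are paired, and `Q` otherwise. The outer contraction then
  -- identifies the three versions of `P`.
  have main : ∑ i, ∑ j, ∑ k, ∑ l, ∑ m, ∑ n, D i j k * D l m n *
      ((h i j * (h k l * h m n + h k m * h l n + h k n * h l m)
      + h i k * (h j l * h m n + h j m * h l n + h j n * h l m)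
      + h i l * (h j k * h m n + h j m * h k n + h j n * h k m)
      + h i m * (h j k * h l n + h j l * h k n + h j n * h k l)
      + h i n * (h j k * h l m + h j l * h k m + h j m * h k l))
      - 9 * h i j * h k l * h m n - 6 * h i l * h j m * h k n) =
      ∑ i, ∑ j, ∑ k, D i j k * (3 * P i j k + 3 * P i k j + 3 * P j k i + 6 * Q i j k
        - 9 * P i j k - 6 * Q i j k) := by
    refine Finset.sum_congr rfl fun i _ => Finset.sum_congr rfl fun j _ =>
      Finset.sum_congr rfl fun k _ => ?_
    have e1 : 9 * P i j k = ∑ l, ∑ m, ∑ n, D l m n * (9 * h i j * h k l * h m n) := by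
      simp only [P, Finset.mul_sum]
      refine Finset.sum_congr rfl fun l _ => Finset.sum_congr rfl fun m _ =>
        Finset.sum_congr rfl fun n _ => by ring
    have e2 : 6 * Q i j k = ∑ l, ∑ m, ∑ n, D l m n * (6 * h i l * h j m * h k n) := by
      simp only [Q, Finset.mul_sum]
      refine Finset.sum_congr rfl fun l _ => Finset.sum_congr rfl fun m _ =>
        Finset.sum_congr rfl fun n _ => by ring
    rw [← hP i j k, ← hP i k j, ← hP j k i]
    nth_rewrite 1 [← hQ i j k]
    rw [e1, e2]
    simp only [← Finset.sum_add_distrib, ← Finset.sum_sub_distrib, Finset.mul_sum]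
    refine Finset.sum_congr rfl fun l _ => Finset.sum_congr rfl fun m _ =>
        Finset.sum_congr rfl fun n _ => ?_
    rw [hh l k]
    ring
  rw [main]
  have split : ∑ i, ∑ j, ∑ k, D i j k * (3 * P i j k + 3 * P i k j + 3 * P j k i + 6 * Q i j k
        - 9 * P i j k - 6 * Q i j k) = 3 * ∑ i, ∑ j, ∑ k, D i j k * P i k j
        + 3 * ∑ i, ∑ j, ∑ k, D i j k * P j k i - 6 * ∑ i, ∑ j, ∑ k, D i j k * P i j k := by
    simp only [Finset.mul_sum, ← Finset.sum_add_distrib, ← Finset.sum_sub_distrib]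
    refine Finset.sum_congr rfl fun l _ => Finset.sum_congr rfl fun m _ =>
        Finset.sum_congr rfl fun n _ => by ring
  rw [split, hP1, hP2]; ring

end Contraction

/-! ### The correction polynomials -/

/-- The first-order correction with coefficient tensors `p` and `D`. -/
def linCubic {d : ℕ} (p : Fin d → ℝ) (D : Fin d → Fin d → Fin d → ℝ) (w : Par d) : ℝ :=
  (∑ i, p i * w i) - 1 / 6 * ∑ r, ∑ s, ∑ u, D r s u * (w r * w s * w u)

/-- The centred second-order correction with coefficient tensors `p`, `q`, `D`, `E`. -/
def centredSextic {d : ℕ} (h : Matrix (Fin d) (Fin d) ℝ) (p : Fin d → ℝ)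
    (q : Fin d → Fin d → ℝ) (D : Fin d → Fin d → Fin d → ℝ)
    (E : Fin d → Fin d → Fin d → Fin d → ℝ) (w : Par d) : ℝ :=
  1 / 2 * (∑ i, ∑ j, q i j * (w i * w j - h i j))
    - 1 / 6 * (∑ i, ∑ r, ∑ s, ∑ u, p i * D r s u *
        (w i * w r * w s * w u - 3 * h i r * h s u))
    - 1 / 24 * (∑ r, ∑ s, ∑ u, ∑ v, E r s u v *
        (w r * w s * w u * w v - 3 * h r s * h u v))
    + 1 / 72 * (∑ a, ∑ b, ∑ c, ∑ e, ∑ f, ∑ g, D a b c * D e f g *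
        (w a * w b * w c * w e * w f * w g
          - 9 * h a b * h c e * h f g - 6 * h a e * h b f * h c g))

section Corrections

variable {d : ℕ} {H : Matrix (Fin d) (Fin d) ℝ} {c : ℝ} {p : Fin d → ℝ} {q : Fin d → Fin d → ℝ}
  {D : Fin d → Fin d → Fin d → ℝ} {E : Fin d → Fin d → Fin d → Fin d → ℝ}

lemma polyGrowth_linCubic (p : Fin d → ℝ) (D : Fin d → Fin d → Fin d → ℝ) :
    PolyGrowth (linCubic p D) := by
  unfold linCubic
  repeat' first
    | exact PolyGrowth.const _
    | exact PolyGrowth.coord _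
    | refine PolyGrowth.sum _ fun _ => ?_
    | refine PolyGrowth.sub ?_ ?_
    | refine PolyGrowth.mul ?_ ?_

lemma gaussInt_linCubic : gaussInt H (linCubic p D) = 0 := by
  refine integral_odd_mul_gaussWeight fun w => ?_
  simp only [linCubic, PiLp.neg_apply, mul_neg, neg_mul, neg_neg, Finset.sum_neg_distrib]
  ring

lemma polyGrowth_centredSextic (h : Matrix (Fin d) (Fin d) ℝ) (p : Fin d → ℝ)
    (q : Fin d → Fin d → ℝ) (D : Fin d → Fin d → Fin d → ℝ)
    (E : Fin d → Fin d → Fin d → Fin d → ℝ) : PolyGrowth (centredSextic h p q D E) := by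
  unfold centredSextic
  repeat' first
    | exact PolyGrowth.const _
    | exact PolyGrowth.coord _
    | refine PolyGrowth.sum _ fun _ => ?_
    | refine PolyGrowth.sub ?_ ?_
    | refine PolyGrowth.add ?_ ?_
    | refine PolyGrowth.mul ?_ ?_

/-- By Wick's formula and the symmetry of `D` and `E`, the subtracted constants contract to the
Gaussian means of the monomials. This is why the second-order correction leaves the total mass
unchanged. -/
lemma gaussInt_centredSextic (hs : H.IsSymm) (hc : 0 < c)
    (hH : ∀ w, c * ‖w‖ ^ 2 ≤ quadForm H w)
    (hD : ∀ r s u, D s r u = D r s u) (hD' : ∀ r s u, D r u s = D r s u)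
    (hE : ∀ r s u v, E r u s v = E r s u v) (hE' : ∀ r s u v, E r s v u = E r s u v) :
    gaussInt H (centredSextic H⁻¹ p q D E) = 0 := by
  have hu : IsUnit H.det := (Matrix.isUnit_iff_isUnit_det _).1 (posDef_of_quadForm hs hc hH).isUnit
  have hh : ∀ a b, H⁻¹ b a = H⁻¹ a b := fun a b => by
    have : (H⁻¹)ᵀ = H⁻¹ := by rw [Matrix.transpose_nonsing_inv, hs.eq]
    exact congrFun (congrFun this a) b
  have pc := @PolyGrowth.coord d
  have pk := @PolyGrowth.const d
  set Z := gaussInt H fun _ => 1 with hZ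
  have P1 : ∀ i j, PolyGrowth fun w : Par d => q i j * (w i * w j - H⁻¹ i j) := fun i j =>
    (pk _).mul (((pc _).mul (pc _)).sub (pk _))
  have P2 : ∀ i r s u, PolyGrowth fun w : Par d =>
      p i * D r s u * (w i * w r * w s * w u - 3 * H⁻¹ i r * H⁻¹ s u) := fun i r s u =>
    (pk _).mul (((((pc _).mul (pc _)).mul (pc _)).mul (pc _)).sub (pk _))
  have P3 : ∀ r s u v, PolyGrowth fun w : Par d =>
      E r s u v * (w r * w s * w u * w v - 3 * H⁻¹ r s * H⁻¹ u v) := fun i r s u =>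
    (pk _).mul (((((pc _).mul (pc _)).mul (pc _)).mul (pc _)).sub (pk _))
  have P4 : ∀ i j k l m n, PolyGrowth fun w : Par d => D i j k * D l m n *
      (w i * w j * w k * w l * w m * w n - 9 * H⁻¹ i j * H⁻¹ k l * H⁻¹ m n
        - 6 * H⁻¹ i l * H⁻¹ j m * H⁻¹ k n) := fun i j k l m n =>
    (pk _).mul (((((((((pc _).mul (pc _)).mul (pc _)).mul (pc _)).mul (pc _)).mul (pc _))).sub
      (pk _)).sub (pk _))
  have S1 := fun i => PolyGrowth.sum Finset.univ fun j => P1 i j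
  have S1' := PolyGrowth.sum Finset.univ S1
  have S2 := fun i r s => PolyGrowth.sum Finset.univ fun j => P2 i r s j
  have S2' := fun i r => PolyGrowth.sum Finset.univ fun j => S2 i r j
  have S2'' := fun i => PolyGrowth.sum Finset.univ fun j => S2' i j
  have S2a := PolyGrowth.sum Finset.univ S2''
  have S3 := fun i r s => PolyGrowth.sum Finset.univ fun j => P3 i r s j
  have S3' := fun i r => PolyGrowth.sum Finset.univ fun j => S3 i r j
  have S3'' := fun i => PolyGrowth.sum Finset.univ fun j => S3' i j
  have S3a := PolyGrowth.sum Finset.univ S3''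
  have S4 := fun a b e f g => PolyGrowth.sum Finset.univ fun j => P4 a b e f g j
  have S4b := fun a b e f => PolyGrowth.sum Finset.univ fun j => S4 a b e f j
  have S4c := fun a b e => PolyGrowth.sum Finset.univ fun j => S4b a b e j
  have S4d := fun a b => PolyGrowth.sum Finset.univ fun j => S4c a b j
  have S4e := fun a => PolyGrowth.sum Finset.univ fun j => S4d a j
  have S4f := PolyGrowth.sum Finset.univ S4e
  have T1 : gaussInt H (fun w => ∑ i, ∑ j, q i j * (w i * w j - H⁻¹ i j)) = 0 := by
    rw [gaussInt_sum hc hH S1]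
    refine Finset.sum_eq_zero fun i _ => ?_
    rw [gaussInt_sum hc hH (P1 i)]
    refine Finset.sum_eq_zero fun j _ => ?_
    rw [gaussInt_const_mul, gaussInt_sub hc hH ((pc i).mul (pc j)) (pk _),
      gaussInt_coord_two hs hu hc hH, gaussInt_const H (H⁻¹ i j), sub_self, mul_zero]
  have m4 : ∀ i r s u : Fin d, gaussInt H (fun w => w i * w r * w s * w u) =
      (H⁻¹ i r * H⁻¹ s u + H⁻¹ i s * H⁻¹ r u + H⁻¹ i u * H⁻¹ r s) * Z := fun i r s u => by
    rw [hZ, ← gaussInt_coord_four hs hu hc hH]; simp only [mul_assoc]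
  have m6 := fun i j k l m n : Fin d =>
    (show gaussInt H (fun w => w i * w j * w k * w l * w m * w n) =
      gaussInt H (fun w => w i * (w j * (w k * (w l * (w m * w n))))) by
        simp only [mul_assoc]).trans (gaussInt_coord_six hs hu hc hH i j k l m n)
  have T2 : gaussInt H (fun w => ∑ i, ∑ r, ∑ s, ∑ u, p i * D r s u *
        (w i * w r * w s * w u - 3 * H⁻¹ i r * H⁻¹ s u)) = 0 := by
    rw [gaussInt_sum hc hH S2'']
    refine Finset.sum_eq_zero fun i _ => ?_
    rw [gaussInt_sum hc hH (S2' i)]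
    simp only [gaussInt_sum hc hH (S2 i _), gaussInt_sum hc hH (P2 i _ _)]
    have : ∀ r s u, gaussInt H (fun w => p i * D r s u *
        (w i * w r * w s * w u - 3 * H⁻¹ i r * H⁻¹ s u)) = p i * Z * (D r s u *
        (H⁻¹ i r * H⁻¹ s u + H⁻¹ i s * H⁻¹ r u + H⁻¹ i u * H⁻¹ r s - 3 * H⁻¹ i r * H⁻¹ s u)) := by
      intro r s u
      rw [gaussInt_const_mul, gaussInt_sub hc hH ((((pc _).mul (pc _)).mul (pc _)).mul (pc _))
        (pk _), m4, gaussInt_const H (3 * _ * _)]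
      ring
    simp only [this, ← Finset.mul_sum]
    rw [sum_pairing_one_three hD hD' hh i, mul_zero]
  have T3 : gaussInt H (fun w => ∑ r, ∑ s, ∑ u, ∑ v, E r s u v *
        (w r * w s * w u * w v - 3 * H⁻¹ r s * H⁻¹ u v)) = 0 := by
    rw [gaussInt_sum hc hH S3'']
    simp only [gaussInt_sum hc hH (S3' _), gaussInt_sum hc hH (S3 _ _), gaussInt_sum hc hH (P3 _ _ _)]
    have : ∀ i r s u, gaussInt H (fun w => E i r s u *
        (w i * w r * w s * w u - 3 * H⁻¹ i r * H⁻¹ s u)) = Z * (E i r s u *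
        (H⁻¹ i r * H⁻¹ s u + H⁻¹ i s * H⁻¹ r u + H⁻¹ i u * H⁻¹ r s - 3 * H⁻¹ i r * H⁻¹ s u)) := by
      intro i r s u
      rw [gaussInt_const_mul, gaussInt_sub hc hH ((((pc _).mul (pc _)).mul (pc _)).mul (pc _))
        (pk _), m4, gaussInt_const H (3 * _ * _)]
      ring
    simp only [this, ← Finset.mul_sum]
    rw [sum_pairing_four hE hE' hh, mul_zero]
  have T4 : gaussInt H (fun w => ∑ i, ∑ j, ∑ k, ∑ l, ∑ m, ∑ n, D i j k * D l m n *
      (w i * w j * w k * w l * w m * w n - 9 * H⁻¹ i j * H⁻¹ k l * H⁻¹ m n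
        - 6 * H⁻¹ i l * H⁻¹ j m * H⁻¹ k n)) = 0 := by
    rw [gaussInt_sum hc hH S4e]
    simp only [gaussInt_sum hc hH (S4d _), gaussInt_sum hc hH (S4c _ _),
      gaussInt_sum hc hH (S4b _ _ _), gaussInt_sum hc hH (S4 _ _ _ _),
      gaussInt_sum hc hH (P4 _ _ _ _ _)]
    have : ∀ i j k l m n, gaussInt H (fun w => D i j k * D l m n *
      (w i * w j * w k * w l * w m * w n - 9 * H⁻¹ i j * H⁻¹ k l * H⁻¹ m n
        - 6 * H⁻¹ i l * H⁻¹ j m * H⁻¹ k n)) = Z * (D i j k * D l m n *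
      ((H⁻¹ i j * (H⁻¹ k l * H⁻¹ m n + H⁻¹ k m * H⁻¹ l n + H⁻¹ k n * H⁻¹ l m)
      + H⁻¹ i k * (H⁻¹ j l * H⁻¹ m n + H⁻¹ j m * H⁻¹ l n + H⁻¹ j n * H⁻¹ l m)
      + H⁻¹ i l * (H⁻¹ j k * H⁻¹ m n + H⁻¹ j m * H⁻¹ k n + H⁻¹ j n * H⁻¹ k m)
      + H⁻¹ i m * (H⁻¹ j k * H⁻¹ l n + H⁻¹ j l * H⁻¹ k n + H⁻¹ j n * H⁻¹ k l)
      + H⁻¹ i n * (H⁻¹ j k * H⁻¹ l m + H⁻¹ j l * H⁻¹ k m + H⁻¹ j m * H⁻¹ k l))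
      - 9 * H⁻¹ i j * H⁻¹ k l * H⁻¹ m n - 6 * H⁻¹ i l * H⁻¹ j m * H⁻¹ k n)) := by
      intro i j k l m n
      have m := ((((((pc i).mul (pc j)).mul (pc k)).mul (pc l)).mul (pc m)).mul (pc n))
      rw [gaussInt_const_mul, gaussInt_sub hc hH (m.sub (pk _)) (pk _),
        gaussInt_sub hc hH m (pk _), m6, gaussInt_const H (9 * _ * _ * _),
        gaussInt_const H (6 * _ * _ * _)]
      ring
    simp only [this, ← Finset.mul_sum]
    rw [sum_pairing_six hD hD' hh, mul_zero]
  unfold centredSextic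
  rw [gaussInt_add hc hH ((((pk _).mul S1').sub ((pk _).mul S2a)).sub ((pk _).mul S3a))
      ((pk _).mul S4f),
    gaussInt_sub hc hH (((pk _).mul S1').sub ((pk _).mul S2a)) ((pk _).mul S3a),
    gaussInt_sub hc hH ((pk _).mul S1') ((pk _).mul S2a)]
  simp only [gaussInt_const_mul]
  rw [T1, T2, T3, T4]
  ring

end Corrections

/-! ### Symmetry of higher derivatives -/

section Symmetry

variable {E F : Type*} [NormedAddCommGroup E] [NormedSpace ℝ E] [NormedAddCommGroup F]
  [NormedSpace ℝ F] {f : E → F} {x : E}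

/-- The first slot is the direction of the last differentiation. Symmetry in the first two slots
thus becomes Schwarz's theorem for a function with the other slots frozen, and symmetry in later
slots survives differentiation. -/
lemma ContDiffAt.iteratedFDeriv_cons {k : ℕ} (hf : ContDiffAt ℝ (k + 1 : ℕ) f x) (a : E)
    (v : Fin k → E) : iteratedFDeriv ℝ (k + 1) f x (Matrix.vecCons a v) =
      fderiv ℝ (fun y => iteratedFDeriv ℝ k f y v) x a := by
  have hd : DifferentiableAt ℝ (iteratedFDeriv ℝ k f) x :=
    hf.differentiableAt_iteratedFDeriv (by exact_mod_cast Nat.lt_succ_self k)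
  rw [hd.iteratedFDeriv_succ_apply_left']
  simp [Fin.tail_def]

/-- The first two arguments of an iterated derivative may be exchanged. -/
lemma ContDiffAt.iteratedFDeriv_swap {k : ℕ} (hf : ContDiffAt ℝ (k + 2 : ℕ) f x) (a b : E)
    (v : Fin k → E) : iteratedFDeriv ℝ (k + 2) f x (Matrix.vecCons a (Matrix.vecCons b v)) =
      iteratedFDeriv ℝ (k + 2) f x (Matrix.vecCons b (Matrix.vecCons a v)) := by
  -- With the last `k` slots frozen, both sides are second derivatives of `g`.
  set g : E → F := fun y => iteratedFDeriv ℝ k f y v with hg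
  have hgc : ContDiffAt ℝ 2 g x := by
    have h1 : ContDiffAt ℝ 2 (iteratedFDeriv ℝ k f) x :=
      hf.iteratedFDeriv_right (m := 2) (by push_cast; rw [add_comm])
    exact h1.continuousLinearMap_comp (ContinuousMultilinearMap.apply ℝ (fun _ => E) F v)
  have hev : ∀ᶠ y in 𝓝 x, ContDiffAt ℝ (k + 1 : ℕ) f y :=
    (hf.of_le (by exact_mod_cast Nat.le_succ (k + 1))).eventually (by simp)
  have key : ∀ a b : E, iteratedFDeriv ℝ (k + 2) f x (Matrix.vecCons a (Matrix.vecCons b v)) =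
      fderiv ℝ (fderiv ℝ g) x a b := by
    intro a b
    rw [ContDiffAt.iteratedFDeriv_cons (k := k + 1) hf]
    have h2 : (fun y => iteratedFDeriv ℝ (k + 1) f y (Matrix.vecCons b v)) =ᶠ[𝓝 x]
        fun y => fderiv ℝ g y b := by
      filter_upwards [hev] with y hy
      rw [hy.iteratedFDeriv_cons]
    rw [h2.fderiv_eq]
    have h3 : DifferentiableAt ℝ (fderiv ℝ g) x :=
      (hgc.fderiv_right (m := 1) (by norm_num)).differentiableAt (by norm_num)
    rw [fderiv_clm_apply h3 (differentiableAt_const b)]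
    simp
  rw [key, key]
  exact (hgc.isSymmSndFDerivAt (by simp)).eq a b

/-- A symmetry of a lower order derivative near a point is inherited by higher derivatives. -/
lemma ContDiffAt.iteratedFDeriv_cons_congr {k : ℕ} (hf : ContDiffAt ℝ (k + 1 : ℕ) f x) (a : E)
    {v v' : Fin k → E} (h : ∀ᶠ y in 𝓝 x, iteratedFDeriv ℝ k f y v = iteratedFDeriv ℝ k f y v') :
    iteratedFDeriv ℝ (k + 1) f x (Matrix.vecCons a v) =
      iteratedFDeriv ℝ (k + 1) f x (Matrix.vecCons a v') := by
  rw [hf.iteratedFDeriv_cons, hf.iteratedFDeriv_cons]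
  exact congrArg (fun L : E →L[ℝ] F => L a) (Filter.EventuallyEq.fderiv_eq h)

lemma ContDiffAt.eventually_nat {k m : ℕ} (hf : ContDiffAt ℝ (k : ℕ) f x) (h : m ≤ k) :
    ∀ᶠ y in 𝓝 x, ContDiffAt ℝ (m : ℕ) f y :=
  (hf.of_le (by exact_mod_cast h)).eventually (by simp)

lemma ContDiffAt.iteratedFDeriv_three_swap_right (hf : ContDiffAt ℝ (3 : ℕ) f x) (a b c : E) :
    iteratedFDeriv ℝ 3 f x ![a, c, b] = iteratedFDeriv ℝ 3 f x ![a, b, c] :=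
  hf.iteratedFDeriv_cons_congr (k := 2) a
    ((hf.eventually_nat (m := 2) (by norm_num)).mono fun _ hy => hy.iteratedFDeriv_swap (k := 0) c b ![])

lemma ContDiffAt.iteratedFDeriv_four_swap_mid (hf : ContDiffAt ℝ (4 : ℕ) f x) (a b c e : E) :
    iteratedFDeriv ℝ 4 f x ![a, c, b, e] = iteratedFDeriv ℝ 4 f x ![a, b, c, e] :=
  hf.iteratedFDeriv_cons_congr (k := 3) a
    ((hf.eventually_nat (m := 3) (by norm_num)).mono
      fun _ hy => hy.iteratedFDeriv_swap (k := 1) c b ![e])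

lemma ContDiffAt.iteratedFDeriv_four_swap_right (hf : ContDiffAt ℝ (4 : ℕ) f x) (a b c e : E) :
    iteratedFDeriv ℝ 4 f x ![a, b, e, c] = iteratedFDeriv ℝ 4 f x ![a, b, c, e] :=
  hf.iteratedFDeriv_cons_congr (k := 3) a
    ((hf.eventually_nat (m := 3) (by norm_num)).mono
      fun _ hy => hy.iteratedFDeriv_three_swap_right b c e)

end Symmetry

/-! ### Expansion of multilinear maps in coordinates -/

section Multilinear

variable {d k : ℕ}

lemma Par.sum_coord_smul_single (x : Par d) :
    x = ∑ i, x i • EuclideanSpace.single i (1 : ℝ) := by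
  ext j
  simp [Pi.single_apply]

lemma ContinuousMultilinearMap.sum_coord (T : ContinuousMultilinearMap ℝ (fun _ : Fin k => Par d) ℝ)
    (v : Fin k → Par d) :
    T v = ∑ I : Fin k → Fin d, (∏ m, v m (I m)) *
      T (fun m => EuclideanSpace.single (I m) (1 : ℝ)) := by
  conv_lhs => rw [show v = fun m => ∑ i, v m i • EuclideanSpace.single i (1 : ℝ) from
    funext fun m => Par.sum_coord_smul_single (v m)]
  rw [ContinuousMultilinearMap.map_sum]
  refine Finset.sum_congr rfl fun I _ => ?_
  rw [ContinuousMultilinearMap.map_smul_univ, smul_eq_mul]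

lemma ContinuousMultilinearMap.norm_le_sum_coord
    (T : ContinuousMultilinearMap ℝ (fun _ : Fin k => Par d) ℝ) :
    ‖T‖ ≤ ∑ I : Fin k → Fin d, |T (fun m => EuclideanSpace.single (I m) (1 : ℝ))| := by
  refine ContinuousMultilinearMap.opNorm_le_bound (by positivity) fun v => ?_
  rw [T.sum_coord v, Finset.sum_mul]
  refine (norm_sum_le _ _).trans (Finset.sum_le_sum fun I _ => ?_)
  rw [norm_mul, mul_comm, norm_prod]
  refine mul_le_mul_of_nonneg_left ?_ (abs_nonneg _)
  exact Finset.prod_le_prod (fun _ _ => norm_nonneg _) fun m _ => PiLp.norm_apply_le (v m) (I m)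

lemma sum_fun_fin_succ {M : Type*} [AddCommMonoid M] (F : (Fin (k + 1) → Fin d) → M) :
    ∑ I, F I = ∑ i, ∑ J : Fin k → Fin d, F (Matrix.vecCons i J) := by
  rw [← Fintype.sum_prod_type']
  exact (Fintype.sum_equiv (Fin.consEquiv fun _ => Fin d) _ _ fun _ => rfl).symm

lemma sum_fun_fin_zero {M : Type*} [AddCommMonoid M] (F : (Fin 0 → Fin d) → M) :
    ∑ I, F I = F ![] := by
  rw [Fintype.sum_unique]; congr 1

variable (T₁ : ContinuousMultilinearMap ℝ (fun _ : Fin 1 => Par d) ℝ)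
  (T₂ : ContinuousMultilinearMap ℝ (fun _ : Fin 2 => Par d) ℝ)
  (T₃ : ContinuousMultilinearMap ℝ (fun _ : Fin 3 => Par d) ℝ)
  (T₄ : ContinuousMultilinearMap ℝ (fun _ : Fin 4 => Par d) ℝ)

/-- The value of a multilinear map at basis vectors. -/
def ContinuousMultilinearMap.entry (T : ContinuousMultilinearMap ℝ (fun _ : Fin k => Par d) ℝ)
    (I : Fin k → Fin d) : ℝ :=
  T fun m => EuclideanSpace.single (I m) (1 : ℝ)

lemma ContinuousMultilinearMap.sum_coord_one (v : Fin 1 → Par d) :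
    T₁ v = ∑ i, v 0 i * T₁.entry ![i] := by
  rw [T₁.sum_coord]
  simp [sum_fun_fin_succ, ContinuousMultilinearMap.entry]

lemma ContinuousMultilinearMap.sum_coord_two (v : Fin 2 → Par d) :
    T₂ v = ∑ i, ∑ j, v 0 i * v 1 j * T₂.entry ![i, j] := by
  rw [T₂.sum_coord]
  simp only [sum_fun_fin_succ, sum_fun_fin_zero, ContinuousMultilinearMap.entry, Fin.prod_univ_two]
  rfl

lemma ContinuousMultilinearMap.sum_coord_three (v : Fin 3 → Par d) :
    T₃ v = ∑ i, ∑ j, ∑ l, v 0 i * v 1 j * v 2 l * T₃.entry ![i, j, l] := by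
  rw [T₃.sum_coord]
  simp only [sum_fun_fin_succ, sum_fun_fin_zero, ContinuousMultilinearMap.entry,
    Fin.prod_univ_three]
  rfl

lemma ContinuousMultilinearMap.sum_coord_four (v : Fin 4 → Par d) :
    T₄ v = ∑ i, ∑ j, ∑ l, ∑ m, v 0 i * v 1 j * v 2 l * v 3 m * T₄.entry ![i, j, l, m] := by
  rw [T₄.sum_coord]
  simp only [sum_fun_fin_succ, sum_fun_fin_zero, ContinuousMultilinearMap.entry,
    Fin.prod_univ_four]
  rfl

end Multilinear

/-! ### The tensors of the expansion -/

section Tensors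

variable {d n : ℕ} {f : Par d → ℝ} {C : Matrix (Fin d) (Fin d) ℝ} {t : Par d}

/-- The linear map of a matrix. -/
def mulVecL (C : Matrix (Fin d) (Fin d) ℝ) : Par d →L[ℝ] Par d := Matrix.toEuclideanCLM (𝕜 := ℝ) C

lemma mulVecL_apply (C : Matrix (Fin d) (Fin d) ℝ) (w : Par d) :
    mulVecL C w = WithLp.toLp 2 (C *ᵥ w.ofLp) := rfl

lemma mulVecL_single (C : Matrix (Fin d) (Fin d) ℝ) (r i : Fin d) :
    mulVecL C (EuclideanSpace.single r 1) i = C i r := by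
  simp [mulVecL_apply]

lemma calib_eq (C : Matrix (Fin d) (Fin d) ℝ) (t θ : Par d) :
    calib C t θ = t + mulVecL C (θ - t) := rfl

/-- The calibrated tensors are the entries of the derivatives of the score pulled back along `C`,
divided by n. This allows index sums to be replaced by values of multilinear maps at `mulVecL C w`.
-/
lemma Hmat_eq (r s : Fin d) :
    Hmat n f C t r s = (n : ℝ)⁻¹ * ((iteratedFDeriv ℝ 2 f t).compContinuousLinearMap
      fun _ => mulVecL C).entry ![r, s] := by
  rw [ContinuousMultilinearMap.entry, ContinuousMultilinearMap.compContinuousLinearMap_apply,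
    ContinuousMultilinearMap.sum_coord_two, Finset.sum_comm]
  simp only [mulVecL_single, Hmat, Matrix.smul_apply, smul_eq_mul, Matrix.mul_apply,
    Finset.sum_mul, Matrix.transpose_apply]
  congr 1
  refine Finset.sum_congr rfl fun i _ => Finset.sum_congr rfl fun j _ => ?_
  change C j r * pd f ![j, i] t * C i s = _ * pd f ![j, i] t
  simp only [Matrix.cons_val]
  ring

lemma quadForm_Hmat (w : Par d) :
    quadForm (Hmat n f C t) w =
      (n : ℝ)⁻¹ * iteratedFDeriv ℝ 2 f t (fun _ => mulVecL C w) := by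
  have h := ContinuousMultilinearMap.sum_coord_two
    ((iteratedFDeriv ℝ 2 f t).compContinuousLinearMap fun _ => mulVecL C) fun _ => w
  rw [ContinuousMultilinearMap.compContinuousLinearMap_apply] at h
  rw [h]
  simp only [quadForm, Hmat_eq, Finset.mul_sum]
  refine Finset.sum_congr rfl fun i _ => Finset.sum_congr rfl fun j _ => by ring

lemma calD3_eq (r s u : Fin d) :
    calD3 n f C t r s u = (n : ℝ)⁻¹ * ((iteratedFDeriv ℝ 3 f t).compContinuousLinearMap
      fun _ => mulVecL C).entry ![r, s, u] := by
  rw [ContinuousMultilinearMap.entry, ContinuousMultilinearMap.compContinuousLinearMap_apply,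
    ContinuousMultilinearMap.sum_coord_three]
  simp only [mulVecL_single, calD3, Finset.mul_sum]
  refine Finset.sum_congr rfl fun i _ => Finset.sum_congr rfl fun j _ =>
    Finset.sum_congr rfl fun k _ => ?_
  change pd f ![i, j, k] t / n * _ = (n : ℝ)⁻¹ * (_ * pd f ![i, j, k] t)
  simp only [Matrix.cons_val]
  ring

lemma calD4_eq (r s u v : Fin d) :
    calD4 n f C t r s u v = (n : ℝ)⁻¹ * ((iteratedFDeriv ℝ 4 f t).compContinuousLinearMap
      fun _ => mulVecL C).entry ![r, s, u, v] := by
  rw [ContinuousMultilinearMap.entry, ContinuousMultilinearMap.compContinuousLinearMap_apply,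
    ContinuousMultilinearMap.sum_coord_four]
  simp only [mulVecL_single, calD4, Finset.mul_sum]
  refine Finset.sum_congr rfl fun i _ => Finset.sum_congr rfl fun j _ =>
    Finset.sum_congr rfl fun k _ => Finset.sum_congr rfl fun l _ => ?_
  change pd f ![i, j, k, l] t / n * _ = (n : ℝ)⁻¹ * (_ * pd f ![i, j, k, l] t)
  simp only [Matrix.cons_val]
  ring

lemma sum_calD3 (w : Par d) :
    ∑ r, ∑ s, ∑ u, calD3 n f C t r s u * (w r * w s * w u) =
      (n : ℝ)⁻¹ * iteratedFDeriv ℝ 3 f t (fun _ => mulVecL C w) := by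
  have h := ContinuousMultilinearMap.sum_coord_three
    ((iteratedFDeriv ℝ 3 f t).compContinuousLinearMap fun _ => mulVecL C) fun _ => w
  rw [ContinuousMultilinearMap.compContinuousLinearMap_apply] at h
  rw [h]
  simp only [calD3_eq, Finset.mul_sum]
  refine Finset.sum_congr rfl fun i _ => Finset.sum_congr rfl fun j _ =>
    Finset.sum_congr rfl fun k _ => by ring

lemma sum_calD4 (w : Par d) :
    ∑ r, ∑ s, ∑ u, ∑ v, calD4 n f C t r s u v * (w r * w s * w u * w v) =
      (n : ℝ)⁻¹ * iteratedFDeriv ℝ 4 f t (fun _ => mulVecL C w) := by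
  have h := ContinuousMultilinearMap.sum_coord_four
    ((iteratedFDeriv ℝ 4 f t).compContinuousLinearMap fun _ => mulVecL C) fun _ => w
  rw [ContinuousMultilinearMap.compContinuousLinearMap_apply] at h
  rw [h]
  simp only [calD4_eq, Finset.mul_sum]
  refine Finset.sum_congr rfl fun i _ => Finset.sum_congr rfl fun j _ =>
    Finset.sum_congr rfl fun k _ => Finset.sum_congr rfl fun l _ => by ring

lemma entry_three (T : ContinuousMultilinearMap ℝ (fun _ : Fin 3 => Par d) ℝ) (r s u : Fin d) :
    (T.compContinuousLinearMap fun _ => mulVecL C).entry ![r, s, u] =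
      T ![mulVecL C (EuclideanSpace.single r 1), mulVecL C (EuclideanSpace.single s 1),
        mulVecL C (EuclideanSpace.single u 1)] :=
  congrArg T (funext fun m => by fin_cases m <;> rfl)

lemma entry_four (T : ContinuousMultilinearMap ℝ (fun _ : Fin 4 => Par d) ℝ) (r s u v : Fin d) :
    (T.compContinuousLinearMap fun _ => mulVecL C).entry ![r, s, u, v] =
      T ![mulVecL C (EuclideanSpace.single r 1), mulVecL C (EuclideanSpace.single s 1),
        mulVecL C (EuclideanSpace.single u 1), mulVecL C (EuclideanSpace.single v 1)] :=
  congrArg T (funext fun m => by fin_cases m <;> rfl)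

lemma entry_two (T : ContinuousMultilinearMap ℝ (fun _ : Fin 2 => Par d) ℝ) (r s : Fin d) :
    (T.compContinuousLinearMap fun _ => mulVecL C).entry ![r, s] =
      T ![mulVecL C (EuclideanSpace.single r 1), mulVecL C (EuclideanSpace.single s 1)] :=
  congrArg T (funext fun m => by fin_cases m <;> rfl)

lemma isSymm_Hmat (hf : ContDiffAt ℝ (2 : ℕ) f t) : (Hmat n f C t).IsSymm := by
  ext r s
  rw [Matrix.transpose_apply, Hmat_eq, Hmat_eq, entry_two, entry_two]
  exact congrArg _ (hf.iteratedFDeriv_swap (k := 0) _ _ ![])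

lemma calD3_swap_left (hf : ContDiffAt ℝ (3 : ℕ) f t) (r s u : Fin d) :
    calD3 n f C t s r u = calD3 n f C t r s u := by
  rw [calD3_eq, calD3_eq, entry_three, entry_three]
  exact congrArg _ (hf.iteratedFDeriv_swap (k := 1) _ _ ![_])

lemma calD3_swap_right (hf : ContDiffAt ℝ (3 : ℕ) f t) (r s u : Fin d) :
    calD3 n f C t r u s = calD3 n f C t r s u := by
  rw [calD3_eq, calD3_eq, entry_three, entry_three, hf.iteratedFDeriv_three_swap_right]

lemma calD4_swap_mid (hf : ContDiffAt ℝ (4 : ℕ) f t) (r s u v : Fin d) :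
    calD4 n f C t r u s v = calD4 n f C t r s u v := by
  rw [calD4_eq, calD4_eq, entry_four, entry_four, hf.iteratedFDeriv_four_swap_mid]

lemma calD4_swap_right (hf : ContDiffAt ℝ (4 : ℕ) f t) (r s u v : Fin d) :
    calD4 n f C t r s v u = calD4 n f C t r s u v := by
  rw [calD4_eq, calD4_eq, entry_four, entry_four, hf.iteratedFDeriv_four_swap_right]

end Tensors

/-! ### Taylor bounds -/

section Taylor

variable {E : Type*} [NormedAddCommGroup E] [NormedSpace ℝ E] {f : E → ℝ}

/-- Taylor's formula with integral remainder on a segment inside the convex ball. The factors 1/k!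
and (1 - s)^k are merely bounded by 1. -/
lemma abs_sub_taylor_le {k : ℕ} {x₀ x y : E} {ρ M : ℝ} (hf : ContDiffOn ℝ (k + 1 : ℕ) f (Metric.ball x₀ ρ))
    (hx : x ∈ Metric.ball x₀ ρ) (hy : x + y ∈ Metric.ball x₀ ρ)
    (hM : ∀ z ∈ Metric.ball x₀ ρ, ‖iteratedFDeriv ℝ (k + 1) f z‖ ≤ M) :
    |f (x + y) - ∑ j ∈ Finset.range (k + 1), (j.factorial : ℝ)⁻¹ * iteratedFDeriv ℝ j f x fun _ => y|
      ≤ M * ‖y‖ ^ (k + 1) := by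
  have hseg : ∀ s ∈ Set.Icc (0 : ℝ) 1, x + s • y ∈ Metric.ball x₀ ρ := fun s hs => by
    have := (convex_ball x₀ ρ).add_smul_sub_mem hx hy hs
    simpa using this
  have hT := map_add_eq_sum_add_integral_iteratedFDeriv (f := f) (x := x) (y := y) (n := k)
    fun s hs => (hf.contDiffAt (Metric.isOpen_ball.mem_nhds (hseg s hs))).of_le (by norm_cast)
  simp only [smul_eq_mul] at hT
  rw [hT, add_sub_cancel_left, abs_mul]
  have hM0 : 0 ≤ M := (norm_nonneg _).trans (hM x hx)
  have h1 : |((k.factorial : ℝ))⁻¹| ≤ 1 := by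
    rw [abs_of_nonneg (by positivity)]
    exact inv_le_one_of_one_le₀ (by exact_mod_cast Nat.one_le_iff_ne_zero.2 k.factorial_ne_zero)
  have h2 : |∫ s in (0:ℝ)..1, (1 - s) ^ k * iteratedFDeriv ℝ (k + 1) f (x + s • y) fun _ => y| ≤
      M * ‖y‖ ^ (k + 1) := by
    have := intervalIntegral.norm_integral_le_of_norm_le_const (a := (0:ℝ)) (b := 1)
      (f := fun s => (1 - s) ^ k * iteratedFDeriv ℝ (k + 1) f (x + s • y) fun _ => y)
      (C := M * ‖y‖ ^ (k + 1)) fun s hs => by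
        rw [Set.uIoc_of_le zero_le_one] at hs
        rw [norm_mul, norm_pow, Real.norm_of_nonneg (by linarith [hs.2])]
        have h3 := (iteratedFDeriv ℝ (k + 1) f (x + s • y)).le_opNorm fun _ => y
        rw [Finset.prod_const, Finset.card_univ, Fintype.card_fin] at h3
        calc _ ≤ 1 * (M * ‖y‖ ^ (k + 1)) := by
              refine mul_le_mul (pow_le_one₀ (by linarith [hs.2]) (by linarith [hs.1]))
                (h3.trans ?_) (norm_nonneg _) zero_le_one
              gcongr
              exact hM _ (hseg s ⟨hs.1.le, hs.2⟩)
          _ = _ := one_mul _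
    simpa using this
  calc _ ≤ 1 * (M * ‖y‖ ^ (k + 1)) := mul_le_mul h1 h2 (abs_nonneg _) zero_le_one
    _ = _ := one_mul _

lemma norm_iteratedFDeriv_sub_le {k : ℕ} {x₀ x y : E} {ρ M : ℝ}
    (hf : ContDiffOn ℝ (k + 1 : ℕ) f (Metric.ball x₀ ρ)) (hx : x ∈ Metric.ball x₀ ρ)
    (hy : y ∈ Metric.ball x₀ ρ)
    (hM : ∀ z ∈ Metric.ball x₀ ρ, ‖iteratedFDeriv ℝ (k + 1) f z‖ ≤ M) :
    ‖iteratedFDeriv ℝ k f y - iteratedFDeriv ℝ k f x‖ ≤ M * ‖y - x‖ := by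
  refine (convex_ball x₀ ρ).norm_image_sub_le_of_norm_fderiv_le (𝕜 := ℝ) (fun z hz => ?_)
    (fun z hz => ?_) hx hy
  · exact (hf.contDiffAt (Metric.isOpen_ball.mem_nhds hz)).differentiableAt_iteratedFDeriv
      (by exact_mod_cast Nat.lt_succ_self k)
  · rw [norm_fderiv_iteratedFDeriv]; exact hM z hz

/-- The mean value inequality carries a bound one order down, given a bound at the centre. Iterated,
it controls orders four, three and two from the domination of the fifth derivative. -/
lemma norm_iteratedFDeriv_le_of_center {k : ℕ} {x₀ : E} {ρ M B : ℝ} (hρ : 0 < ρ)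
    (hf : ContDiffOn ℝ (k + 1 : ℕ) f (Metric.ball x₀ ρ))
    (hM : ∀ z ∈ Metric.ball x₀ ρ, ‖iteratedFDeriv ℝ (k + 1) f z‖ ≤ M)
    (hB : ‖iteratedFDeriv ℝ k f x₀‖ ≤ B) :
    ∀ z ∈ Metric.ball x₀ ρ, ‖iteratedFDeriv ℝ k f z‖ ≤ B + M * ρ := by
  intro z hz
  have h := norm_iteratedFDeriv_sub_le hf (Metric.mem_ball_self hρ) hz hM
  have hM0 : 0 ≤ M := (norm_nonneg _).trans (hM z hz)
  have h1 : ‖z - x₀‖ ≤ ρ := by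
    rw [← dist_eq_norm]; exact (Metric.mem_ball.1 hz).le
  calc ‖iteratedFDeriv ℝ k f z‖ ≤ ‖iteratedFDeriv ℝ k f x₀‖
        + ‖iteratedFDeriv ℝ k f z - iteratedFDeriv ℝ k f x₀‖ := by
        rw [add_comm]; exact norm_le_norm_sub_add _ _
    _ ≤ B + M * ρ := by gcongr; exact h.trans (by gcongr)

end Taylor

/-! ### Second order jets -/

lemma Real.abs_exp_sub_quadratic_le (x : ℝ) :
    |Real.exp x - (1 + x + x ^ 2 / 2)| ≤ |x| ^ 3 * Real.exp |x| := by
  have h := Complex.norm_exp_sub_sum_le_norm_mul_exp x 3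
  rw [Complex.norm_real] at h
  simp only [Finset.sum_range_succ, Finset.sum_range_zero] at h
  convert h using 1
  · rw [← Real.norm_eq_abs, ← Complex.norm_real]
    congr 1
    push_cast
    norm_num [Nat.factorial]
  · simp only [Real.norm_eq_abs]

/-- With x = ua + u²b + r, the term x²/2 differs from u²a²/2 by (x - ua)(x + ua)/2 = O(u³). The
factor exp y is kept because y will be a small multiple of ‖w‖², to be absorbed by the Gaussian. The
constant is 27 from |x|³ ≤ (3Au)³ plus 5 from A + 4A². -/
lemma abs_exp_sub_jet_le {u A a b r y : ℝ} (hu : 0 ≤ u) (hu1 : u ≤ 1) (hA : 1 ≤ A) (ha : |a| ≤ A)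
    (hb : |b| ≤ A) (hr : |r| ≤ A * u ^ 3) (hy : |u * a + u ^ 2 * b + r| ≤ y) :
    |Real.exp (u * a + u ^ 2 * b + r) - (1 + u * a + u ^ 2 * (b + a ^ 2 / 2))|
      ≤ 32 * A ^ 3 * u ^ 3 * Real.exp y := by
  set x := u * a + u ^ 2 * b + r with hx
  have hA0 : 0 ≤ A := by linarith
  have hy0 : 1 ≤ Real.exp y := Real.one_le_exp ((abs_nonneg x).trans hy)
  have hu2 : u ^ 2 ≤ u := by nlinarith
  have hu3 : u ^ 3 ≤ u ^ 2 := by nlinarith [sq_nonneg u]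
  have h1 : |x - u * a| ≤ 2 * A * u ^ 2 := by
    have : x - u * a = u ^ 2 * b + r := by rw [hx]; ring
    rw [this]
    calc |u ^ 2 * b + r| ≤ |u ^ 2 * b| + |r| := abs_add_le _ _
      _ ≤ u ^ 2 * A + A * u ^ 2 := by
          rw [abs_mul, abs_of_nonneg (sq_nonneg u)]
          gcongr
          exact hr.trans (by gcongr)
      _ = _ := by ring
  have hua : |u * a| ≤ A * u := by
    rw [abs_mul, abs_of_nonneg hu, mul_comm]; gcongr
  have h2 : |x| ≤ 3 * A * u := by
    calc |x| = |(x - u * a) + u * a| := by ring_nf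
      _ ≤ |x - u * a| + |u * a| := abs_add_le _ _
      _ ≤ 2 * A * u ^ 2 + A * u := add_le_add h1 hua
      _ ≤ 2 * A * u + A * u := by gcongr
      _ = _ := by ring
  have h3 : |x + u * a| ≤ 4 * A * u := by
    calc _ ≤ |x| + |u * a| := abs_add_le _ _
      _ ≤ 3 * A * u + A * u := add_le_add h2 hua
      _ = _ := by ring
  have h4 : Real.exp x - (1 + u * a + u ^ 2 * (b + a ^ 2 / 2)) =
      (Real.exp x - (1 + x + x ^ 2 / 2)) + (r + (x - u * a) * (x + u * a) / 2) := by
    rw [hx]; ring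
  have h5 : |x| ^ 3 * Real.exp |x| ≤ (3 * A * u) ^ 3 * Real.exp y := by gcongr
  have h6 : |(x - u * a) * (x + u * a) / 2| ≤ 2 * A * u ^ 2 * (4 * A * u) / 2 := by
    rw [abs_div, abs_mul, abs_of_pos (two_pos : (0:ℝ) < 2)]
    gcongr
  have hA1 : A ≤ A ^ 3 := le_self_pow₀ hA (by norm_num)
  have hA2 : A ^ 2 ≤ A ^ 3 := pow_le_pow_right₀ hA (by norm_num)
  have hu30 : 0 ≤ u ^ 3 := by positivity
  rw [h4]
  calc _ ≤ |Real.exp x - (1 + x + x ^ 2 / 2)| + (|r| + |(x - u * a) * (x + u * a) / 2|) :=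
        (abs_add_le _ _).trans (add_le_add le_rfl (abs_add_le _ _))
    _ ≤ (3 * A * u) ^ 3 * Real.exp y + (A * u ^ 3 + 2 * A * u ^ 2 * (4 * A * u) / 2) :=
        add_le_add ((Real.abs_exp_sub_quadratic_le x).trans h5) (add_le_add hr h6)
    _ = 27 * A ^ 3 * u ^ 3 * Real.exp y + (A + 4 * A ^ 2) * u ^ 3 := by ring
    _ ≤ 27 * A ^ 3 * u ^ 3 * Real.exp y + (5 * A ^ 3) * u ^ 3 * Real.exp y := by
        refine add_le_add le_rfl ?_
        calc (A + 4 * A ^ 2) * u ^ 3 ≤ (5 * A ^ 3) * u ^ 3 := by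
              gcongr; linarith
          _ ≤ _ := le_mul_of_one_le_right (by positivity) hy0
    _ = _ := by ring

/-- Product of the prior jet and the exponential jet. The constant is 1 (error of `P`) + 3·32 (error
of the exponential) + 5 (product terms of orders u³ and u⁴). -/
lemma abs_mul_exp_sub_jet_le {u A a b r y P p q : ℝ} (hu : 0 ≤ u) (hu1 : u ≤ 1) (hA : 1 ≤ A)
    (ha : |a| ≤ A) (hb : |b| ≤ A) (hr : |r| ≤ A * u ^ 3) (hy : |u * a + u ^ 2 * b + r| ≤ y)
    (hp : |p| ≤ A) (hq : |q| ≤ A) (hP : |P - (1 + u * p + u ^ 2 * q)| ≤ A * u ^ 3) :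
    |P * Real.exp (u * a + u ^ 2 * b + r) -
        (1 + u * (p + a) + u ^ 2 * (q + p * a + b + a ^ 2 / 2))|
      ≤ 102 * A ^ 4 * u ^ 3 * Real.exp y := by
  have hA0 : 0 ≤ A := by linarith
  have hE := abs_exp_sub_jet_le hu hu1 hA ha hb hr hy
  set e := Real.exp (u * a + u ^ 2 * b + r)
  set b' := b + a ^ 2 / 2 with hb'
  have hy0 : 1 ≤ Real.exp y := Real.one_le_exp ((abs_nonneg _).trans hy)
  have he : |e| ≤ Real.exp y := by
    rw [abs_of_pos (Real.exp_pos _)]; exact Real.exp_le_exp.2 ((le_abs_self _).trans hy)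
  have hA1 : A ≤ A ^ 2 := le_self_pow₀ hA (by norm_num)
  have hA3 : A ≤ A ^ 4 := le_self_pow₀ hA (by norm_num)
  have hA2 : A ^ 2 ≤ A ^ 4 := pow_le_pow_right₀ hA (by norm_num)
  have hA4 : A ^ 3 ≤ A ^ 4 := pow_le_pow_right₀ hA (by norm_num)
  have hb'A : |b'| ≤ 2 * A ^ 2 := by
    calc |b'| ≤ |b| + |a ^ 2 / 2| := abs_add_le _ _
      _ ≤ A + A ^ 2 := by
          refine add_le_add hb ?_
          rw [abs_of_nonneg (by positivity), ← sq_abs]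
          have : |a| ^ 2 ≤ A ^ 2 := by gcongr
          linarith [sq_nonneg |a|]
      _ ≤ _ := by linarith
  have hu2 : u ^ 2 ≤ 1 := pow_le_one₀ hu hu1
  have hP' : |1 + u * p + u ^ 2 * q| ≤ 3 * A := by
    calc _ ≤ |1 + u * p| + |u ^ 2 * q| := abs_add_le _ _
      _ ≤ (|1| + |u * p|) + |u ^ 2 * q| := by gcongr; exact abs_add_le _ _
      _ ≤ (A + 1 * A) + 1 * A := by
          rw [abs_mul, abs_mul, abs_of_nonneg hu, abs_of_nonneg (sq_nonneg u), abs_one]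
          gcongr
      _ = _ := by ring
  have hrest : |u ^ 3 * (p * b' + q * a) + u ^ 4 * (q * b')| ≤ 5 * A ^ 4 * u ^ 3 := by
    have hu4 : u ^ 4 ≤ u ^ 3 := pow_le_pow_of_le_one hu hu1 (by norm_num)
    calc _ ≤ |u ^ 3 * (p * b' + q * a)| + |u ^ 4 * (q * b')| := abs_add_le _ _
      _ ≤ u ^ 3 * (A * (2 * A ^ 2) + A * A) + u ^ 3 * (A * (2 * A ^ 2)) := by
          rw [abs_mul, abs_mul, abs_of_nonneg (by positivity : 0 ≤ u ^ 3),
            abs_of_nonneg (by positivity : 0 ≤ u ^ 4), abs_mul]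
          gcongr
          refine (abs_add_le _ _).trans ?_
          rw [abs_mul, abs_mul]
          gcongr
      _ = (4 * A ^ 3 + A ^ 2) * u ^ 3 := by ring
      _ ≤ _ := by
          gcongr; linarith
  have hsplit : P * e - (1 + u * (p + a) + u ^ 2 * (q + p * a + b + a ^ 2 / 2)) =
      (P - (1 + u * p + u ^ 2 * q)) * e
      + (1 + u * p + u ^ 2 * q) * (e - (1 + u * a + u ^ 2 * b'))
      + (u ^ 3 * (p * b' + q * a) + u ^ 4 * (q * b')) := by
    rw [hb']; ring
  rw [hsplit]
  calc _ ≤ |(P - (1 + u * p + u ^ 2 * q)) * e|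
      + |(1 + u * p + u ^ 2 * q) * (e - (1 + u * a + u ^ 2 * b'))|
      + |u ^ 3 * (p * b' + q * a) + u ^ 4 * (q * b')| := abs_add_three _ _ _
    _ ≤ A * u ^ 3 * Real.exp y + 3 * A * (32 * A ^ 3 * u ^ 3 * Real.exp y) + 5 * A ^ 4 * u ^ 3 := by
        rw [abs_mul, abs_mul]
        gcongr
    _ ≤ A ^ 4 * u ^ 3 * Real.exp y + 96 * A ^ 4 * u ^ 3 * Real.exp y
        + 5 * A ^ 4 * u ^ 3 * Real.exp y := by
        refine add_le_add (add_le_add (by gcongr) (le_of_eq (by ring))) ?_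
        exact le_mul_of_one_le_right (by positivity) hy0
    _ = _ := by ring

/-! ### The corrections in terms of derivatives -/

section Corrections

variable {d : ℕ} {n : ℕ} {prior f : Par d → ℝ} {C : Matrix (Fin d) (Fin d) ℝ} {t : Par d}

lemma A2_eq_centredSextic (w : Par d) :
    A2 n prior f C t w = centredSextic (Hmat n f C t)⁻¹ (fun i => pd prior ![i] t / prior t)
      (fun i j => pd prior ![i, j] t / prior t) (calD3 n f C t) (calD4 n f C t) w := rfl

lemma sum_pd_one (w : Par d) :
    ∑ i, pd prior ![i] t / prior t * w i =
      (iteratedFDeriv ℝ 1 prior t fun _ => w) / prior t := by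
  rw [ContinuousMultilinearMap.sum_coord_one, Finset.sum_div]
  refine Finset.sum_congr rfl fun i _ => ?_
  change _ = w i * pd prior ![i] t / _
  ring

lemma sum_pd_two (w : Par d) :
    ∑ i, ∑ j, pd prior ![i, j] t / prior t * (w i * w j) =
      (iteratedFDeriv ℝ 2 prior t fun _ => w) / prior t := by
  rw [ContinuousMultilinearMap.sum_coord_two, Finset.sum_div]
  refine Finset.sum_congr rfl fun i _ => ?_
  rw [Finset.sum_div]
  refine Finset.sum_congr rfl fun j _ => ?_
  change _ = w i * w j * pd prior ![i, j] t / _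
  ring

lemma A1_eq (w : Par d) :
    A1 n prior f C t w = (iteratedFDeriv ℝ 1 prior t fun _ => w) / prior t
      + -(1 / 6) * ((n : ℝ)⁻¹ * iteratedFDeriv ℝ 3 f t fun _ => mulVecL C w) := by
  rw [A1, sum_pd_one, sum_calD3]; ring

/-- Every monomial vanishes at 0, so the difference discards the centring constants. What is left
factors: the mixed sum is linear form times cubic form, and the sextic sum is the square of the
cubic form. -/
lemma centredSextic_sub_zero (h : Matrix (Fin d) (Fin d) ℝ) (p : Fin d → ℝ)
    (q : Fin d → Fin d → ℝ) (D : Fin d → Fin d → Fin d → ℝ)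
    (E : Fin d → Fin d → Fin d → Fin d → ℝ) (w : Par d) :
    centredSextic h p q D E w - centredSextic h p q D E 0 =
      1 / 2 * (∑ i, ∑ j, q i j * (w i * w j))
      - 1 / 6 * ((∑ i, p i * w i) * ∑ r, ∑ s, ∑ u, D r s u * (w r * w s * w u))
      - 1 / 24 * (∑ r, ∑ s, ∑ u, ∑ v, E r s u v * (w r * w s * w u * w v))
      + 1 / 72 * (∑ r, ∑ s, ∑ u, D r s u * (w r * w s * w u)) ^ 2 := by
  have e1 : ∑ i, ∑ j, q i j * (w i * w j - h i j) - ∑ i, ∑ j, q i j * ((0 : Par d) i * (0 : Par d) j - h i j)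
      = ∑ i, ∑ j, q i j * (w i * w j) := by
    simp only [← Finset.sum_sub_distrib]
    refine Finset.sum_congr rfl fun i _ => Finset.sum_congr rfl fun j _ => ?_
    simp only [PiLp.zero_apply]; ring
  have e2 : (∑ i, ∑ r, ∑ s, ∑ u, p i * D r s u * (w i * w r * w s * w u - 3 * h i r * h s u))
      - (∑ i, ∑ r, ∑ s, ∑ u, p i * D r s u *
        ((0 : Par d) i * (0 : Par d) r * (0 : Par d) s * (0 : Par d) u - 3 * h i r * h s u))
      = (∑ i, p i * w i) * ∑ r, ∑ s, ∑ u, D r s u * (w r * w s * w u) := by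
    rw [Finset.sum_mul]
    simp only [← Finset.sum_sub_distrib, Finset.mul_sum]
    refine Finset.sum_congr rfl fun i _ => Finset.sum_congr rfl fun j _ =>
      Finset.sum_congr rfl fun k _ => Finset.sum_congr rfl fun l _ => ?_
    simp only [PiLp.zero_apply]; ring
  have e3 : (∑ r, ∑ s, ∑ u, ∑ v, E r s u v * (w r * w s * w u * w v - 3 * h r s * h u v))
      - (∑ r, ∑ s, ∑ u, ∑ v, E r s u v *
        ((0 : Par d) r * (0 : Par d) s * (0 : Par d) u * (0 : Par d) v - 3 * h r s * h u v))
      = ∑ r, ∑ s, ∑ u, ∑ v, E r s u v * (w r * w s * w u * w v) := by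
    simp only [← Finset.sum_sub_distrib]
    refine Finset.sum_congr rfl fun i _ => Finset.sum_congr rfl fun j _ =>
      Finset.sum_congr rfl fun k _ => Finset.sum_congr rfl fun l _ => ?_
    simp only [PiLp.zero_apply]; ring
  have e4 : (∑ a, ∑ b, ∑ c, ∑ e, ∑ f, ∑ g, D a b c * D e f g * (w a * w b * w c * w e * w f * w g
          - 9 * h a b * h c e * h f g - 6 * h a e * h b f * h c g))
      - (∑ a, ∑ b, ∑ c, ∑ e, ∑ f, ∑ g, D a b c * D e f g * ((0 : Par d) a * (0 : Par d) b
          * (0 : Par d) c * (0 : Par d) e * (0 : Par d) f * (0 : Par d) g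
          - 9 * h a b * h c e * h f g - 6 * h a e * h b f * h c g))
      = (∑ r, ∑ s, ∑ u, D r s u * (w r * w s * w u)) ^ 2 := by
    rw [sq]
    simp only [Finset.sum_mul]
    simp only [← Finset.sum_sub_distrib, Finset.mul_sum]
    refine Finset.sum_congr rfl fun a _ => Finset.sum_congr rfl fun b _ =>
      Finset.sum_congr rfl fun c _ => Finset.sum_congr rfl fun e _ =>
      Finset.sum_congr rfl fun f _ => Finset.sum_congr rfl fun g _ => ?_
    simp only [PiLp.zero_apply]; ring
  rw [← e1, ← e2, ← e3, ← e4]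
  simp only [centredSextic]
  ring

/-- The right side is the u²-coefficient of the product of the two jets; the factor 1/72 is half the
square of 1/6. -/
lemma A2_sub_zero (w : Par d) {p a q b : ℝ}
    (hp : p = (iteratedFDeriv ℝ 1 prior t fun _ => w) / prior t)
    (hq : q = 1 / 2 * ((iteratedFDeriv ℝ 2 prior t fun _ => w) / prior t))
    (ha : a = -(1 / 6) * ((n : ℝ)⁻¹ * iteratedFDeriv ℝ 3 f t fun _ => mulVecL C w))
    (hb : b = -(1 / 24) * ((n : ℝ)⁻¹ * iteratedFDeriv ℝ 4 f t fun _ => mulVecL C w)) :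
    A2 n prior f C t w - A2 n prior f C t 0 = q + p * a + b + a ^ 2 / 2 := by
  rw [A2_eq_centredSextic, A2_eq_centredSextic, centredSextic_sub_zero, sum_pd_one, sum_pd_two,
    sum_calD3, sum_calD4, hp, hq, ha, hb]
  ring

end Corrections

/-! ### Local expansion of the unnormalized posterior -/

/-- Quantitative regularity of a score `f` and a prior on a ball around `θ₀` that contains the
critical point `t` of `f`. -/
structure LocalRegularity {d : ℕ} (n : ℕ) (prior f : Par d → ℝ) (C : Matrix (Fin d) (Fin d) ℝ)
    (θ₀ t : Par d) (ρ B c p₀ : ℝ) : Prop where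
  n_pos : 0 < n
  smooth : ContDiffOn ℝ 5 f (Metric.ball θ₀ ρ)
  bound_two : ∀ z ∈ Metric.ball θ₀ ρ, ‖iteratedFDeriv ℝ 2 f z‖ ≤ n * B
  bound_three : ∀ z ∈ Metric.ball θ₀ ρ, ‖iteratedFDeriv ℝ 3 f z‖ ≤ n * B
  bound_four : ∀ z ∈ Metric.ball θ₀ ρ, ‖iteratedFDeriv ℝ 4 f z‖ ≤ n * B
  bound_five : ∀ z ∈ Metric.ball θ₀ ρ, ‖iteratedFDeriv ℝ 5 f z‖ ≤ n * B
  near : ‖t - θ₀‖ < ρ / 2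
  critical : ∀ v, (iteratedFDeriv ℝ 1 f t fun _ => v) = 0
  curvature : ∀ w, c * ‖w‖ ^ 2 ≤ quadForm (Hmat n f C t) w
  prior_smooth : ContDiffOn ℝ 3 prior (Metric.ball θ₀ ρ)
  prior_one : ∀ z ∈ Metric.ball θ₀ ρ, ‖iteratedFDeriv ℝ 1 prior z‖ ≤ B
  prior_two : ∀ z ∈ Metric.ball θ₀ ρ, ‖iteratedFDeriv ℝ 2 prior z‖ ≤ B
  prior_three : ∀ z ∈ Metric.ball θ₀ ρ, ‖iteratedFDeriv ℝ 3 prior z‖ ≤ B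
  prior_pos : p₀ ≤ prior t

lemma abs_iteratedFDeriv_const_le {d k : ℕ} {f : Par d → ℝ} {z : Par d} {M : ℝ}
    (h : ‖iteratedFDeriv ℝ k f z‖ ≤ M) (v : Par d) :
    |iteratedFDeriv ℝ k f z fun _ => v| ≤ M * ‖v‖ ^ k := by
  have h1 := (iteratedFDeriv ℝ k f z).le_opNorm fun _ => v
  rw [Finset.prod_const, Finset.card_univ, Fintype.card_fin, Real.norm_eq_abs] at h1
  exact h1.trans (by gcongr)

lemma iteratedFDeriv_const_smul_arg {d k : ℕ} {f : Par d → ℝ} {z : Par d} (u : ℝ) (v : Par d) :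
    (iteratedFDeriv ℝ k f z fun _ => u • v) = u ^ k * iteratedFDeriv ℝ k f z fun _ => v := by
  rw [ContinuousMultilinearMap.map_smul_univ (iteratedFDeriv ℝ k f z) (fun _ => u) fun _ => v]
  simp

namespace LocalRegularity

variable {d n : ℕ} {prior f : Par d → ℝ} {C : Matrix (Fin d) (Fin d) ℝ} {θ₀ t : Par d}
  {ρ B c p₀ : ℝ}

lemma mem_ball (h : LocalRegularity n prior f C θ₀ t ρ B c p₀) (hρ : 0 < ρ) :
    t ∈ Metric.ball θ₀ ρ := by
  rw [mem_ball_iff_norm]; linarith [h.near]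

lemma add_mem_ball (h : LocalRegularity n prior f C θ₀ t ρ B c p₀) {v : Par d}
    (hv : ‖v‖ ≤ ρ / 2) : t + v ∈ Metric.ball θ₀ ρ := by
  rw [mem_ball_iff_norm]
  calc ‖t + v - θ₀‖ = ‖(t - θ₀) + v‖ := by congr 1; abel
    _ ≤ ‖t - θ₀‖ + ‖v‖ := norm_add_le _ _
    _ < ρ := by linarith [h.near]

lemma contDiffAt (h : LocalRegularity n prior f C θ₀ t ρ B c p₀) (hρ : 0 < ρ) :
    ContDiffAt ℝ (5 : ℕ) f t :=
  h.smooth.contDiffAt (Metric.isOpen_ball.mem_nhds (h.mem_ball hρ))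

lemma isSymm (h : LocalRegularity n prior f C θ₀ t ρ B c p₀) (hρ : 0 < ρ) :
    (Hmat n f C t).IsSymm :=
  isSymm_Hmat ((h.contDiffAt hρ).of_le (by norm_num))

lemma n_mul_inv (h : LocalRegularity n prior f C θ₀ t ρ B c p₀) (B : ℝ) :
    (n : ℝ)⁻¹ * (n * B) = B := by
  have : (n : ℝ) ≠ 0 := by exact_mod_cast h.n_pos.ne'
  field_simp

lemma abs_scaled_le (h : LocalRegularity n prior f C θ₀ t ρ B c p₀) {k : ℕ}
    (hb : ‖iteratedFDeriv ℝ k f t‖ ≤ n * B) (v : Par d) :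
    |(n : ℝ)⁻¹ * iteratedFDeriv ℝ k f t fun _ => v| ≤ B * ‖v‖ ^ k := by
  rw [abs_mul, abs_of_nonneg (by positivity)]
  calc _ ≤ (n : ℝ)⁻¹ * ((n * B) * ‖v‖ ^ k) := by
        gcongr; exact abs_iteratedFDeriv_const_le hb v
    _ = _ := by rw [← mul_assoc, h.n_mul_inv]

lemma quadForm_le (h : LocalRegularity n prior f C θ₀ t ρ B c p₀) (hρ : 0 < ρ) (hB : 0 ≤ B)
    (w : Par d) :
    quadForm (Hmat n f C t) w ≤ B * (1 + ‖mulVecL C‖) ^ 2 * ‖w‖ ^ 2 := by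
  rw [quadForm_Hmat]
  refine (le_abs_self _).trans ((h.abs_scaled_le (h.bound_two t (h.mem_ball hρ)) _).trans ?_)
  rw [mul_assoc, ← mul_pow]
  gcongr
  exact ((mulVecL C).le_opNorm w).trans (by gcongr; linarith)

/-- The Taylor expansion of the score at its critical point. -/
lemma abs_score_taylor_le (h : LocalRegularity n prior f C θ₀ t ρ B c p₀) (hρ : 0 < ρ)
    {v : Par d} (hv : ‖v‖ ≤ ρ / 2) :
    |f (t + v) - f t - ((1 / 2 * iteratedFDeriv ℝ 2 f t fun _ => v)
      + (1 / 6 * iteratedFDeriv ℝ 3 f t fun _ => v)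
      + (1 / 24 * iteratedFDeriv ℝ 4 f t fun _ => v))| ≤ n * B * ‖v‖ ^ 5 := by
  have := abs_sub_taylor_le (k := 4) (x := t) (y := v) h.smooth (h.mem_ball hρ)
    (h.add_mem_ball hv) h.bound_five
  simp only [Finset.sum_range_succ, Finset.sum_range_zero, iteratedFDeriv_zero_apply,
    h.critical] at this
  convert this using 2
  norm_num [Nat.factorial]
  ring

lemma abs_prior_taylor_le (h : LocalRegularity n prior f C θ₀ t ρ B c p₀) (hρ : 0 < ρ)
    {v : Par d} (hv : ‖v‖ ≤ ρ / 2) :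
    |prior (t + v) - (prior t + (iteratedFDeriv ℝ 1 prior t fun _ => v)
      + (1 / 2 * iteratedFDeriv ℝ 2 prior t fun _ => v))| ≤ B * ‖v‖ ^ 3 := by
  have := abs_sub_taylor_le (k := 2) (x := t) (y := v) h.prior_smooth (h.mem_ball hρ)
    (h.add_mem_ball hv) h.prior_three
  simp only [Finset.sum_range_succ, Finset.sum_range_zero, iteratedFDeriv_zero_apply] at this
  convert this using 2
  norm_num [Nat.factorial]

end LocalRegularity

/-- The unnormalized posterior relative to its value at `t`, in the local coordinate `w`. -/
def localRatio {d : ℕ} (n : ℕ) (prior f : Par d → ℝ) (C : Matrix (Fin d) (Fin d) ℝ)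
    (t w : Par d) : ℝ :=
  prior (t + (Real.sqrt n)⁻¹ • w) / prior t *
    Real.exp (-(f (t + (Real.sqrt n)⁻¹ • mulVecL C w) - f t))

/-- The expansion of `localRatio`. -/
def localExpansion {d : ℕ} (n : ℕ) (prior f : Par d → ℝ) (C : Matrix (Fin d) (Fin d) ℝ)
    (t w : Par d) : ℝ :=
  gaussWeight (Hmat n f C t) w * (1 + (Real.sqrt n)⁻¹ * A1 n prior f C t w
    + (n : ℝ)⁻¹ * (A2 n prior f C t w - A2 n prior f C t 0))

namespace LocalRegularity

variable {d n : ℕ} {prior f : Par d → ℝ} {C : Matrix (Fin d) (Fin d) ℝ} {θ₀ t : Par d}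
  {ρ B c p₀ L K₀ δ : ℝ}

/-- A crude polynomial bound suffices for `p` and `q`. For `a` and `b` the exact powers of ‖w‖ are
kept, since they are needed to compare the perturbation of the exponent with ‖w‖². -/
lemma exists_coefficients (h : LocalRegularity n prior f C θ₀ t ρ B c p₀) (hρ : 0 < ρ)
    (hB0 : 0 < B) (hp₀ : 0 < p₀) (hL1 : 1 ≤ L) (hCL : ‖mulVecL C‖ ≤ L) (hK₀p : B / p₀ ≤ K₀)
    (w : Par d) :
    ∃ p q a b : ℝ,
      p = (iteratedFDeriv ℝ 1 prior t fun _ => w) / prior t ∧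
      q = 1 / 2 * ((iteratedFDeriv ℝ 2 prior t fun _ => w) / prior t) ∧
      a = -(1 / 6) * ((n : ℝ)⁻¹ * iteratedFDeriv ℝ 3 f t fun _ => mulVecL C w) ∧
      b = -(1 / 24) * ((n : ℝ)⁻¹ * iteratedFDeriv ℝ 4 f t fun _ => mulVecL C w) ∧
      |p| ≤ K₀ * (1 + ‖w‖) ^ 5 ∧ |q| ≤ K₀ * (1 + ‖w‖) ^ 5 ∧
      |a| ≤ B * L ^ 5 * ‖w‖ ^ 3 ∧ |b| ≤ B * L ^ 5 * ‖w‖ ^ 4 := by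
  have htb := h.mem_ball hρ
  have hpt : 0 < prior t := hp₀.trans_le h.prior_pos
  have hL0 : 0 < L := by linarith
  have hx := norm_nonneg w
  have hCw : ‖mulVecL C w‖ ≤ L * ‖w‖ :=
    ((mulVecL C).le_opNorm w).trans (by gcongr)
  have hdiv : ∀ z k, |z| ≤ B * ‖w‖ ^ k → k ≤ 5 → |z / prior t| ≤ K₀ * (1 + ‖w‖) ^ 5 := by
    intro z k hz hk
    rw [abs_div, abs_of_pos hpt]
    calc |z| / prior t ≤ (B * ‖w‖ ^ k) / p₀ := by
          gcongr; exact h.prior_pos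
      _ = B / p₀ * ‖w‖ ^ k := by ring
      _ ≤ K₀ * (1 + ‖w‖) ^ 5 := by
          refine mul_le_mul hK₀p ?_ (by positivity) ((by positivity : 0 ≤ B / p₀).trans hK₀p)
          calc ‖w‖ ^ k ≤ (1 + ‖w‖) ^ k := by gcongr; linarith
            _ ≤ (1 + ‖w‖) ^ 5 := pow_le_pow_right₀ (by linarith) hk
  refine ⟨_, _, _, _, rfl, rfl, rfl, rfl, ?_, ?_, ?_, ?_⟩
  · exact hdiv _ 1 (abs_iteratedFDeriv_const_le (h.prior_one t htb) w) (by norm_num)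
  · rw [abs_mul]
    have := hdiv _ 2 (abs_iteratedFDeriv_const_le (h.prior_two t htb) w) (by norm_num)
    rw [abs_of_pos (by norm_num : (0:ℝ) < 1 / 2)]
    linarith only [this, abs_nonneg ((iteratedFDeriv ℝ 2 prior t fun _ => w) / prior t)]
  · rw [abs_mul]
    have h3 := h.abs_scaled_le (h.bound_three t htb) (mulVecL C w)
    have h4 : B * ‖mulVecL C w‖ ^ 3 ≤ B * L ^ 5 * ‖w‖ ^ 3 := by
      calc B * ‖mulVecL C w‖ ^ 3 ≤ B * (L * ‖w‖) ^ 3 := by gcongr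
        _ = B * L ^ 3 * ‖w‖ ^ 3 := by ring
        _ ≤ _ := by gcongr; norm_num
    rw [abs_neg, abs_of_pos (by norm_num : (0:ℝ) < 1 / 6)]
    linarith only [h3, h4, abs_nonneg ((n : ℝ)⁻¹ * iteratedFDeriv ℝ 3 f t fun _ => mulVecL C w)]
  · rw [abs_mul]
    have h3 := h.abs_scaled_le (h.bound_four t htb) (mulVecL C w)
    have h4 : B * ‖mulVecL C w‖ ^ 4 ≤ B * L ^ 5 * ‖w‖ ^ 4 := by
      calc B * ‖mulVecL C w‖ ^ 4 ≤ B * (L * ‖w‖) ^ 4 := by gcongr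
        _ = B * L ^ 4 * ‖w‖ ^ 4 := by ring
        _ ≤ _ := by gcongr; norm_num
    rw [abs_neg, abs_of_pos (by norm_num : (0:ℝ) < 1 / 24)]
    linarith only [h3, h4, abs_nonneg ((n : ℝ)⁻¹ * iteratedFDeriv ℝ 4 f t fun _ => mulVecL C w)]

lemma mul_pow_norm_le (hB0 : 0 < B) (hL1 : 1 ≤ L) (hK₀B : B * L ^ 5 ≤ K₀) (w : Par d) {k : ℕ}
    (hk : k ≤ 5) : B * L ^ 5 * ‖w‖ ^ k ≤ K₀ * (1 + ‖w‖) ^ 5 := by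
  have hx := norm_nonneg w
  have hL0 : 0 < L := by linarith
  have : ‖w‖ ^ k ≤ (1 + ‖w‖) ^ 5 :=
    calc ‖w‖ ^ k ≤ (1 + ‖w‖) ^ k := by gcongr; linarith
      _ ≤ (1 + ‖w‖) ^ 5 := pow_le_pow_right₀ (by linarith) hk
  exact mul_le_mul hK₀B this (by positivity) ((by positivity : 0 ≤ B * L ^ 5).trans hK₀B)

lemma corrections_le (h : LocalRegularity n prior f C θ₀ t ρ B c p₀) (hρ : 0 < ρ)
    (hB0 : 0 < B) (hp₀ : 0 < p₀) (hL1 : 1 ≤ L) (hCL : ‖mulVecL C‖ ≤ L) (hK₀p : B / p₀ ≤ K₀)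
    (hK₀B : B * L ^ 5 ≤ K₀) (hK₀1 : 1 ≤ K₀) (w : Par d) :
    |A1 n prior f C t w| ≤ 4 * K₀ ^ 2 * (1 + ‖w‖) ^ 10 ∧
      |A2 n prior f C t w - A2 n prior f C t 0| ≤ 4 * K₀ ^ 2 * (1 + ‖w‖) ^ 10 := by
  obtain ⟨p, q, a, b, hp, hq, ha, hb, bp, bq, ba, bb⟩ :=
    h.exists_coefficients hρ hB0 hp₀ hL1 hCL hK₀p w
  replace ba := ba.trans (mul_pow_norm_le hB0 hL1 hK₀B w (by norm_num))
  replace bb := bb.trans (mul_pow_norm_le hB0 hL1 hK₀B w (by norm_num))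
  rw [A2_sub_zero w hp hq ha hb, A1_eq, ← hp, ← ha]
  have hx := norm_nonneg w
  have hA1 : 1 ≤ K₀ * (1 + ‖w‖) ^ 5 :=
    one_le_mul_of_one_le_of_one_le hK₀1 (one_le_pow₀ (by linarith))
  have hfin : 4 * K₀ ^ 2 * (1 + ‖w‖) ^ 10 = 4 * (K₀ * (1 + ‖w‖) ^ 5) ^ 2 := by
    rw [mul_pow, ← pow_mul, mul_assoc]
  rw [hfin]
  generalize K₀ * (1 + ‖w‖) ^ 5 = A at *
  have hAA : A ≤ A ^ 2 := le_self_pow₀ hA1 (by norm_num)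
  have hp2 : |p * a| ≤ A ^ 2 := by
    rw [abs_mul, sq]; gcongr
  have ha2 : |a ^ 2 / 2| ≤ A ^ 2 := by
    rw [abs_div, abs_pow, abs_of_pos (two_pos : (0:ℝ) < 2)]
    have : |a| ^ 2 ≤ A ^ 2 := by gcongr
    linarith only [this, sq_nonneg |a|]
  constructor
  · refine le_trans (abs_add_le _ _) ?_
    linarith only [bp, ba, hAA, hA1]
  · have h1 := abs_add_le (q + p * a + b) (a ^ 2 / 2)
    have h2 := abs_add_three q (p * a) b
    linarith only [h1, h2, bq, bb, hAA, hA1, hp2, ha2]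

/-- On this range x = u‖w‖ ≤ δ, so the non-Gaussian part of the exponent is at most BL⁵(x + x² +
x³)‖w‖² ≤ (c/4)‖w‖², half of the decay (c/2)‖w‖² of the Gaussian weight. The jet estimates then
apply pointwise. -/
lemma abs_localRatio_sub_le (h : LocalRegularity n prior f C θ₀ t ρ B c p₀) (hρ : 0 < ρ)
    (hB0 : 0 < B) (hp₀ : 0 < p₀) (hL1 : 1 ≤ L) (hCL : ‖mulVecL C‖ ≤ L) (hK₀p : B / p₀ ≤ K₀)
    (hK₀B : B * L ^ 5 ≤ K₀) (hK₀1 : 1 ≤ K₀) (hδ0 : 0 < δ) (hδ1 : δ ≤ 1) (hδρ : δ * L ≤ ρ / 2)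
    (hδc : 3 * (B * L ^ 5) * δ ≤ c / 4) {w : Par d} (hw : ‖w‖ ≤ δ * Real.sqrt n) :
    |localRatio n prior f C t w - localExpansion n prior f C t w| ≤
      Real.exp (-(c / 2) * ‖w‖ ^ 2) * (102 * (K₀ * (1 + ‖w‖) ^ 5) ^ 4 * (Real.sqrt n)⁻¹ ^ 3 *
        Real.exp (c / 4 * ‖w‖ ^ 2)) := by
  have hL0 : 0 < L := by linarith
  have hn : (0 : ℝ) < n := by exact_mod_cast h.n_pos
  have hpt : 0 < prior t := hp₀.trans_le h.prior_pos
  have hsq : 0 < Real.sqrt n := Real.sqrt_pos.2 hn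
  obtain ⟨u, hu⟩ : ∃ u, u = (Real.sqrt n)⁻¹ := ⟨_, rfl⟩
  have hu0 : 0 < u := hu ▸ inv_pos.2 hsq
  have hu1 : u ≤ 1 :=
    hu ▸ inv_le_one_of_one_le₀ (Real.one_le_sqrt.2 (by exact_mod_cast h.n_pos))
  have hu2 : u ^ 2 = (n : ℝ)⁻¹ := by rw [hu, inv_pow, Real.sq_sqrt hn.le]
  have hx := norm_nonneg w
  obtain ⟨p, q, a, b, hp, hq, ha, hb, bp, bq, ba, bb⟩ :=
    h.exists_coefficients hρ hB0 hp₀ hL1 hCL hK₀p w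
  have huw : u * ‖w‖ ≤ δ := by
    rw [hu, inv_mul_le_iff₀ hsq, mul_comm]; exact hw
  have hCw : ‖mulVecL C w‖ ≤ L * ‖w‖ :=
    ((mulVecL C).le_opNorm w).trans (by gcongr)
  have hv1 : ‖u • w‖ ≤ ρ / 2 := by
    rw [norm_smul, Real.norm_of_nonneg hu0.le]
    exact (huw.trans (le_mul_of_one_le_right hδ0.le hL1)).trans hδρ
  have hv2' : ‖u • mulVecL C w‖ ≤ L * (u * ‖w‖) := by
    rw [norm_smul, Real.norm_of_nonneg hu0.le]
    calc u * ‖mulVecL C w‖ ≤ u * (L * ‖w‖) := by gcongr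
      _ = _ := by ring
  have hv2 : ‖u • mulVecL C w‖ ≤ ρ / 2 := by
    refine hv2'.trans (le_trans ?_ hδρ)
    rw [mul_comm]; gcongr
  obtain ⟨A, hA⟩ : ∃ A, A = K₀ * (1 + ‖w‖) ^ 5 := ⟨_, rfl⟩
  have hA1 : 1 ≤ A := hA ▸ one_le_mul_of_one_le_of_one_le hK₀1 (one_le_pow₀ (by linarith))
  -- `r` is what the exponent contains beyond its quadratic, cubic and quartic parts. It is bounded
  -- by nB‖uCw‖⁵, which is of order u³ because nu² = 1.
  obtain ⟨r, hr⟩ : ∃ r, r = -(f (t + u • mulVecL C w) - f t) +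
    1 / 2 * quadForm (Hmat n f C t) w - (u * a + u ^ 2 * b) := ⟨_, rfl⟩
  have hrb : |r| ≤ B * L ^ 5 * (u ^ 3 * ‖w‖ ^ 5) := by
    have hS := h.abs_score_taylor_le hρ hv2
    simp only [iteratedFDeriv_const_smul_arg] at hS
    have e1 : r = -(f (t + u • mulVecL C w) - f t -
        ((1 / 2 * (u ^ 2 * iteratedFDeriv ℝ 2 f t fun _ => mulVecL C w))
        + (1 / 6 * (u ^ 3 * iteratedFDeriv ℝ 3 f t fun _ => mulVecL C w))
        + (1 / 24 * (u ^ 4 * iteratedFDeriv ℝ 4 f t fun _ => mulVecL C w)))) := by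
      rw [hr, quadForm_Hmat, ha, hb, ← hu2]; ring
    rw [e1, abs_neg]
    refine hS.trans ?_
    calc n * B * ‖u • mulVecL C w‖ ^ 5 ≤ n * B * (L * (u * ‖w‖)) ^ 5 := by gcongr
      _ = (u ^ 2 * n) * (B * L ^ 5 * (u ^ 3 * ‖w‖ ^ 5)) := by ring
      _ = _ := by rw [hu2, inv_mul_cancel₀ hn.ne', one_mul]
  have hrA : |r| ≤ A * u ^ 3 := by
    calc |r| ≤ B * L ^ 5 * ‖w‖ ^ 5 * u ^ 3 := hrb.trans (le_of_eq (by ring))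
      _ ≤ A * u ^ 3 := by gcongr; rw [hA]; exact mul_pow_norm_le hB0 hL1 hK₀B w le_rfl
  have hy : |u * a + u ^ 2 * b + r| ≤ c / 4 * ‖w‖ ^ 2 := by
    have hδ2 : (u * ‖w‖) ^ 2 ≤ δ := by
      calc (u * ‖w‖) ^ 2 ≤ δ ^ 2 := by gcongr
        _ ≤ δ := by nlinarith
    have hδ3 : (u * ‖w‖) ^ 3 ≤ δ := by
      calc (u * ‖w‖) ^ 3 ≤ δ ^ 3 := by gcongr
        _ ≤ δ := pow_le_of_le_one hδ0.le hδ1 (by norm_num)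
    calc |u * a + u ^ 2 * b + r| ≤ |u * a| + |u ^ 2 * b| + |r| := abs_add_three _ _ _
      _ ≤ u * (B * L ^ 5 * ‖w‖ ^ 3) + u ^ 2 * (B * L ^ 5 * ‖w‖ ^ 4)
          + B * L ^ 5 * (u ^ 3 * ‖w‖ ^ 5) := by
          rw [abs_mul, abs_mul, abs_of_pos hu0, abs_of_nonneg (sq_nonneg u)]
          gcongr
      _ = B * L ^ 5 * (u * ‖w‖ + (u * ‖w‖) ^ 2 + (u * ‖w‖) ^ 3) * ‖w‖ ^ 2 := by ring
      _ ≤ B * L ^ 5 * (δ + δ + δ) * ‖w‖ ^ 2 := by gcongr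
      _ = 3 * (B * L ^ 5) * δ * ‖w‖ ^ 2 := by ring
      _ ≤ _ := by gcongr
  have hP : |prior (t + u • w) / prior t - (1 + u * p + u ^ 2 * q)| ≤ A * u ^ 3 := by
    have hT := h.abs_prior_taylor_le hρ hv1
    simp only [iteratedFDeriv_const_smul_arg] at hT
    have e1 : prior (t + u • w) / prior t - (1 + u * p + u ^ 2 * q) =
        (prior (t + u • w) - (prior t + (u ^ 1 * iteratedFDeriv ℝ 1 prior t fun _ => w)
        + (1 / 2 * (u ^ 2 * iteratedFDeriv ℝ 2 prior t fun _ => w)))) / prior t := by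
      rw [hp, hq]; field_simp
    rw [e1, abs_div, abs_of_pos hpt]
    calc _ ≤ (B * ‖u • w‖ ^ 3) / p₀ := by
          gcongr; exact h.prior_pos
      _ = B / p₀ * ‖w‖ ^ 3 * u ^ 3 := by
          rw [norm_smul, Real.norm_of_nonneg hu0.le]; ring
      _ ≤ A * u ^ 3 := by
          rw [hA]
          gcongr
          calc ‖w‖ ^ 3 ≤ (1 + ‖w‖) ^ 3 := by gcongr; linarith
            _ ≤ (1 + ‖w‖) ^ 5 := pow_le_pow_right₀ (by linarith) (by norm_num)
  rw [← hA, ← hu]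
  have hjet := abs_mul_exp_sub_jet_le hu0.le hu1 hA1 (hA ▸ ba.trans (mul_pow_norm_le hB0 hL1 hK₀B w (by norm_num)))
    (hA ▸ bb.trans (mul_pow_norm_le hB0 hL1 hK₀B w (by norm_num))) hrA hy (hA ▸ bp) (hA ▸ bq) hP
  have hratio : localRatio n prior f C t w = gaussWeight (Hmat n f C t) w *
      (prior (t + u • w) / prior t * Real.exp (u * a + u ^ 2 * b + r)) := by
    rw [localRatio, ← hu, gaussWeight, mul_left_comm, ← Real.exp_add]
    congr 2
    rw [hr]; ring
  have hexp : localExpansion n prior f C t w = gaussWeight (Hmat n f C t) w *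
      (1 + u * (p + a) + u ^ 2 * (q + p * a + b + a ^ 2 / 2)) := by
    rw [localExpansion, ← hu, A2_sub_zero w hp hq ha hb, A1_eq, ← hp, ← ha, hu2]
  rw [hratio, hexp, ← mul_sub, abs_mul, abs_of_pos (gaussWeight_pos _ _)]
  exact mul_le_mul (gaussWeight_le h.curvature w) hjet (abs_nonneg _) (Real.exp_pos _).le

end LocalRegularity

/-- The constants are chosen before n, the score and the estimator, so the estimate can later be
applied to random data. -/
theorem exists_local_expansion {d : ℕ} (C : Matrix (Fin d) (Fin d) ℝ) {ρ B c p₀ : ℝ}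
    (hρ : 0 < ρ) (hB : 1 ≤ B) (hc : 0 < c) (hp₀ : 0 < p₀) :
    ∃ δ K : ℝ, 0 < δ ∧ δ * (1 + ‖mulVecL C‖) ≤ ρ / 2 ∧ 0 < K ∧
      ∀ (n : ℕ) (prior f : Par d → ℝ) (θ₀ t : Par d), LocalRegularity n prior f C θ₀ t ρ B c p₀ →
        (∀ w, |A1 n prior f C t w| ≤ K * (1 + ‖w‖) ^ 10 ∧
          |A2 n prior f C t w - A2 n prior f C t 0| ≤ K * (1 + ‖w‖) ^ 10) ∧
        ∀ w, ‖w‖ ≤ δ * Real.sqrt n →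
          |localRatio n prior f C t w - localExpansion n prior f C t w| ≤
            K * (Real.sqrt n)⁻¹ ^ 3 * Real.exp (-(c / 8) * ‖w‖ ^ 2) := by
  obtain ⟨L, hL⟩ : ∃ L, L = 1 + ‖mulVecL C‖ := ⟨_, rfl⟩
  have hL1 : 1 ≤ L := by linarith [norm_nonneg (mulVecL C)]
  have hL0 : 0 < L := by linarith
  have hCL : ‖mulVecL C‖ ≤ L := by linarith
  have hB0 : 0 < B := by linarith
  -- The exponent 20 comes from the fourth power of K₀(1 + ‖w‖)⁵; absorbing it halves the remaining
  -- decay c/4 to c/8.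
  obtain ⟨K₁, hK₁, hpow⟩ := exists_pow_mul_exp_le 20 (c := c / 4) (by linarith)
  obtain ⟨K₀, hK₀⟩ : ∃ K₀, K₀ = B * L ^ 5 * (1 + 1 / p₀) := ⟨_, rfl⟩
  have hp1 : 0 < 1 / p₀ := by positivity
  have hBL : 1 ≤ B * L ^ 5 := one_le_mul_of_one_le_of_one_le hB (one_le_pow₀ hL1)
  have hK₀1 : 1 ≤ K₀ := hK₀ ▸ one_le_mul_of_one_le_of_one_le hBL (by linarith)
  have hK₀B : B * L ^ 5 ≤ K₀ := hK₀ ▸ le_mul_of_one_le_right (by positivity) (by linarith)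
  have hK₀p : B / p₀ ≤ K₀ := by
    have h1 : B * 1 ≤ B * L ^ 5 := by gcongr; exact one_le_pow₀ hL1
    calc B / p₀ = B * 1 * (1 / p₀) := by ring
      _ ≤ B * L ^ 5 * (1 + 1 / p₀) := by gcongr; linarith
      _ = K₀ := hK₀.symm
  -- The three bounds give δ³ ≤ δ² ≤ δ, keep θ and θ* in the ball, and make 3BL⁵δ ≤ c/4.
  obtain ⟨δ, hδ⟩ : ∃ δ, δ = min 1 (min (ρ / (2 * L)) (c / (12 * B * L ^ 5))) := ⟨_, rfl⟩
  have hδ0 : 0 < δ := by rw [hδ]; positivity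
  have hδ1 : δ ≤ 1 := hδ ▸ min_le_left _ _
  have hδρ : δ * L ≤ ρ / 2 := by
    calc δ * L ≤ ρ / (2 * L) * L := by
          gcongr; exact hδ ▸ (min_le_right _ _).trans (min_le_left _ _)
      _ = ρ / 2 := by field_simp
  have hδc : 3 * (B * L ^ 5) * δ ≤ c / 4 := by
    calc _ ≤ 3 * (B * L ^ 5) * (c / (12 * B * L ^ 5)) := by
          gcongr; exact hδ ▸ (min_le_right _ _).trans (min_le_right _ _)
      _ = c / 4 := by field_simp; norm_num
  have hK0 : 0 < K₀ := by linarith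
  refine ⟨δ, 102 * K₀ ^ 4 * K₁ + 4 * K₀ ^ 2, hδ0, hL ▸ hδρ, by positivity, ?_⟩
  intro n prior f θ₀ t h
  have hKK : 4 * K₀ ^ 2 ≤ 102 * K₀ ^ 4 * K₁ + 4 * K₀ ^ 2 :=
    le_add_of_nonneg_left (by positivity)
  refine ⟨fun w => ?_, fun w hw => ?_⟩
  · obtain ⟨h1, h2⟩ := h.corrections_le hρ hB0 hp₀ hL1 hCL hK₀p hK₀B hK₀1 w
    exact ⟨h1.trans (by gcongr), h2.trans (by gcongr)⟩
  · refine (h.abs_localRatio_sub_le hρ hB0 hp₀ hL1 hCL hK₀p hK₀B hK₀1 hδ0 hδ1 hδρ hδc hw).trans ?_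
    have hW := hpow ‖w‖ (norm_nonneg w)
    have hu0 : 0 ≤ (Real.sqrt n)⁻¹ := by positivity
    generalize (Real.sqrt n)⁻¹ = u at *
    have e2 : Real.exp (-(c / 4) * ‖w‖ ^ 2) =
        Real.exp (-(c / 2) * ‖w‖ ^ 2) * Real.exp (c / 4 * ‖w‖ ^ 2) := by
      rw [← Real.exp_add]; congr 1; ring
    rw [e2, show c / 4 / 2 = c / 8 by ring] at hW
    have hpw : ((1 + ‖w‖) ^ 5) ^ 4 = (1 + ‖w‖) ^ 20 := by rw [← pow_mul]
    rw [mul_pow, hpw]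
    generalize (1 + ‖w‖) ^ 20 = W at *
    have hE := Real.exp_pos (-(c / 8) * ‖w‖ ^ 2)
    generalize Real.exp (-(c / 2) * ‖w‖ ^ 2) = E₁ at *
    generalize Real.exp (c / 4 * ‖w‖ ^ 2) = E₂ at *
    generalize Real.exp (-(c / 8) * ‖w‖ ^ 2) = E₃ at *
    calc E₁ * (102 * (K₀ ^ 4 * W) * u ^ 3 * E₂) = 102 * K₀ ^ 4 * u ^ 3 * (W * (E₁ * E₂)) := by ring
      _ ≤ 102 * K₀ ^ 4 * u ^ 3 * (K₁ * E₃) := by gcongr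
      _ = 102 * K₀ ^ 4 * K₁ * u ^ 3 * E₃ := by ring
      _ ≤ _ := by gcongr; exact le_add_of_nonneg_right (by positivity)

/-! ### Normalization of an expansion around a Gaussian weight -/

lemma gaussInt_one {d : ℕ} (H : Matrix (Fin d) (Fin d) ℝ) :
    gaussInt H (fun _ => 1) = ∫ w, gaussWeight H w := by
  simp [gaussInt]

lemma integral_exp_neg_mul_sq_norm_pos {d : ℕ} {c : ℝ} (hc : 0 < c) :
    0 < ∫ w : Par d, Real.exp (-c * ‖w‖ ^ 2) := by
  rw [integral_pos_iff_support_of_nonneg (fun w => (Real.exp_pos _).le)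
    (integrable_exp_neg_mul_sq_norm hc)]
  have : Function.support (fun w : Par d => Real.exp (-c * ‖w‖ ^ 2)) = Set.univ := by
    ext w; simp [(Real.exp_pos _).ne']
  rw [this]
  exact NeZero.pos _

/-- With X = uA + u²B and y = u²β, the quotient (1 + X)/(1 + y) is 1 + X - y up to (y² - Xy)/(1 +
y), which is O(u³). The error `e` of the normalizing constant adds a term of the same order; `hid`
is the exact identity. -/
lemma normalized_difference_le {g Z A B I Z₀ β e z₁ k m u W : ℝ} (hg : 0 ≤ g) (hu : 0 ≤ u)
    (hu1 : u ≤ 1) (hz₁ : 0 < z₁) (hZ₀ : z₁ ≤ Z₀) (hI : z₁ / 4 ≤ I) (hW : 1 ≤ W) (hk : 0 ≤ k)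
    (hm : 0 ≤ m) (hA : |A| ≤ k * W) (hB : |B| ≤ k * W) (hβ : |β| ≤ m) (he : |e| ≤ k * u ^ 3)
    (hIe : I = Z₀ * (1 + u ^ 2 * β) + e) :
    |Z / I - g / Z₀ * (1 + u * A + u ^ 2 * (B - β))| ≤
      4 / z₁ * |Z - g * (1 + u * A + u ^ 2 * B)| +
      (4 / z₁ * (2 * k * m + m ^ 2) + 4 / z₁ ^ 2 * (1 + 2 * k + m) * k) * u ^ 3 * (W * g) := by
  have hI0 : 0 < I := by linarith
  have hZ0 : 0 < Z₀ := by linarith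
  obtain ⟨X, hX⟩ : ∃ X, X = u * A + u ^ 2 * B := ⟨_, rfl⟩
  obtain ⟨y, hy⟩ : ∃ y, y = u ^ 2 * β := ⟨_, rfl⟩
  have hu2 : u ^ 2 ≤ u := by nlinarith
  have hu21 : u ^ 2 ≤ 1 := by linarith
  have hu3 : 0 ≤ u ^ 3 := by positivity
  have hXb : |X| ≤ u * (2 * k * W) := by
    rw [hX]
    calc _ ≤ |u * A| + |u ^ 2 * B| := abs_add_le _ _
      _ ≤ u * (k * W) + u * (k * W) := by
          rw [abs_mul, abs_mul, abs_of_nonneg hu, abs_of_nonneg (sq_nonneg u)]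
          gcongr
      _ = _ := by ring
  have hyb : |y| ≤ u ^ 2 * m := by
    rw [hy, abs_mul, abs_of_nonneg (sq_nonneg u)]; gcongr
  have hid : Z / I - g / Z₀ * (1 + u * A + u ^ 2 * (B - β)) =
      (Z - g * (1 + u * A + u ^ 2 * B)) / I
      + g * ((-(X * y) + y ^ 2) / I - (1 + X - y) * e / (I * Z₀)) := by
    have h1 : u * A = X - u ^ 2 * B := by rw [hX]; ring
    rw [h1, show 1 + (X - u ^ 2 * B) + u ^ 2 * (B - β) = 1 + X - y by rw [hy]; ring,
      show 1 + (X - u ^ 2 * B) + u ^ 2 * B = 1 + X by ring]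
    have he' : e = I - Z₀ * (1 + y) := by rw [hIe, hy]; ring
    rw [he']
    field_simp
    ring
  have hinvI : 1 / I ≤ 4 / z₁ := by
    rw [div_le_div_iff₀ hI0 hz₁]; linarith
  have t1 : |(Z - g * (1 + u * A + u ^ 2 * B)) / I| ≤ 4 / z₁ * |Z - g * (1 + u * A + u ^ 2 * B)| := by
    rw [abs_div, abs_of_pos hI0, div_eq_mul_one_div, mul_comm]
    gcongr
  have hXy : |-(X * y) + y ^ 2| ≤ (2 * k * m + m ^ 2) * u ^ 3 * W := by
    calc _ ≤ |-(X * y)| + |y ^ 2| := abs_add_le _ _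
      _ ≤ (u * (2 * k * W)) * (u ^ 2 * m) + (u ^ 2 * m) ^ 2 := by
          rw [abs_neg, abs_mul, abs_pow]; gcongr
      _ = 2 * k * m * u ^ 3 * W + m ^ 2 * u ^ 3 * u * 1 := by ring
      _ ≤ 2 * k * m * u ^ 3 * W + m ^ 2 * u ^ 3 * 1 * W := by gcongr
      _ = _ := by ring
  have h1Xy : |1 + X - y| ≤ (1 + 2 * k + m) * W := by
    calc _ ≤ |1 + X| + |y| := abs_sub _ _
      _ ≤ |1| + |X| + |y| := by gcongr; exact abs_add_le _ _
      _ ≤ 1 + 1 * (2 * k * W) + 1 * m := by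
          rw [abs_one]
          gcongr
          · exact hXb.trans (by gcongr)
          · exact hyb.trans (by gcongr)
      _ ≤ 1 * W + 2 * k * W + m * W := by
          have : m ≤ m * W := le_mul_of_one_le_right hm hW
          linarith
      _ = _ := by ring
  have t2 : |(-(X * y) + y ^ 2) / I| ≤ 4 / z₁ * (2 * k * m + m ^ 2) * u ^ 3 * W := by
    rw [abs_div, abs_of_pos hI0, div_eq_mul_one_div, mul_comm]
    calc _ ≤ 4 / z₁ * ((2 * k * m + m ^ 2) * u ^ 3 * W) := by gcongr
      _ = _ := by ring
  have t3 : |(1 + X - y) * e / (I * Z₀)| ≤ 4 / z₁ ^ 2 * (1 + 2 * k + m) * k * u ^ 3 * W := by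
    rw [abs_div, abs_mul, abs_of_pos (mul_pos hI0 hZ0)]
    calc _ ≤ ((1 + 2 * k + m) * W) * (k * u ^ 3) / (z₁ / 4 * z₁) := by gcongr
      _ = _ := by field_simp
  rw [hid]
  calc _ ≤ _ + |g * ((-(X * y) + y ^ 2) / I - (1 + X - y) * e / (I * Z₀))| := abs_add_le _ _
    _ ≤ 4 / z₁ * |Z - g * (1 + u * A + u ^ 2 * B)| +
        g * (4 / z₁ * (2 * k * m + m ^ 2) * u ^ 3 * W
          + 4 / z₁ ^ 2 * (1 + 2 * k + m) * k * u ^ 3 * W) := by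
        rw [abs_mul, abs_of_nonneg hg]
        refine add_le_add t1 ?_
        gcongr
        exact (abs_sub _ _).trans (add_le_add t2 t3)
    _ = _ := by ring

/-- `P` and `Q` have Gaussian mean zero, so the mass of the unnormalized expansion is the Gaussian
one times 1 + u²β, and division by it removes β. The upper bound `b` on the quadratic form keeps the
Gaussian mass away from zero. -/
theorem exists_normalized_expansion (d : ℕ) {b c k : ℝ} (hb : 0 < b) (hc : 0 < c) (hk : 0 < k) :
    ∃ K u₀ : ℝ, 0 < K ∧ 0 < u₀ ∧ ∀ (H : Matrix (Fin d) (Fin d) ℝ) (Z P Q : Par d → ℝ) (β u : ℝ),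
      (∀ w, c * ‖w‖ ^ 2 ≤ quadForm H w) → (∀ w, quadForm H w ≤ b * ‖w‖ ^ 2) →
      PolyGrowth P → PolyGrowth Q → gaussInt H P = 0 → gaussInt H Q = 0 →
      (∀ w, |P w| ≤ k * (1 + ‖w‖) ^ 10) → (∀ w, |Q w + β| ≤ k * (1 + ‖w‖) ^ 10) →
      0 < u → u ≤ u₀ →
      Integrable (fun w => Z w - gaussWeight H w * (1 + u * P w + u ^ 2 * (Q w + β))) →
      ∫ w, |Z w - gaussWeight H w * (1 + u * P w + u ^ 2 * (Q w + β))| ≤ k * u ^ 3 →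
      Integrable Z ∧ 0 < ∫ w, Z w ∧
      (∀ w, |Z w / (∫ v, Z v) -
          gaussWeight H w / (∫ v, gaussWeight H v) * (1 + u * P w + u ^ 2 * Q w)| ≤
        K * |Z w - gaussWeight H w * (1 + u * P w + u ^ 2 * (Q w + β))| +
          K * u ^ 3 * Real.exp (-(c / 4) * ‖w‖ ^ 2)) ∧
      ∀ w, |gaussWeight H w / (∫ v, gaussWeight H v) * (u * P w + u ^ 2 * Q w)| ≤
        K * u * Real.exp (-(c / 4) * ‖w‖ ^ 2) := by
  obtain ⟨K₁, hK₁, hpow⟩ := exists_pow_mul_exp_le 10 (c := c / 2) (by linarith)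
  obtain ⟨z₁, hz₁⟩ : ∃ z, z = ∫ w : Par d, Real.exp (-(b / 2) * ‖w‖ ^ 2) := ⟨_, rfl⟩
  have hz₁0 : 0 < z₁ := hz₁ ▸ integral_exp_neg_mul_sq_norm_pos (half_pos hb)
  obtain ⟨M, hM⟩ : ∃ M, M = ∫ w : Par d, (1 + ‖w‖) ^ 10 * Real.exp (-(c / 2) * ‖w‖ ^ 2) :=
    ⟨_, rfl⟩
  have hM0 : 0 ≤ M := hM ▸ integral_nonneg fun w => by positivity
  obtain ⟨m, hm⟩ : ∃ m, m = k * M / z₁ := ⟨_, rfl⟩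
  have hm0 : 0 ≤ m := by rw [hm]; positivity
  obtain ⟨K₂, hK₂⟩ : ∃ K₂, K₂ = 4 / z₁ * (2 * k * m + m ^ 2)
    + 4 / z₁ ^ 2 * (1 + 2 * k + m) * k := ⟨_, rfl⟩
  have hK₂0 : 0 ≤ K₂ := by rw [hK₂]; positivity
  -- The summands serve the L¹ error, the error of order u³ and the final bound of order u. The
  -- conditions on u₀ give u²|β| ≤ 1/2 and |e| ≤ z₁/4, hence ∫ Z ≥ z₁/4.
  refine ⟨4 / z₁ + K₂ * K₁ + (2 * k + m) * K₁ / z₁,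
    min 1 (min (1 / (2 * (m + 1))) (z₁ / (4 * k))), by positivity, by positivity, ?_⟩
  intro H Z P Q β u hH hH' hP hQ hP0 hQ0 hPb hQb hu hu0 hint herr
  have hu1 : u ≤ 1 := hu0.trans (min_le_left _ _)
  have hum : u ≤ 1 / (2 * (m + 1)) := hu0.trans ((min_le_right _ _).trans (min_le_left _ _))
  have huk : u ≤ z₁ / (4 * k) := hu0.trans ((min_le_right _ _).trans (min_le_right _ _))
  have hgi := integrable_gaussWeight hc hH
  have hZ₀ : z₁ ≤ ∫ w, gaussWeight H w := by
    rw [hz₁]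
    refine integral_mono (integrable_exp_neg_mul_sq_norm (half_pos hb)) hgi fun w => ?_
    have := hH' w
    exact Real.exp_le_exp.2 (by linarith)
  have hQβ : PolyGrowth (fun w => Q w + β) := hQ.add (PolyGrowth.const β)
  -- β is recovered as the Gaussian mean of Q + β.
  have hβ : |β| ≤ m := by
    have h1 : gaussInt H (fun w => Q w + β) = β * ∫ w, gaussWeight H w := by
      rw [gaussInt_add hc hH hQ (PolyGrowth.const β), hQ0, gaussInt_const, gaussInt_one, zero_add]
    have h2 : |gaussInt H (fun w => Q w + β)| ≤ k * M := by
      rw [hM, ← integral_const_mul]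
      refine abs_integral_le_integral_abs.trans
        (integral_mono (hQβ.integrable_mul_gaussWeight hc hH).abs
          ((integrable_pow_mul_exp 10 (half_pos hc)).const_mul k) fun w => ?_)
      simp only [abs_mul, abs_of_pos (gaussWeight_pos H w), ← mul_assoc]
      exact mul_le_mul (hQb w) (gaussWeight_le hH w) (gaussWeight_pos H w).le (by positivity)
    rw [h1, abs_mul, abs_of_pos (hz₁0.trans_le hZ₀)] at h2
    rw [hm, le_div_iff₀ hz₁0]
    exact (mul_le_mul_of_nonneg_left hZ₀ (abs_nonneg β)).trans h2
  have hF : PolyGrowth fun w => 1 + u * P w + u ^ 2 * (Q w + β) :=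
    ((PolyGrowth.const 1).add ((PolyGrowth.const u).mul hP)).add ((PolyGrowth.const _).mul hQβ)
  have hFi : Integrable fun w => gaussWeight H w * (1 + u * P w + u ^ 2 * (Q w + β)) := by
    simpa only [mul_comm] using hF.integrable_mul_gaussWeight hc hH
  have hFint : ∫ w, gaussWeight H w * (1 + u * P w + u ^ 2 * (Q w + β)) =
      (∫ w, gaussWeight H w) * (1 + u ^ 2 * β) := by
    have h1 : ∫ w, gaussWeight H w * (1 + u * P w + u ^ 2 * (Q w + β)) =
        gaussInt H fun w => 1 + u * P w + u ^ 2 * (Q w + β) := by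
      unfold gaussInt; simp only [mul_comm]
    rw [h1, gaussInt_add hc hH ((PolyGrowth.const 1).add ((PolyGrowth.const u).mul hP))
      ((PolyGrowth.const _).mul hQβ), gaussInt_add hc hH (PolyGrowth.const 1)
      ((PolyGrowth.const u).mul hP), gaussInt_const_mul, gaussInt_const_mul,
      gaussInt_add hc hH hQ (PolyGrowth.const β), hP0, hQ0, gaussInt_const H β, gaussInt_one]
    ring
  have hZi : Integrable Z := by
    refine (hint.add hFi).congr (ae_of_all _ fun w => ?_)
    simp
  obtain ⟨e, he⟩ : ∃ e, e = ∫ w, (Z w - gaussWeight H w * (1 + u * P w + u ^ 2 * (Q w + β))) :=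
    ⟨_, rfl⟩
  have heb : |e| ≤ k * u ^ 3 := he ▸ abs_integral_le_integral_abs.trans herr
  have hI : ∫ w, Z w = (∫ w, gaussWeight H w) * (1 + u ^ 2 * β) + e := by
    rw [he, integral_sub hZi hFi, hFint]; ring
  have hu2 : u ^ 2 ≤ u := by nlinarith
  have hu3 : u ^ 3 ≤ u := pow_le_of_le_one hu.le hu1 (by norm_num)
  have hyb : u ^ 2 * |β| ≤ 1 / 2 := by
    calc u ^ 2 * |β| ≤ u * (m + 1) := by gcongr; linarith
      _ ≤ 1 / (2 * (m + 1)) * (m + 1) := by gcongr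
      _ = 1 / 2 := by field_simp
  have heb' : |e| ≤ z₁ / 4 := by
    calc |e| ≤ k * u := heb.trans (by gcongr)
      _ ≤ k * (z₁ / (4 * k)) := by gcongr
      _ = z₁ / 4 := by field_simp
  have hI4 : z₁ / 4 ≤ ∫ w, Z w := by
    rw [hI]
    have h1 : 1 / 2 ≤ 1 + u ^ 2 * β := by
      have h2 : -(u ^ 2 * |β|) ≤ u ^ 2 * β := by
        have := neg_abs_le β
        nlinarith [sq_nonneg u]
      linarith
    have h3 : z₁ * (1 / 2) ≤ (∫ w, gaussWeight H w) * (1 + u ^ 2 * β) :=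
      mul_le_mul hZ₀ h1 (by norm_num) (hz₁0.le.trans hZ₀)
    have := neg_abs_le e
    linarith
  have hgexp : ∀ w, (1 + ‖w‖) ^ 10 * gaussWeight H w ≤ K₁ * Real.exp (-(c / 4) * ‖w‖ ^ 2) := by
    intro w
    have h1 := hpow ‖w‖ (norm_nonneg w)
    rw [show c / 2 / 2 = c / 4 by ring] at h1
    exact (mul_le_mul_of_nonneg_left (gaussWeight_le hH w) (by positivity)).trans h1
  refine ⟨hZi, by linarith, fun w => ?_, fun w => ?_⟩
  · have hW : (1:ℝ) ≤ (1 + ‖w‖) ^ 10 := one_le_pow₀ (by linarith [norm_nonneg w])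
    have h := normalized_difference_le (Z := Z w) (gaussWeight_pos H w).le hu.le hu1 hz₁0 hZ₀ hI4
      hW hk.le hm0 (hPb w) (hQb w) hβ heb hI
    rw [add_sub_cancel_right, ← hK₂] at h
    refine h.trans (add_le_add ?_ ?_)
    · gcongr
      have : 0 ≤ K₂ * K₁ + (2 * k + m) * K₁ / z₁ := by positivity
      linarith
    · calc K₂ * u ^ 3 * ((1 + ‖w‖) ^ 10 * gaussWeight H w)
          ≤ K₂ * u ^ 3 * (K₁ * Real.exp (-(c / 4) * ‖w‖ ^ 2)) :=
            mul_le_mul_of_nonneg_left (hgexp w) (by positivity)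
        _ = K₂ * K₁ * u ^ 3 * Real.exp (-(c / 4) * ‖w‖ ^ 2) := by ring
        _ ≤ _ := by
            gcongr
            have : 0 ≤ 4 / z₁ + (2 * k + m) * K₁ / z₁ := by positivity
            linarith
  · have hW : (1:ℝ) ≤ (1 + ‖w‖) ^ 10 := one_le_pow₀ (by linarith [norm_nonneg w])
    have hQ' : |Q w| ≤ (k + m) * (1 + ‖w‖) ^ 10 := by
      calc |Q w| = |(Q w + β) - β| := by ring_nf
        _ ≤ |Q w + β| + |β| := abs_sub _ _
        _ ≤ k * (1 + ‖w‖) ^ 10 + m * (1 + ‖w‖) ^ 10 :=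
            add_le_add (hQb w) (hβ.trans (le_mul_of_one_le_right hm0 hW))
        _ = _ := by ring
    rw [abs_mul, abs_div, abs_of_pos (gaussWeight_pos H w), abs_of_pos (hz₁0.trans_le hZ₀)]
    have hPQ : |u * P w + u ^ 2 * Q w| ≤ u * ((2 * k + m) * (1 + ‖w‖) ^ 10) := by
      calc _ ≤ |u * P w| + |u ^ 2 * Q w| := abs_add_le _ _
        _ ≤ u * (k * (1 + ‖w‖) ^ 10) + u * ((k + m) * (1 + ‖w‖) ^ 10) := by
            rw [abs_mul, abs_mul, abs_of_pos hu, abs_of_nonneg (sq_nonneg u)]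
            gcongr
            exact hPb w
        _ = _ := by ring
    calc _ ≤ gaussWeight H w / z₁ * (u * ((2 * k + m) * (1 + ‖w‖) ^ 10)) := by
          refine mul_le_mul ?_ hPQ (abs_nonneg _)
            (div_nonneg (gaussWeight_pos H w).le hz₁0.le)
          have := (gaussWeight_pos H w).le
          gcongr
      _ = (2 * k + m) / z₁ * u * ((1 + ‖w‖) ^ 10 * gaussWeight H w) := by ring
      _ ≤ (2 * k + m) / z₁ * u * (K₁ * Real.exp (-(c / 4) * ‖w‖ ^ 2)) := by
          exact mul_le_mul_of_nonneg_left (hgexp w) (by positivity)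
      _ = (2 * k + m) * K₁ / z₁ * u * Real.exp (-(c / 4) * ‖w‖ ^ 2) := by ring
      _ ≤ _ := by
          gcongr
          have : 0 ≤ 4 / z₁ + K₂ * K₁ := by positivity
          linarith

/-! ### The unnormalized posterior -/

section Kernel

variable {d : ℕ} {Θ : Set (Par d)} {prior f : Par d → ℝ} {C : Matrix (Fin d) (Fin d) ℝ}
  {t : Par d} {r : ℝ}

lemma continuous_calib : Continuous (calib C t) := by
  have : calib C t = fun θ => t + mulVecL C (θ - t) := funext (calib_eq C t)
  rw [this]
  fun_prop

lemma srKernel_nonneg (hprior : ∀ θ ∈ Θ, 0 ≤ prior θ) (θ : Par d) :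
    0 ≤ srKernel Θ prior f C t θ := by
  unfold srKernel
  split_ifs with h
  · exact mul_nonneg (hprior θ h.1) (Real.exp_pos _).le
  · exact le_rfl

/-- The integrable majorant of the prior. -/
def priorWeight (Θ : Set (Par d)) (prior : Par d → ℝ) (r : ℝ) : Par d → ℝ :=
  Θ.indicator fun θ => prior θ * (1 + ‖θ‖) ^ (-r)

lemma priorWeight_nonneg (hprior : ∀ θ ∈ Θ, 0 ≤ prior θ) (θ : Par d) :
    0 ≤ priorWeight Θ prior r θ :=
  Set.indicator_nonneg (fun θ hθ => mul_nonneg (hprior θ hθ) (by positivity)) θ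

lemma integrable_priorWeight (hΘ : IsOpen Θ)
    (hint : IntegrableOn (fun θ => prior θ * (1 + ‖θ‖) ^ (-r)) Θ) :
    Integrable (priorWeight Θ prior r) :=
  (integrable_indicator_iff hΘ.measurableSet).2 hint

/-- Measurability of the prior on Θ is extracted from the integrability of its weighted version, by
multiplying back by (1 + ‖θ‖)^r. -/
lemma aestronglyMeasurable_srKernel (hΘ : IsOpen Θ)
    (hint : IntegrableOn (fun θ => prior θ * (1 + ‖θ‖) ^ (-r)) Θ)
    (hf : Measurable (Θ.indicator f)) :
    AEStronglyMeasurable (srKernel Θ prior f C t) volume := by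
  have h1 : AEStronglyMeasurable (fun θ => priorWeight Θ prior r θ * (1 + ‖θ‖) ^ r) volume := by
    refine (integrable_priorWeight hΘ hint).aestronglyMeasurable.mul ?_
    refine Continuous.aestronglyMeasurable ?_
    refine Continuous.rpow_const (by fun_prop) fun θ => Or.inl ?_
    positivity
  have h2 : Measurable fun θ => Real.exp (-(Θ.indicator f (calib C t θ))) :=
    Real.measurable_exp.comp (hf.comp continuous_calib.measurable).neg
  have h12 : AEStronglyMeasurable (fun θ => priorWeight Θ prior r θ * (1 + ‖θ‖) ^ r *
      Real.exp (-(Θ.indicator f (calib C t θ)))) volume := h1.mul h2.aestronglyMeasurable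
  have h3 := h12.indicator
    (hΘ.preimage (continuous_calib (C := C) (t := t))).measurableSet
  refine h3.congr (ae_of_all _ fun θ => ?_)
  have hpre : θ ∈ calib C t ⁻¹' Θ ↔ calib C t θ ∈ Θ := Iff.rfl
  by_cases hb : calib C t θ ∈ Θ
  swap
  · rw [Set.indicator_of_notMem (hpre.not.2 hb), srKernel, if_neg fun h => hb h.2]
  rw [Set.indicator_of_mem (hpre.2 hb), Set.indicator_of_mem hb, srKernel, priorWeight]
  by_cases ha : θ ∈ Θ
  swap
  · rw [Set.indicator_of_notMem ha, if_neg fun h => ha h.1, zero_mul, zero_mul]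
  rw [Set.indicator_of_mem ha, if_pos ⟨ha, hb⟩, mul_assoc (prior θ),
    ← Real.rpow_add (by positivity)]
  simp

/-- Since `C` shrinks lengths by at most Λ, θ* is at distance at least δ/Λ from `t`, hence δ/(2Λ)
from θ₀, and the separation applies there. Of its gain nε, half pays for f(t) - f(θ₀) and half
remains as exponential decay. The logarithmic term, with nε ≥ 1, yields (1 + ‖θ*‖)^(-r), which is
comparable to the weight that makes the prior integrable. -/
lemma srKernel_tail_le {θ₀ : Par d} {n : ℕ} {Λ δ ε T p₀ : ℝ} (hr : 0 ≤ r)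
    (hprior : ∀ θ ∈ Θ, 0 ≤ prior θ) (hΛ : 1 ≤ Λ) (hC : ∀ w, ‖w‖ ≤ Λ * ‖mulVecL C w‖)
    (hsep : ∀ θ ∈ Θ, δ / (2 * Λ) ≤ ‖θ - θ₀‖ →
      n * ε * (1 + r * Real.log (1 + ‖θ‖)) ≤ f θ - f θ₀)
    (ht : ‖t - θ₀‖ ≤ δ / (2 * Λ)) (hT : ‖t‖ ≤ T) (hft : f t - f θ₀ ≤ n * ε / 2)
    (hn : 1 ≤ n * ε) (hp₀ : 0 < p₀) (hpt : p₀ ≤ prior t) {θ : Par d} (hθ : δ ≤ ‖θ - t‖) :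
    srKernel Θ prior f C t θ / (prior t * Real.exp (-f t)) ≤
      ((1 + T + Λ * T + Λ) ^ r / p₀ * Real.exp (-(n * ε / 2))) * priorWeight Θ prior r θ := by
  have hT0 : 0 ≤ T := (norm_nonneg t).trans hT
  have hΛ0 : 0 < Λ := by linarith
  have hpos : 0 < prior t := hp₀.trans_le hpt
  unfold srKernel
  split_ifs with h
  swap
  · rw [zero_div]
    exact mul_nonneg (by positivity) (priorWeight_nonneg hprior θ)
  obtain ⟨h1, h2⟩ := h
  set η := calib C t θ with hη
  have hηt : η - t = mulVecL C (θ - t) := by rw [hη, calib_eq]; abel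
  have hd1 : ‖θ - t‖ ≤ Λ * ‖η - t‖ := by rw [hηt]; exact hC _
  have hd2 : δ / (2 * Λ) ≤ ‖η - θ₀‖ := by
    have h3 : ‖η - t‖ ≤ ‖η - θ₀‖ + ‖t - θ₀‖ := by
      calc ‖η - t‖ = ‖(η - θ₀) - (t - θ₀)‖ := by congr 1; abel
        _ ≤ _ := norm_sub_le _ _
    have h4 : δ / Λ ≤ ‖η - t‖ := by
      rw [div_le_iff₀ hΛ0, mul_comm]; exact hθ.trans hd1
    have h5 : δ / Λ = δ / (2 * Λ) + δ / (2 * Λ) := by field_simp; norm_num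
    linarith
  have hs := hsep η h2 hd2
  have hlog : 0 ≤ Real.log (1 + ‖η‖) := Real.log_nonneg (by linarith [norm_nonneg η])
  have hexp : Real.exp (-f η) ≤
      Real.exp (-f t) * (Real.exp (-(n * ε / 2)) * (1 + ‖η‖) ^ (-r)) := by
    rw [Real.rpow_def_of_pos (by positivity), ← Real.exp_add, ← Real.exp_add]
    refine Real.exp_le_exp.2 ?_
    have h6 : r * Real.log (1 + ‖η‖) ≤ n * ε * (r * Real.log (1 + ‖η‖)) :=
      le_mul_of_one_le_left (mul_nonneg hr hlog) hn
    linarith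
  have hnorm : 1 + ‖θ‖ ≤ (1 + T + Λ * T + Λ) * (1 + ‖η‖) := by
    have h7 : ‖θ‖ ≤ ‖θ - t‖ + ‖t‖ := by simpa using norm_add_le (θ - t) t
    have h8 : ‖η - t‖ ≤ ‖η‖ + ‖t‖ := norm_sub_le _ _
    have h9 : Λ * ‖η - t‖ ≤ Λ * (‖η‖ + T) := by gcongr; linarith
    have h10 : 0 ≤ (1 + T + Λ * T) * ‖η‖ := by positivity
    nlinarith
  have hpow : (1 + ‖η‖) ^ (-r) ≤ (1 + T + Λ * T + Λ) ^ r * (1 + ‖θ‖) ^ (-r) := by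
    rw [Real.rpow_neg (by positivity), Real.rpow_neg (by positivity), ← div_eq_mul_inv,
      inv_eq_one_div, div_le_div_iff₀ (by positivity) (by positivity), one_mul,
      ← Real.mul_rpow (by positivity) (by positivity)]
    exact Real.rpow_le_rpow (by positivity) hnorm hr
  have hpw : priorWeight Θ prior r θ = prior θ * (1 + ‖θ‖) ^ (-r) :=
    Set.indicator_of_mem h1 _
  rw [hpw]
  have hpθ := hprior θ h1
  calc prior θ * Real.exp (-f η) / (prior t * Real.exp (-f t))
      ≤ prior θ * (Real.exp (-f t) * (Real.exp (-(n * ε / 2)) *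
          ((1 + T + Λ * T + Λ) ^ r * (1 + ‖θ‖) ^ (-r)))) / (p₀ * Real.exp (-f t)) := by
        have := hexp.trans (mul_le_mul_of_nonneg_left (mul_le_mul_of_nonneg_left hpow
          (Real.exp_pos (-(n * ε / 2))).le) (Real.exp_pos (-f t)).le)
        gcongr
    _ = _ := by
        have := (Real.exp_pos (-f t)).ne'
        field_simp

end Kernel

/-! ### Affine changes of variables. -/

section ChangeOfVariables

variable {d : ℕ}

lemma integral_comp_add_smul (g : Par d → ℝ) (t : Par d) {u : ℝ} (hu : 0 < u) :
    ∫ w, g (t + u • w) = (u ^ d)⁻¹ * ∫ θ, g θ := by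
  rw [Measure.integral_comp_smul volume (fun x => g (t + x)) u, finrank_euclideanSpace_fin,
    abs_of_pos (by positivity), smul_eq_mul, integral_add_left_eq_self]

lemma integrable_comp_add_smul_iff (g : Par d → ℝ) (t : Par d) {u : ℝ} (hu : 0 < u) :
    Integrable (fun w => g (t + u • w)) ↔ Integrable g := by
  rw [integrable_comp_smul_iff volume (fun x => g (t + x)) hu.ne']
  exact ⟨fun h => by simpa using h.comp_add_left (-t), fun h => h.comp_add_left t⟩

lemma aestronglyMeasurable_comp_add_smul {g : Par d → ℝ} (hg : AEStronglyMeasurable g volume)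
    (t : Par d) {u : ℝ} (hu : 0 < u) :
    AEStronglyMeasurable (fun w => g (t + u • w)) volume := by
  have h1 : AEStronglyMeasurable (fun x => g (t + x)) volume :=
    hg.comp_measurePreserving (measurePreserving_add_left volume t)
  refine h1.comp_quasiMeasurePreserving (f := fun w => u • w) ⟨by fun_prop, ?_⟩
  rw [Measure.map_addHaar_smul _ hu.ne']
  exact Measure.smul_absolutelyContinuous

end ChangeOfVariables

lemma exists_pow_mul_exp_nat_le (N : ℕ) {ε : ℝ} (hε : 0 < ε) :
    ∃ K : ℝ, 0 < K ∧ ∀ n : ℕ, (n : ℝ) ^ N * Real.exp (-(n * ε / 2)) ≤ K := by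
  refine ⟨N.factorial * (2 / ε) ^ N, by positivity, fun n => ?_⟩
  have h := Real.pow_div_factorial_le_exp (n * ε / 2) (by positivity) N
  rw [div_le_iff₀ (by positivity)] at h
  rw [Real.exp_neg, mul_inv_le_iff₀ (Real.exp_pos _)]
  calc (n : ℝ) ^ N = (n * ε / 2) ^ N * (2 / ε) ^ N := by
        rw [← mul_pow]; congr 1; field_simp
    _ ≤ (Real.exp (n * ε / 2) * N.factorial) * (2 / ε) ^ N := by gcongr
    _ = _ := by ring

/-! ### The expansion on the whole space -/

/-- The unnormalized posterior in the local coordinate, relative to its value at `t`. -/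
def relKernel {d : ℕ} (n : ℕ) (Θ : Set (Par d)) (prior f : Par d → ℝ)
    (C : Matrix (Fin d) (Fin d) ℝ) (t w : Par d) : ℝ :=
  srKernel Θ prior f C t (t + (Real.sqrt n)⁻¹ • w) / (prior t * Real.exp (-f t))

namespace LocalRegularity

variable {d n : ℕ} {Θ : Set (Par d)} {prior f : Par d → ℝ} {C : Matrix (Fin d) (Fin d) ℝ}
  {θ₀ t : Par d} {ρ B c p₀ δ : ℝ}

/-- For such w both θ and θ* lie in the ball, so the restriction of the kernel to Θ is not active.
-/
lemma relKernel_eq (h : LocalRegularity n prior f C θ₀ t ρ B c p₀)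
    (hball : Metric.ball θ₀ ρ ⊆ Θ) (hδ : 0 < δ) (hδρ : δ * (1 + ‖mulVecL C‖) ≤ ρ / 2) {w : Par d}
    (hw : ‖w‖ ≤ δ * Real.sqrt n) :
    relKernel n Θ prior f C t w = localRatio n prior f C t w := by
  have hn : (0 : ℝ) < n := by exact_mod_cast h.n_pos
  have hsq : 0 < Real.sqrt n := Real.sqrt_pos.2 hn
  have huw : ‖(Real.sqrt n)⁻¹ • w‖ ≤ δ := by
    rw [norm_smul, norm_inv, Real.norm_of_nonneg hsq.le, inv_mul_le_iff₀ hsq, mul_comm]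
    exact hw
  have hCn := norm_nonneg (mulVecL C)
  have e : calib C t (t + (Real.sqrt n)⁻¹ • w) = t + (Real.sqrt n)⁻¹ • mulVecL C w := by
    rw [calib_eq, add_sub_cancel_left, map_smul]
  have h1 : t + (Real.sqrt n)⁻¹ • w ∈ Θ := hball (h.add_mem_ball (by nlinarith))
  have h2 : t + (Real.sqrt n)⁻¹ • mulVecL C w ∈ Θ := by
    refine hball (h.add_mem_ball ?_)
    rw [← map_smul]
    refine ((mulVecL C).le_opNorm _).trans (le_trans ?_ hδρ)
    rw [mul_comm]
    exact mul_le_mul huw (by linarith) hCn hδ.le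
  rw [relKernel, srKernel, if_pos ⟨h1, e ▸ h2⟩, localRatio, e]
  rw [mul_div_mul_comm, ← Real.exp_sub]
  congr 2
  ring

/-- Expand at the critical point `t` and evaluate at θ₀: 1/2 + 1/6 + 1/24 + 1 ≤ 2. This makes the
excess score of `t` over θ₀ a small multiple of n once `t` is close. -/
lemma score_sub_center_le (h : LocalRegularity n prior f C θ₀ t ρ B c p₀) (hρ : 0 < ρ)
    (hB : 0 < B) (h1 : ‖t - θ₀‖ ≤ 1) : f t - f θ₀ ≤ n * (2 * B * ‖t - θ₀‖) := by
  have hv : ‖θ₀ - t‖ ≤ ρ / 2 := by rw [norm_sub_rev]; exact h.near.le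
  have hT := h.abs_score_taylor_le hρ hv
  have htb := h.mem_ball hρ
  have b2 := abs_iteratedFDeriv_const_le (h.bound_two t htb) (θ₀ - t)
  have b3 := abs_iteratedFDeriv_const_le (h.bound_three t htb) (θ₀ - t)
  have b4 := abs_iteratedFDeriv_const_le (h.bound_four t htb) (θ₀ - t)
  rw [add_sub_cancel] at hT
  rw [norm_sub_rev θ₀ t] at *
  have hx0 : 0 ≤ ‖t - θ₀‖ := norm_nonneg _
  generalize ‖t - θ₀‖ = x at *
  have hnB : 0 ≤ n * B := by positivity
  have q (k : ℕ) (hk : k ≠ 0) : n * B * x ^ k ≤ n * B * x :=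
    mul_le_mul_of_nonneg_left (pow_le_of_le_one hx0 h1 hk) hnB
  have q2 := q 2 (by norm_num)
  have q3 := q 3 (by norm_num)
  have q4 := q 4 (by norm_num)
  have q5 := q 5 (by norm_num)
  have q0 : 0 ≤ n * B * x := by positivity
  rw [abs_le] at hT b2 b3 b4
  linarith [hT.1, b2.1, b3.1, b4.1]

end LocalRegularity

namespace LocalRegularity

variable {d n : ℕ} {Θ : Set (Par d)} {prior f : Par d → ℝ} {C : Matrix (Fin d) (Fin d) ℝ}
  {θ₀ t : Par d} {ρ B c p₀ δ K K' τ r : ℝ}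

/-- Outside the local range kernel and expansion are bounded separately, the kernel by the tail
estimate and the expansion by its Gaussian decay. -/
lemma abs_relKernel_sub_le (h : LocalRegularity n prior f C θ₀ t ρ B c p₀)
    (hprior : ∀ θ ∈ Θ, 0 ≤ prior θ) (hp₀ : 0 < p₀) (hδ : 0 < δ) (hK : 0 < K) (hc : 0 < c)
    (hcoef : ∀ w, |A1 n prior f C t w| ≤ K * (1 + ‖w‖) ^ 10 ∧
      |A2 n prior f C t w - A2 n prior f C t 0| ≤ K * (1 + ‖w‖) ^ 10)
    (hloc : ∀ w, ‖w‖ ≤ δ * Real.sqrt n →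
      |relKernel n Θ prior f C t w - localExpansion n prior f C t w| ≤
        K * (Real.sqrt n)⁻¹ ^ 3 * Real.exp (-(c / 8) * ‖w‖ ^ 2))
    (hτ : 0 ≤ τ)
    (htail : ∀ θ, δ ≤ ‖θ - t‖ → srKernel Θ prior f C t θ / (prior t * Real.exp (-f t)) ≤
      τ * priorWeight Θ prior r θ)
    (hpow : ∀ x : ℝ, 0 ≤ x → (1 + x) ^ 13 * Real.exp (-(c / 2) * x ^ 2) ≤
      K' * Real.exp (-(c / 2 / 2) * x ^ 2)) (hK' : 0 < K') (w : Par d) :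
    |relKernel n Θ prior f C t w - localExpansion n prior f C t w| ≤
      (K + (1 + 2 * K) * K' / δ ^ 3) * (Real.sqrt n)⁻¹ ^ 3 * Real.exp (-(c / 8) * ‖w‖ ^ 2) +
        τ * priorWeight Θ prior r (t + (Real.sqrt n)⁻¹ • w) := by
  have hn : (0 : ℝ) < n := by exact_mod_cast h.n_pos
  have hn1 : (1 : ℝ) ≤ n := by exact_mod_cast h.n_pos
  have hsq : 0 < Real.sqrt n := Real.sqrt_pos.2 hn
  have hpw := priorWeight_nonneg (r := r) hprior (t + (Real.sqrt n)⁻¹ • w)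
  have hpt : 0 < prior t := hp₀.trans_le h.prior_pos
  by_cases hw : ‖w‖ ≤ δ * Real.sqrt n
  · refine (hloc w hw).trans ?_
    have h1 : 0 ≤ (1 + 2 * K) * K' / δ ^ 3 * (Real.sqrt n)⁻¹ ^ 3 *
        Real.exp (-(c / 8) * ‖w‖ ^ 2) := by positivity
    have h2 := mul_nonneg hτ hpw
    linarith
  push Not at hw
  have hrel0 : 0 ≤ relKernel n Θ prior f C t w :=
    div_nonneg (srKernel_nonneg hprior _) (by positivity)
  have hrel : relKernel n Θ prior f C t w ≤
      τ * priorWeight Θ prior r (t + (Real.sqrt n)⁻¹ • w) := by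
    refine htail _ ?_
    rw [add_sub_cancel_left, norm_smul, norm_inv, Real.norm_of_nonneg hsq.le,
      le_inv_mul_iff₀ hsq, mul_comm]
    exact hw.le
  have hgw := gaussWeight_le h.curvature w
  have hg0 := (gaussWeight_pos (Hmat n f C t) w).le
  have hw0 : 0 ≤ ‖w‖ := norm_nonneg w
  have hP := hpow ‖w‖ hw0
  have hexp : Real.exp (-(c / 2 / 2) * ‖w‖ ^ 2) ≤ Real.exp (-(c / 8) * ‖w‖ ^ 2) := by
    refine Real.exp_le_exp.2 ?_
    have := mul_nonneg hc.le (sq_nonneg ‖w‖)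
    linarith
  have hu1 : (Real.sqrt n)⁻¹ ≤ 1 := inv_le_one_of_one_le₀ (Real.one_le_sqrt.2 hn1)
  have hni : (n : ℝ)⁻¹ ≤ 1 := inv_le_one_of_one_le₀ hn1
  have hni0 : 0 ≤ (n : ℝ)⁻¹ := by positivity
  have hu0 : 0 < (Real.sqrt n)⁻¹ := by positivity
  -- Its cube buys the factor n^(-3/2) at the price of three more powers of 1 + ‖w‖, hence the
  -- exponent 13 = 10 + 3.
  have hx : 1 ≤ (Real.sqrt n)⁻¹ * (1 + ‖w‖) / δ := by
    rw [le_div_iff₀ hδ, one_mul, le_inv_mul_iff₀ hsq, mul_comm]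
    linarith
  have hx3 : 1 ≤ ((Real.sqrt n)⁻¹ * (1 + ‖w‖) / δ) ^ 3 := one_le_pow₀ hx
  obtain ⟨h1, h2⟩ := hcoef w
  have hL : |localExpansion n prior f C t w| ≤
      (1 + 2 * K) * K' / δ ^ 3 * (Real.sqrt n)⁻¹ ^ 3 * Real.exp (-(c / 8) * ‖w‖ ^ 2) := by
    rw [localExpansion, abs_mul, abs_of_nonneg hg0]
    generalize A1 n prior f C t w = a at *
    generalize A2 n prior f C t w - A2 n prior f C t 0 = b at *
    generalize gaussWeight (Hmat n f C t) w = g at *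
    generalize (n : ℝ)⁻¹ = m at *
    generalize (Real.sqrt n)⁻¹ = u at *
    generalize ‖w‖ = x at *
    have h3 : |1 + u * a + m * b| ≤ (1 + 2 * K) * (1 + x) ^ 10 := by
      have e1 : |u * a| ≤ |a| := by
        rw [abs_mul, abs_of_pos hu0]; exact mul_le_of_le_one_left (abs_nonneg a) hu1
      have e2 : |m * b| ≤ |b| := by
        rw [abs_mul, abs_of_nonneg hni0]; exact mul_le_of_le_one_left (abs_nonneg b) hni
      have e3 := (abs_add_three 1 (u * a) (m * b))
      rw [abs_one] at e3
      have e4 : 1 ≤ (1 + x) ^ 10 := one_le_pow₀ (by linarith)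
      linarith
    calc g * |1 + u * a + m * b|
        ≤ Real.exp (-(c / 2) * x ^ 2) * ((1 + 2 * K) * (1 + x) ^ 10) := by gcongr
      _ ≤ Real.exp (-(c / 2) * x ^ 2) * ((1 + 2 * K) * (1 + x) ^ 10) *
          (u * (1 + x) / δ) ^ 3 := le_mul_of_one_le_right (by positivity) hx3
      _ = (1 + 2 * K) / δ ^ 3 * u ^ 3 * ((1 + x) ^ 13 * Real.exp (-(c / 2) * x ^ 2)) := by
          field_simp
      _ ≤ (1 + 2 * K) / δ ^ 3 * u ^ 3 * (K' * Real.exp (-(c / 8) * x ^ 2)) :=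
          mul_le_mul_of_nonneg_left (hP.trans (mul_le_mul_of_nonneg_left hexp hK'.le))
            (by positivity)
      _ = _ := by ring
  have h4 : 0 ≤ K * (Real.sqrt n)⁻¹ ^ 3 * Real.exp (-(c / 8) * ‖w‖ ^ 2) := by positivity
  have h5 := abs_sub (relKernel n Θ prior f C t w) (localExpansion n prior f C t w)
  rw [abs_of_nonneg hrel0] at h5
  linarith

lemma continuous_localExpansion : Continuous (localExpansion n prior f C t) := by
  have h1 : Continuous (A1 n prior f C t) := (polyGrowth_linCubic _ _).1
  have h2 : Continuous (A2 n prior f C t) := (polyGrowth_centredSextic _ _ _ _ _).1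
  unfold localExpansion
  exact (continuous_gaussWeight _).mul (by fun_prop)

lemma integral_abs_relKernel_sub_le (hn0 : 0 < n) (hΘ : IsOpen Θ)
    (hint : IntegrableOn (fun θ => prior θ * (1 + ‖θ‖) ^ (-r)) Θ)
    (hf : Measurable (Θ.indicator f)) (hc : 0 < c)
    (hbound : ∀ w, |relKernel n Θ prior f C t w - localExpansion n prior f C t w| ≤
      K * (Real.sqrt n)⁻¹ ^ 3 * Real.exp (-(c / 8) * ‖w‖ ^ 2) +
        τ * priorWeight Θ prior r (t + (Real.sqrt n)⁻¹ • w)) :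
    Integrable (fun w => relKernel n Θ prior f C t w - localExpansion n prior f C t w) ∧
    ∫ w, |relKernel n Θ prior f C t w - localExpansion n prior f C t w| ≤
      K * (Real.sqrt n)⁻¹ ^ 3 * (∫ w : Par d, Real.exp (-(c / 8) * ‖w‖ ^ 2)) +
        τ * (Real.sqrt n ^ d * ∫ θ, priorWeight Θ prior r θ) := by
  have hu : 0 < (Real.sqrt n)⁻¹ := inv_pos.2 (Real.sqrt_pos.2 (by exact_mod_cast hn0))
  have hi1 : Integrable fun w : Par d =>
      K * (Real.sqrt n)⁻¹ ^ 3 * Real.exp (-(c / 8) * ‖w‖ ^ 2) :=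
    (integrable_exp_neg_mul_sq_norm (by positivity)).const_mul _
  have hi2 : Integrable fun w : Par d =>
      τ * priorWeight Θ prior r (t + (Real.sqrt n)⁻¹ • w) :=
    ((integrable_comp_add_smul_iff _ t hu).2 (integrable_priorWeight hΘ hint)).const_mul _
  have hm : AEStronglyMeasurable
      (fun w => relKernel n Θ prior f C t w - localExpansion n prior f C t w) volume := by
    refine AEStronglyMeasurable.sub ?_ continuous_localExpansion.aestronglyMeasurable
    exact (aestronglyMeasurable_comp_add_smul (aestronglyMeasurable_srKernel hΘ hint hf)
      t hu).aemeasurable.div_const (prior t * Real.exp (-f t)) |>.aestronglyMeasurable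
  have hi := (hi1.add hi2).mono' hm (ae_of_all _ hbound)
  refine ⟨hi, ?_⟩
  calc ∫ w, |relKernel n Θ prior f C t w - localExpansion n prior f C t w|
      ≤ ∫ w, (K * (Real.sqrt n)⁻¹ ^ 3 * Real.exp (-(c / 8) * ‖w‖ ^ 2) +
        τ * priorWeight Θ prior r (t + (Real.sqrt n)⁻¹ • w)) :=
        integral_mono hi.abs (hi1.add hi2) hbound
    _ = _ := by
        rw [integral_add hi1 hi2, integral_const_mul, integral_const_mul,
          integral_comp_add_smul _ t hu, inv_pow (Real.sqrt n) d, inv_inv]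

end LocalRegularity

/-! ### The normalized posterior in the coordinates θ and w. -/

section Posterior

variable {d n : ℕ} {Θ : Set (Par d)} {prior f : Par d → ℝ} {C : Matrix (Fin d) (Fin d) ℝ}
  {t : Par d}

lemma integral_relKernel (hn : 0 < n) :
    ∫ w, relKernel n Θ prior f C t w =
      Real.sqrt n ^ d * (∫ θ, srKernel Θ prior f C t θ) / (prior t * Real.exp (-f t)) := by
  have hu : 0 < (Real.sqrt n)⁻¹ := inv_pos.2 (Real.sqrt_pos.2 (by exact_mod_cast hn))
  unfold relKernel
  rw [integral_div, integral_comp_add_smul _ t hu, inv_pow, inv_inv]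

lemma integrable_relKernel_iff (hn : 0 < n) (ht : prior t ≠ 0) :
    Integrable (relKernel n Θ prior f C t) ↔ Integrable (srKernel Θ prior f C t) := by
  have hu : 0 < (Real.sqrt n)⁻¹ := inv_pos.2 (Real.sqrt_pos.2 (by exact_mod_cast hn))
  rw [← integrable_comp_add_smul_iff (srKernel Θ prior f C t) t hu]
  have h0 : (prior t * Real.exp (-f t))⁻¹ ≠ 0 :=
    inv_ne_zero (mul_ne_zero ht (Real.exp_pos _).ne')
  unfold relKernel
  simp only [div_eq_mul_inv]
  exact integrable_mul_const_iff h0.isUnit _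

lemma srPosteriorW_eq (hn : 0 < n) (ht : prior t ≠ 0) (w : Par d) :
    srPosteriorW n Θ prior f C t w =
      relKernel n Θ prior f C t w / ∫ v, relKernel n Θ prior f C t v := by
  have hs : Real.sqrt n ≠ 0 := (Real.sqrt_pos.2 (by exact_mod_cast hn)).ne'
  have he := (Real.exp_pos (-f t)).ne'
  rw [integral_relKernel hn, srPosteriorW, srPosterior, relKernel]
  generalize (∫ θ, srKernel Θ prior f C t θ) = I
  generalize srKernel Θ prior f C t (t + (Real.sqrt n)⁻¹ • w) = k
  -- A vanishing integral makes both sides zero by the convention for division by zero, so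
  -- integrability is not needed.
  by_cases hI : I = 0
  · simp [hI]
  rw [inv_pow]
  field_simp

lemma srExpansion_eq (hH : (Hmat n f C t).PosDef) (w : Par d) :
    srExpansion n prior f C t w = gaussWeight (Hmat n f C t) w /
      (∫ v, gaussWeight (Hmat n f C t) v) * (1 + (Real.sqrt n)⁻¹ * A1 n prior f C t w +
        (Real.sqrt n)⁻¹ ^ 2 * A2 n prior f C t w) := by
  rw [srExpansion, gaussDensity_inv hH, inv_pow, Real.sq_sqrt n.cast_nonneg]

lemma gaussDensity_smul_inv (hn : 0 < n) (H : Matrix (Fin d) (Fin d) ℝ) (hH : H.PosDef)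
    (v : Par d) :
    gaussDensity ((n : ℝ)⁻¹ • H⁻¹) v =
      Real.sqrt n ^ d * gaussDensity H⁻¹ (Real.sqrt n • v) := by
  have hn0 : (n : ℝ) ≠ 0 := by exact_mod_cast hn.ne'
  have hs : 0 < Real.sqrt n := Real.sqrt_pos.2 (by exact_mod_cast hn)
  have hu : IsUnit H.det := hH.det_pos.ne'.isUnit
  have hinv : ((n : ℝ)⁻¹ • H⁻¹)⁻¹ = (n : ℝ) • H := by
    refine Matrix.inv_eq_left_inv ?_
    rw [Matrix.smul_mul, Matrix.mul_smul, smul_smul, mul_inv_cancel₀ hn0, one_smul,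
      Matrix.mul_nonsing_inv _ hu]
  unfold gaussDensity
  rw [hinv, Matrix.nonsing_inv_nonsing_inv _ hu, Matrix.det_smul, Fintype.card_fin]
  have e1 : Real.sqrt ((2 * Real.pi) ^ d * ((n : ℝ)⁻¹ ^ d * (H⁻¹).det)) =
      (Real.sqrt n ^ d)⁻¹ * Real.sqrt ((2 * Real.pi) ^ d * (H⁻¹).det) := by
    rw [mul_left_comm, Real.sqrt_mul (by positivity)]
    congr 1
    rw [Real.sqrt_eq_iff_mul_self_eq (by positivity) (by positivity), inv_pow, ← mul_inv,
      ← mul_pow, Real.mul_self_sqrt n.cast_nonneg]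
  rw [e1, mul_inv, inv_inv, mul_assoc]
  congr 4
  refine Finset.sum_congr rfl fun i _ => Finset.sum_congr rfl fun j _ => ?_
  have e2 : Real.sqrt n * Real.sqrt n = n := Real.mul_self_sqrt n.cast_nonneg
  simp only [Matrix.smul_apply, smul_eq_mul, PiLp.smul_apply]
  linear_combination (-(v i * H i j * v j)) * e2

/-- The dilation is used as a measurable equivalence, which spares any measurability of `g`. -/
lemma lintegral_comp_add_smul (g : Par d → ℝ≥0∞) (t : Par d) {u : ℝ} (hu : 0 < u) :
    ∫⁻ w, g (t + u • w) = ENNReal.ofReal (u ^ d)⁻¹ * ∫⁻ θ, g θ := by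
  have h1 := lintegral_map_equiv (μ := (volume : Measure (Par d))) (fun x => g (t + x))
    (Homeomorph.smulOfNeZero u hu.ne').toMeasurableEquiv
  have h2 : Measure.map (Homeomorph.smulOfNeZero u hu.ne').toMeasurableEquiv
      (volume : Measure (Par d)) = ENNReal.ofReal (u ^ d)⁻¹ • volume := by
    have := Measure.map_addHaar_smul (volume : Measure (Par d)) hu.ne'
    rwa [finrank_euclideanSpace_fin, abs_of_pos (by positivity)] at this
  rw [h2, lintegral_smul_measure, lintegral_add_left_eq_self, smul_eq_mul] at h1
  exact h1.symm

lemma lintegral_srPosterior_sub (hn : 0 < n) {H : Matrix (Fin d) (Fin d) ℝ} (hH : H.PosDef) :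
    ∫⁻ θ, ‖srPosterior Θ prior f C t θ - gaussDensity ((n : ℝ)⁻¹ • H⁻¹) (θ - t)‖ₑ =
      ∫⁻ w, ‖srPosteriorW n Θ prior f C t w - gaussDensity H⁻¹ w‖ₑ := by
  have hs : 0 < Real.sqrt n := Real.sqrt_pos.2 (by exact_mod_cast hn)
  have hu : 0 < (Real.sqrt n)⁻¹ := inv_pos.2 hs
  have hud : 0 < (Real.sqrt n)⁻¹ ^ d := by positivity
  have e (w : Par d) : ‖srPosteriorW n Θ prior f C t w - gaussDensity H⁻¹ w‖ₑ =
      ENNReal.ofReal ((Real.sqrt n)⁻¹ ^ d) * ‖srPosterior Θ prior f C t (t + (Real.sqrt n)⁻¹ • w) -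
        gaussDensity ((n : ℝ)⁻¹ • H⁻¹) (t + (Real.sqrt n)⁻¹ • w - t)‖ₑ := by
    rw [add_sub_cancel_left, gaussDensity_smul_inv hn H hH, smul_smul, mul_inv_cancel₀ hs.ne',
      one_smul, ← Real.enorm_of_nonneg hud.le, ← enorm_mul, mul_sub, ← mul_assoc, ← mul_pow,
      inv_mul_cancel₀ hs.ne', one_pow, one_mul, srPosteriorW]
  simp only [e]
  rw [lintegral_const_mul' _ _ ENNReal.ofReal_ne_top, lintegral_comp_add_smul (fun θ =>
    ‖srPosterior Θ prior f C t θ - gaussDensity ((n : ℝ)⁻¹ • H⁻¹) (θ - t)‖ₑ) t hu, ← mul_assoc,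
    ← ENNReal.ofReal_mul hud.le, mul_inv_cancel₀ hud.ne', ENNReal.ofReal_one, one_mul]

end Posterior

/-! ### Powers of the sample size and the deterministic expansion theorem. -/

lemma inv_sqrt_le_of_ceil_le {u : ℝ} (hu : 0 < u) {n : ℕ} (hn : ⌈(u ^ 2)⁻¹⌉₊ ≤ n) :
    (Real.sqrt n)⁻¹ ≤ u := by
  have h : (u ^ 2)⁻¹ ≤ n := (Nat.le_ceil _).trans (by exact_mod_cast hn)
  rw [inv_le_comm₀ (Real.sqrt_pos.2 (lt_of_lt_of_le (by positivity) h)) hu]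
  refine Real.le_sqrt_of_sq_le ?_
  rwa [inv_pow]

/-- Used with N = d: the Jacobian of the tail integral and the target rate together cost n^((d+3)/2)
≤ n^(d+2), which the exponential decay absorbs. -/
lemma sqrt_pow_mul_exp_le {N n : ℕ} {E K : ℝ} (hn : 0 < n) (hE : 0 ≤ E)
    (h : (n : ℝ) ^ (N + 2) * E ≤ K) : Real.sqrt n ^ N * E ≤ K * (Real.sqrt n)⁻¹ ^ 3 := by
  have hn1 : (1 : ℝ) ≤ n := by exact_mod_cast hn
  have hs1 : 1 ≤ Real.sqrt n := Real.one_le_sqrt.2 hn1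
  have hs0 : 0 < Real.sqrt n := by linarith
  have e : (n : ℝ) = Real.sqrt n ^ 2 := (Real.sq_sqrt n.cast_nonneg).symm
  rw [inv_pow, ← div_eq_mul_inv, le_div_iff₀ (by positivity)]
  refine le_trans ?_ h
  generalize Real.sqrt n = s at *
  rw [e]
  calc s ^ N * E * s ^ 3 = s ^ (N + 3) * E := by ring
    _ ≤ s ^ (2 * (N + 2)) * E := by
        refine mul_le_mul_of_nonneg_right (pow_le_pow_right₀ hs1 ?_) hE
        omega
    _ = _ := by rw [pow_mul]

lemma lintegral_enorm_le_of_abs_le {d : ℕ} {F g : Par d → ℝ} (hg : Integrable g)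
    (h : ∀ w, |F w| ≤ g w) : ∫⁻ w, ‖F w‖ₑ ≤ ENNReal.ofReal (∫ w, g w) := by
  rw [ofReal_integral_eq_lintegral_ofReal hg
    (ae_of_all _ fun w => (abs_nonneg _).trans (h w))]
  refine lintegral_mono fun w => ?_
  rw [← ofReal_norm]
  exact ENNReal.ofReal_le_ofReal (h w)

/-- The order of the quantifiers follows the separation condition: δ fixes the radius ν at which
separation is required, that radius determines ε, and η, K and N may depend on ε. -/
theorem exists_posterior_expansion {d : ℕ} {Θ : Set (Par d)} (hΘ : IsOpen Θ)
    {prior : Par d → ℝ} {r : ℝ} (hr : 0 ≤ r) (hprior : ∀ θ ∈ Θ, 0 ≤ prior θ)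
    (hint : IntegrableOn (fun θ => prior θ * (1 + ‖θ‖) ^ (-r)) Θ)
    (C : Matrix (Fin d) (Fin d) ℝ) {θ₀ : Par d} {ρ B c p₀ Λ : ℝ} (hρ : 0 < ρ) (hB : 1 ≤ B)
    (hc : 0 < c) (hp₀ : 0 < p₀) (hΛ : 1 ≤ Λ) (hC : ∀ w, ‖w‖ ≤ Λ * ‖mulVecL C w‖)
    (hball : Metric.ball θ₀ ρ ⊆ Θ) :
    ∃ δ ν : ℝ, 0 < δ ∧ 0 < ν ∧ ∀ ε : ℝ, 0 < ε → ∃ (η K : ℝ) (N : ℕ), 0 < η ∧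
      ∀ (n : ℕ) (f : Par d → ℝ) (t : Par d), N ≤ n →
        LocalRegularity n prior f C θ₀ t ρ B c p₀ → Measurable (Θ.indicator f) →
        (∀ θ ∈ Θ, ν ≤ ‖θ - θ₀‖ →
          n * ε * (1 + r * Real.log (1 + ‖θ‖)) ≤ f θ - f θ₀) →
        ‖t - θ₀‖ ≤ η →
        (Integrable (srKernel Θ prior f C t) ∧ 0 < ∫ θ, srKernel Θ prior f C t θ) ∧
        (∀ w, ‖w‖ ≤ δ * Real.sqrt n →
          |srPosteriorW n Θ prior f C t w - srExpansion n prior f C t w| ≤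
            K * (Real.sqrt n)⁻¹ ^ 3) ∧
        (∫⁻ w, ‖srPosteriorW n Θ prior f C t w - srExpansion n prior f C t w‖ₑ ≤
          ENNReal.ofReal (K * (Real.sqrt n)⁻¹ ^ 3)) ∧
        ∫⁻ θ, ‖srPosterior Θ prior f C t θ -
            gaussDensity ((n : ℝ)⁻¹ • (Hmat n f C t)⁻¹) (θ - t)‖ₑ ≤
          ENNReal.ofReal (K * (Real.sqrt n)⁻¹) := by
  obtain ⟨δ, K₁, hδ, hδρ, hK₁, hexp⟩ := exists_local_expansion C hρ hB hc hp₀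
  have hΛ0 : 0 < Λ := by linarith
  have hB0 : 0 < B := by linarith
  refine ⟨δ, δ / (2 * Λ), hδ, by positivity, fun ε hε => ?_⟩
  obtain ⟨K', hK', hpow⟩ := exists_pow_mul_exp_le 13 (half_pos hc)
  obtain ⟨K₃, hK₃, hdecay⟩ := exists_pow_mul_exp_nat_le (d + 2) hε
  obtain ⟨T, hT⟩ : ∃ T, T = ‖θ₀‖ + 1 := ⟨_, rfl⟩
  have hT0 : 0 ≤ T := hT ▸ by positivity
  obtain ⟨κ, hκ⟩ : ∃ κ, κ = (1 + T + Λ * T + Λ) ^ r / p₀ := ⟨_, rfl⟩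
  have hκ0 : 0 ≤ κ := hκ ▸ by positivity
  obtain ⟨I, hI⟩ : ∃ I, I = ∫ θ, priorWeight Θ prior r θ := ⟨_, rfl⟩
  have hI0 : 0 ≤ I := hI ▸ integral_nonneg (priorWeight_nonneg hprior)
  obtain ⟨E₁, hE₁⟩ : ∃ E, E = ∫ w : Par d, Real.exp (-(c / 8) * ‖w‖ ^ 2) := ⟨_, rfl⟩
  have hE₁0 : 0 ≤ E₁ := hE₁ ▸ integral_nonneg fun w => (Real.exp_pos _).le
  obtain ⟨E₂, hE₂⟩ : ∃ E, E = ∫ w : Par d, Real.exp (-(c / 4) * ‖w‖ ^ 2) := ⟨_, rfl⟩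
  have hE₂0 : 0 ≤ E₂ := hE₂ ▸ integral_nonneg fun w => (Real.exp_pos _).le
  obtain ⟨K₂, hK₂⟩ : ∃ K₂, K₂ = K₁ + (1 + 2 * K₁) * K' / δ ^ 3 := ⟨_, rfl⟩
  have hK₂0 : 0 ≤ K₂ := hK₂ ▸ by positivity
  obtain ⟨k, hk⟩ : ∃ k, k = K₁ + (K₂ * E₁ + κ * I * K₃) := ⟨_, rfl⟩
  have hkE : 0 ≤ K₂ * E₁ + κ * I * K₃ := by positivity
  have hk0 : 0 < k := hk ▸ by positivity
  obtain ⟨K₄, u₀, hK₄, hu₀, hnorm⟩ := exists_normalized_expansion d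
    (b := B * (1 + ‖mulVecL C‖) ^ 2) (c := c) (k := k)
    (mul_pos hB0 (pow_pos (by linarith [norm_nonneg (mulVecL C)]) 2)) hc hk0
  -- The bounds on η give ‖t‖ ≤ T, the distance needed in the tail estimate, and f(t) - f(θ₀) ≤
  -- nε/2. Those on n give n^(-1/2) ≤ u₀ and nε ≥ 1.
  refine ⟨min 1 (min (δ / (2 * Λ)) (ε / (4 * B))), K₄ * (K₁ + 1 + k + 2 * E₂),
    max 1 (max ⌈(u₀ ^ 2)⁻¹⌉₊ ⌈ε⁻¹⌉₊), by positivity, ?_⟩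
  intro n f t hN h hf hsep ht
  have hn0 : 0 < n := h.n_pos
  have hn : (0 : ℝ) < n := by exact_mod_cast hn0
  have hn1 : (1 : ℝ) ≤ n := by exact_mod_cast hn0
  have hu : (Real.sqrt n)⁻¹ ≤ u₀ := inv_sqrt_le_of_ceil_le hu₀
    ((le_max_left _ _).trans ((le_max_right _ _).trans hN))
  have hnε : 1 ≤ n * ε := by
    have h1 : ε⁻¹ ≤ n := (Nat.le_ceil _).trans
      (by exact_mod_cast (le_max_right _ _).trans ((le_max_right _ _).trans hN))
    rwa [inv_le_iff_one_le_mul₀ hε] at h1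
  have ht1 : ‖t - θ₀‖ ≤ 1 := ht.trans (min_le_left _ _)
  have ht2 : ‖t - θ₀‖ ≤ δ / (2 * Λ) := ht.trans ((min_le_right _ _).trans (min_le_left _ _))
  have ht3 : ‖t - θ₀‖ ≤ ε / (4 * B) := ht.trans ((min_le_right _ _).trans (min_le_right _ _))
  have htT : ‖t‖ ≤ T := by
    have := norm_add_le (t - θ₀) θ₀
    rw [sub_add_cancel] at this
    linarith
  have hft : f t - f θ₀ ≤ n * ε / 2 := by
    refine (h.score_sub_center_le hρ hB0 ht1).trans ?_
    rw [le_div_iff₀ (by positivity)] at ht3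
    have := mul_le_mul_of_nonneg_left ht3 hn.le
    linarith
  have hpt : 0 < prior t := hp₀.trans_le h.prior_pos
  obtain ⟨hcoef, hloc⟩ := hexp n prior f θ₀ t h
  have hloc' : ∀ w, ‖w‖ ≤ δ * Real.sqrt n →
      |relKernel n Θ prior f C t w - localExpansion n prior f C t w| ≤
        K₁ * (Real.sqrt n)⁻¹ ^ 3 * Real.exp (-(c / 8) * ‖w‖ ^ 2) := fun w hw => by
    rw [h.relKernel_eq hball hδ hδρ hw]
    exact hloc w hw
  have hbound := h.abs_relKernel_sub_le (Θ := Θ) (r := r) (τ := κ * Real.exp (-(n * ε / 2)))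
    hprior hp₀ hδ hK₁ hc hcoef hloc' (by positivity)
    (fun θ hθ => by
      rw [hκ]
      exact srKernel_tail_le hr hprior hΛ hC hsep ht2 htT hft hnε hp₀ h.prior_pos hθ) hpow hK'
  rw [← hK₂] at hbound
  obtain ⟨hdi, hdle⟩ := LocalRegularity.integral_abs_relKernel_sub_le hn0 hΘ hint hf hc hbound
  have hdle' : ∫ w, |relKernel n Θ prior f C t w - localExpansion n prior f C t w| ≤
      k * (Real.sqrt n)⁻¹ ^ 3 := by
    refine hdle.trans ?_
    rw [← hI, ← hE₁]
    have h1 := sqrt_pow_mul_exp_le hn0 (Real.exp_pos _).le (hdecay n)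
    have h2 := mul_le_mul_of_nonneg_left h1 (mul_nonneg hκ0 hI0)
    have h3 : 0 ≤ K₁ * (Real.sqrt n)⁻¹ ^ 3 := by positivity
    rw [hk]
    linarith
  have hH : (Hmat n f C t).PosDef := posDef_of_quadForm (h.isSymm hρ) hc h.curvature
  have hu2 : (n : ℝ)⁻¹ = (Real.sqrt n)⁻¹ ^ 2 := by rw [inv_pow, Real.sq_sqrt n.cast_nonneg]
  have hpg1 : PolyGrowth (A1 n prior f C t) := polyGrowth_linCubic _ _
  have hpg2 : PolyGrowth (A2 n prior f C t) := polyGrowth_centredSextic _ _ _ _ _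
  have h3 : ContDiffAt ℝ (3 : ℕ) f t := (h.contDiffAt hρ).of_le (by norm_num)
  have h4 : ContDiffAt ℝ (4 : ℕ) f t := (h.contDiffAt hρ).of_le (by norm_num)
  have hz1 : gaussInt (Hmat n f C t) (A1 n prior f C t) = 0 := gaussInt_linCubic
  have hz2 : gaussInt (Hmat n f C t) (A2 n prior f C t) = 0 :=
    gaussInt_centredSextic (h.isSymm hρ) hc h.curvature (calD3_swap_left h3)
      (calD3_swap_right h3) (calD4_swap_mid h4) (calD4_swap_right h4)
  have hle : K₁ ≤ k := by rw [hk]; linarith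
  -- The constant β of the normalization step is -A₂(0).
  have hloce : localExpansion n prior f C t = fun w => gaussWeight (Hmat n f C t) w *
      (1 + (Real.sqrt n)⁻¹ * A1 n prior f C t w +
        (Real.sqrt n)⁻¹ ^ 2 * (A2 n prior f C t w + -A2 n prior f C t 0)) := by
    funext w
    rw [localExpansion, hu2, sub_eq_add_neg]
  have hu0 : 0 < (Real.sqrt n)⁻¹ := inv_pos.2 (Real.sqrt_pos.2 hn)
  obtain ⟨hZi, hZ0, hmain, hfirst⟩ := hnorm (Hmat n f C t) (relKernel n Θ prior f C t)
    (A1 n prior f C t) (A2 n prior f C t) (-A2 n prior f C t 0) (Real.sqrt n)⁻¹ h.curvature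
    (h.quadForm_le hρ hB0.le) hpg1 hpg2 hz1 hz2
    (fun w => (hcoef w).1.trans (by gcongr))
    (fun w => by rw [← sub_eq_add_neg]; exact (hcoef w).2.trans (by gcongr))
    hu0 hu (by rw [hloce] at hdi; exact hdi) (by rw [hloce] at hdle'; exact hdle')
  have hD (w : Par d) : |srPosteriorW n Θ prior f C t w - srExpansion n prior f C t w| ≤
      K₄ * |relKernel n Θ prior f C t w - localExpansion n prior f C t w| +
        K₄ * (Real.sqrt n)⁻¹ ^ 3 * Real.exp (-(c / 4) * ‖w‖ ^ 2) := by
    rw [srPosteriorW_eq hn0 hpt.ne', srExpansion_eq hH, hloce]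
    exact hmain w
  have hG (w : Par d) : |srExpansion n prior f C t w - gaussDensity (Hmat n f C t)⁻¹ w| ≤
      K₄ * (Real.sqrt n)⁻¹ * Real.exp (-(c / 4) * ‖w‖ ^ 2) := by
    rw [srExpansion_eq hH, gaussDensity_inv hH]
    convert! hfirst w using 2
    ring
  have hu1 : (Real.sqrt n)⁻¹ ≤ 1 := inv_le_one_of_one_le₀ (Real.one_le_sqrt.2 hn1)
  have hu3 : (Real.sqrt n)⁻¹ ^ 3 ≤ (Real.sqrt n)⁻¹ :=
    pow_le_of_le_one hu0.le hu1 (by norm_num)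
  have hei : Integrable fun w : Par d => Real.exp (-(c / 4) * ‖w‖ ^ 2) :=
    integrable_exp_neg_mul_sq_norm (by positivity)
  have hi1 := hdi.abs.const_mul K₄
  have hi2 := hei.const_mul (K₄ * (Real.sqrt n)⁻¹ ^ 3)
  have hi3 := hei.const_mul (K₄ * (Real.sqrt n)⁻¹)
  have hI12 : ∫ w, (K₄ * |relKernel n Θ prior f C t w - localExpansion n prior f C t w| +
        K₄ * (Real.sqrt n)⁻¹ ^ 3 * Real.exp (-(c / 4) * ‖w‖ ^ 2)) ≤
      K₄ * (k * (Real.sqrt n)⁻¹ ^ 3) + K₄ * (Real.sqrt n)⁻¹ ^ 3 * E₂ := by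
    rw [integral_add hi1 hi2, integral_const_mul, integral_const_mul, ← hE₂]
    gcongr
  refine ⟨⟨(integrable_relKernel_iff hn0 hpt.ne').1 hZi, ?_⟩, fun w hw => ?_, ?_, ?_⟩
  · rw [integral_relKernel hn0, mul_div_assoc] at hZ0
    have h5 := pos_of_mul_pos_right hZ0 (by positivity)
    exact (div_pos_iff_of_pos_right (by positivity)).1 h5
  · refine (hD w).trans ?_
    have e8 : Real.exp (-(c / 8) * ‖w‖ ^ 2) ≤ 1 :=
      Real.exp_le_one_iff.2 (by rw [neg_mul]; exact neg_nonpos.2 (by positivity))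
    have e4 : Real.exp (-(c / 4) * ‖w‖ ^ 2) ≤ 1 :=
      Real.exp_le_one_iff.2 (by rw [neg_mul]; exact neg_nonpos.2 (by positivity))
    have q1 := (hloc' w hw).trans (mul_le_of_le_one_right (by positivity) e8)
    have q2 := mul_le_mul_of_nonneg_left q1 hK₄.le
    have q3 : K₄ * (Real.sqrt n)⁻¹ ^ 3 * Real.exp (-(c / 4) * ‖w‖ ^ 2) ≤
      K₄ * (Real.sqrt n)⁻¹ ^ 3 := mul_le_of_le_one_right (by positivity) e4
    have q4 : 0 ≤ K₄ * (k + 2 * E₂) * (Real.sqrt n)⁻¹ ^ 3 := by positivity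
    linarith
  · refine (lintegral_enorm_le_of_abs_le (hi1.add hi2) hD).trans
      (ENNReal.ofReal_le_ofReal (hI12.trans ?_))
    have q4 : 0 ≤ K₄ * (K₁ + 1 + E₂) * (Real.sqrt n)⁻¹ ^ 3 := by positivity
    linarith
  · rw [lintegral_srPosterior_sub hn0 hH]
    refine (lintegral_enorm_le_of_abs_le ((hi1.add hi2).add hi3) fun w => ?_).trans
      (ENNReal.ofReal_le_ofReal ?_)
    · exact (abs_sub_le _ (srExpansion n prior f C t w) _).trans (add_le_add (hD w) (hG w))
    · have hsum := integral_add (hi1.add hi2) hi3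
      rw [integral_const_mul (K₄ * (Real.sqrt n)⁻¹), ← hE₂] at hsum
      refine hsum.le.trans ((add_le_add_left hI12 _).trans ?_)
      have q1 : K₄ * (k + E₂) * (Real.sqrt n)⁻¹ ^ 3 ≤ K₄ * (k + E₂) * (Real.sqrt n)⁻¹ := by
        gcongr
      have q4 : 0 ≤ K₄ * (K₁ + 1) * (Real.sqrt n)⁻¹ := by positivity
      linarith

/-! ### Events of high probability -/

section Whp

variable {Ω : Type*} [MeasurableSpace Ω]

/-- The filter of the events that hold with probability tending to one. -/
def whpFilter (Pr : Measure Ω) : Filter (ℕ × Ω) where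
  sets := {A | Whp Pr fun n ω => (n, ω) ∈ A}
  univ_sets := by simp [Whp]
  sets_of_superset {A A'} h hAA' :=
    tendsto_of_tendsto_of_tendsto_of_le_of_le tendsto_const_nhds h (fun _ => zero_le)
      fun n => measure_mono fun ω hω hA => hω (hAA' hA)
  inter_sets {A A'} h h' := by
    have h0 := Tendsto.add h h'
    rw [add_zero] at h0
    refine tendsto_of_tendsto_of_tendsto_of_le_of_le tendsto_const_nhds h0 (fun _ => zero_le)
      fun n => (measure_mono fun ω hω => ?_).trans (measure_union_le _ _)
    exact not_and_or.1 hω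

variable {Pr : Measure Ω}

lemma eventually_whpFilter {A : ℕ → Ω → Prop} :
    (∀ᶠ q in whpFilter Pr, A q.1 q.2) ↔ Whp Pr A := Iff.rfl

/-- Lets limit theorems for filters be applied to convergence in probability. -/
lemma tendsto_whpFilter_iff {E : Type*} [PseudoMetricSpace E] {Y : ℕ → Ω → E} {L : E} :
    Tendsto (fun q => Y q.1 q.2) (whpFilter Pr) (𝓝 L) ↔
      TendstoInMeasure Pr Y atTop fun _ => L := by
  rw [Metric.tendsto_nhds, tendstoInMeasure_iff_dist]
  refine forall₂_congr fun ε _ =>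
    (eventually_whpFilter (A := fun n ω => dist (Y n ω) L < ε)).trans ?_
  rw [Whp]
  simp only [not_lt]

lemma tendsto_fst_whpFilter : Tendsto Prod.fst (whpFilter Pr) atTop := by
  refine tendsto_atTop.2 fun N => (eventually_whpFilter (A := fun n _ => N ≤ n)).2 ?_
  refine tendsto_const_nhds.congr' ?_
  filter_upwards [eventually_ge_atTop N] with n hn
  simp [hn]

/-- More than stochastic boundedness is available: one constant works for every ε. -/
lemma IsBigOp.of_eventually {Y : ℕ → Ω → ℝ≥0∞} {a : ℕ → ℝ} (K : ℝ)
    (h : ∀ᶠ q in whpFilter Pr, Y q.1 q.2 ≤ ENNReal.ofReal (K * a q.1)) : IsBigOp Pr Y a := by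
  intro ε hε
  refine ⟨K, ?_⟩
  have h' : Whp Pr fun n ω => Y n ω ≤ ENNReal.ofReal (K * a n) := h
  filter_upwards [h'.eventually (Iic_mem_nhds (ENNReal.ofReal_pos.2 hε))]
    with n hn
  simpa only [not_le] using hn

end Whp

/-! ### Averages of independent observations -/

/-- The average of `g` over the first `n` observations. -/
def sampleAverage {Ω 𝒳 : Type*} (X : ℕ → Ω → 𝒳) (g : 𝒳 → ℝ) (n : ℕ) (ω : Ω) : ℝ :=
  (n : ℝ)⁻¹ * ∑ i : Fin n, g (X i ω)

section Average

variable {Ω 𝒳 : Type*} [MeasurableSpace Ω] [MeasurableSpace 𝒳] {Pr : Measure Ω}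
  {Q : Measure 𝒳} {X : ℕ → Ω → 𝒳} {g : 𝒳 → ℝ}

/-- The strong law is applied to a measurable version of `g`; the two versions agree along almost
every sample path, as there are countably many observations with the same law. -/
lemma sampleAverage_tendsto_ae (hX : ∀ i, Measurable (X i)) (hindep : iIndepFun X Pr)
    (hlaw : ∀ i, Pr.map (X i) = Q) (hg : Integrable g Q) :
    ∀ᵐ ω ∂Pr, Tendsto (fun n => sampleAverage X g n ω) atTop (𝓝 (∫ x, g x ∂Q)) := by
  obtain ⟨g', hg', hgg'⟩ := hg.aestronglyMeasurable
  have hmp (i : ℕ) : MeasurePreserving (X i) Pr Q := ⟨hX i, hlaw i⟩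
  have hint : Integrable (fun ω => g' (X 0 ω)) Pr :=
    (hmp 0).integrable_comp_of_integrable (hg.congr hgg')
  have h := strong_law_ae_real (μ := Pr) (fun i ω => g' (X i ω)) hint
    (fun i j hij => (hindep.indepFun hij).comp hg'.measurable hg'.measurable)
    fun i => (IdentDistrib.mk (hX i).aemeasurable (hX 0).aemeasurable
      ((hlaw i).trans (hlaw 0).symm)).comp hg'.measurable
  have hlim : ∫ ω, g' (X 0 ω) ∂Pr = ∫ x, g x ∂Q := by
    rw [integral_congr_ae hgg', ← hlaw 0, integral_map (hX 0).aemeasurable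
      hg'.aestronglyMeasurable]
  have hae : ∀ᵐ ω ∂Pr, ∀ i, g (X i ω) = g' (X i ω) :=
    ae_all_iff.2 fun i => (hmp i).quasiMeasurePreserving.ae hgg'
  filter_upwards [h, hae] with ω h1 h2
  rw [hlim] at h1
  refine h1.congr fun n => ?_
  rw [sampleAverage, Finset.sum_range, div_eq_inv_mul]
  simp only [h2]

lemma aestronglyMeasurable_sampleAverage (hX : ∀ i, Measurable (X i))
    (hlaw : ∀ i, Pr.map (X i) = Q) (hg : AEStronglyMeasurable g Q) (n : ℕ) :
    AEStronglyMeasurable (sampleAverage X g n) Pr := by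
  unfold sampleAverage
  refine AEStronglyMeasurable.const_mul ?_ _
  refine Finset.aestronglyMeasurable_fun_sum _ fun i _ => ?_
  exact hg.comp_measurePreserving ⟨hX i, hlaw i⟩

lemma sampleAverage_tendstoInMeasure [IsProbabilityMeasure Pr] (hX : ∀ i, Measurable (X i)) (hindep : iIndepFun X Pr)
    (hlaw : ∀ i, Pr.map (X i) = Q) (hg : Integrable g Q) :
    TendstoInMeasure Pr (sampleAverage X g) atTop fun _ => ∫ x, g x ∂Q :=
  tendstoInMeasure_of_tendsto_ae
    (aestronglyMeasurable_sampleAverage hX hlaw hg.aestronglyMeasurable)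
    (sampleAverage_tendsto_ae hX hindep hlaw hg)

end Average

/-! ### Positive definite matrices -/

section Matrices

variable {d : ℕ} {G H K J C : Matrix (Fin d) (Fin d) ℝ}

lemma quadForm_smul (G : Matrix (Fin d) (Fin d) ℝ) (a : ℝ) (w : Par d) :
    quadForm G (a • w) = a ^ 2 * quadForm G w := by
  simp only [quadForm, Finset.mul_sum, PiLp.smul_apply, smul_eq_mul]
  refine Finset.sum_congr rfl fun i _ => Finset.sum_congr rfl fun j _ => by ring

lemma exists_quadForm_ge (hG : G.PosDef) :
    ∃ c : ℝ, 0 < c ∧ ∀ w, c * ‖w‖ ^ 2 ≤ quadForm G w := by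
  obtain ⟨c, hc, h⟩ := (isCompact_sphere (0 : Par d) 1).exists_forall_le' (a := 0)
    (continuous_quadForm G).continuousOn fun w hw => by
      rw [quadForm_eq_dotProduct]
      refine hG.dotProduct_mulVec_pos (x := w.ofLp) fun h0 => ?_
      have : w = 0 := PiLp.ext fun i => congrFun h0 i
      simp [this] at hw
  refine ⟨c, hc, fun w => ?_⟩
  by_cases hw : w = 0
  · simp [hw, quadForm]
  have hn : 0 < ‖w‖ := norm_pos_iff.2 hw
  have h1 := h (‖w‖⁻¹ • w) (by simp [norm_smul, hn.ne'])
  rw [quadForm_smul, inv_pow, le_inv_mul_iff₀ (by positivity)] at h1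
  linarith

lemma quadForm_ge_of_close {c γ : ℝ} (hG : ∀ w, 2 * c * ‖w‖ ^ 2 ≤ quadForm G w)
    (hGH : ∀ i j, |H i j - G i j| ≤ γ) (hγ : d ^ 2 * γ ≤ c) (w : Par d) :
    c * ‖w‖ ^ 2 ≤ quadForm H w := by
  have h1 : |quadForm H w - quadForm G w| ≤ d ^ 2 * γ * ‖w‖ ^ 2 := by
    have e : quadForm H w - quadForm G w = ∑ i, ∑ j, w i * (H i j - G i j) * w j := by
      simp only [quadForm, ← Finset.sum_sub_distrib]
      refine Finset.sum_congr rfl fun i _ => Finset.sum_congr rfl fun j _ => by ring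
    rw [e]
    calc |∑ i, ∑ j, w i * (H i j - G i j) * w j|
        ≤ ∑ _i : Fin d, ∑ _j : Fin d, γ * ‖w‖ ^ 2 := by
          refine (Finset.abs_sum_le_sum_abs _ _).trans (Finset.sum_le_sum fun i _ => ?_)
          refine (Finset.abs_sum_le_sum_abs _ _).trans (Finset.sum_le_sum fun j _ => ?_)
          rw [abs_mul, abs_mul]
          have hi : |w i| ≤ ‖w‖ := PiLp.norm_apply_le w i
          have hj : |w j| ≤ ‖w‖ := PiLp.norm_apply_le w j
          have hγ0 : 0 ≤ γ := (abs_nonneg _).trans (hGH i j)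
          calc |w i| * |H i j - G i j| * |w j| ≤ ‖w‖ * γ * ‖w‖ := by
                gcongr
                exact hGH i j
            _ = γ * ‖w‖ ^ 2 := by ring
      _ = d ^ 2 * γ * ‖w‖ ^ 2 := by
          simp only [Finset.sum_const, Finset.card_univ, Fintype.card_fin, nsmul_eq_mul]
          ring
  have h2 : d ^ 2 * γ * ‖w‖ ^ 2 ≤ c * ‖w‖ ^ 2 := by gcongr
  have h3 := hG w
  have h4 := (abs_le.1 h1).1
  linarith

lemma posDef_inv_mul_mul_inv_inv (hK : K.PosDef) (hJ : J.PosDef) :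
    ((K⁻¹ * J * K⁻¹)⁻¹).PosDef := by
  refine Matrix.PosDef.inv ?_
  have h : (K⁻¹)ᴴ = K⁻¹ := hK.inv.isHermitian
  have h2 := hJ.conjTranspose_mul_mul_same (B := K⁻¹)
    (Matrix.mulVec_injective_of_isUnit hK.inv.isUnit)
  rwa [h] at h2

/-- det C divides det G ≠ 0, so `C` is invertible. -/
lemma exists_norm_le_mul_norm_mulVecL (hG : G.PosDef) (hC : Cᵀ * K * C = G) :
    ∃ Λ : ℝ, 1 ≤ Λ ∧ ∀ w, ‖w‖ ≤ Λ * ‖mulVecL C w‖ := by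
  have hdet : IsUnit C.det := by
    refine isUnit_iff_ne_zero.2 fun h0 => hG.det_pos.ne' ?_
    rw [← hC, Matrix.det_mul, h0, mul_zero]
  refine ⟨max 1 ‖mulVecL C⁻¹‖, le_max_left _ _, fun w => ?_⟩
  have e : mulVecL C⁻¹ (mulVecL C w) = w := by
    simp only [mulVecL_apply, Matrix.mulVec_mulVec, Matrix.nonsing_inv_mul _ hdet,
      Matrix.one_mulVec]
  calc ‖w‖ = ‖mulVecL C⁻¹ (mulVecL C w)‖ := by rw [e]
    _ ≤ ‖mulVecL C⁻¹‖ * ‖mulVecL C w‖ := (mulVecL C⁻¹).le_opNorm _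
    _ ≤ _ := by gcongr; exact le_max_right _ _

end Matrices

/-! ### Bounds near the true value -/

section Local

variable {d : ℕ} {θ₀ : Par d}

lemma exists_prior_bounds {prior : Par d → ℝ} (h : ContDiffAt ℝ 3 prior θ₀)
    (hpos : 0 < prior θ₀) :
    ∃ ρ B : ℝ, 0 < ρ ∧ ContDiffOn ℝ 3 prior (Metric.ball θ₀ ρ) ∧
      (∀ z ∈ Metric.ball θ₀ ρ, prior θ₀ / 2 ≤ prior z ∧
        ‖iteratedFDeriv ℝ 1 prior z‖ ≤ B ∧ ‖iteratedFDeriv ℝ 2 prior z‖ ≤ B ∧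
        ‖iteratedFDeriv ℝ 3 prior z‖ ≤ B) := by
  have hk (k : ℕ) (hk : k ≤ 3) : ∀ᶠ z in 𝓝 θ₀,
      ‖iteratedFDeriv ℝ k prior z‖ ≤ ‖iteratedFDeriv ℝ k prior θ₀‖ + 1 :=
    ((h.continuousAt_iteratedFDeriv (by exact_mod_cast hk)).norm.eventually_lt_const
      (lt_add_one _)).mono fun _ hz => hz.le
  have h0 : ∀ᶠ z in 𝓝 θ₀, prior θ₀ / 2 ≤ prior z :=
    (h.continuousAt.eventually_const_lt (half_lt_self hpos)).mono fun _ hz => hz.le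
  have hev := (h.eventually (by simp)).and (h0.and ((hk 1 (by norm_num)).and
    ((hk 2 (by norm_num)).and (hk 3 le_rfl))))
  obtain ⟨ρ, hρ, hball⟩ := Metric.eventually_nhds_iff_ball.1 hev
  refine ⟨ρ, (‖iteratedFDeriv ℝ 1 prior θ₀‖ + 1) + (‖iteratedFDeriv ℝ 2 prior θ₀‖ + 1) +
    (‖iteratedFDeriv ℝ 3 prior θ₀‖ + 1), hρ, fun z hz => (hball z hz).1.contDiffWithinAt,
    fun z hz => ?_⟩
  obtain ⟨-, b0, b1, b2, b3⟩ := hball z hz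
  have n1 := norm_nonneg (iteratedFDeriv ℝ 1 prior θ₀)
  have n2 := norm_nonneg (iteratedFDeriv ℝ 2 prior θ₀)
  have n3 := norm_nonneg (iteratedFDeriv ℝ 3 prior θ₀)
  exact ⟨b0, by linarith, by linarith, by linarith⟩

lemma norm_iteratedFDeriv_le_of_pd {k : ℕ} {f : Par d → ℝ} {b : ℝ}
    (h : ∀ I : Fin k → Fin d, |pd f I θ₀| ≤ b) : ‖iteratedFDeriv ℝ k f θ₀‖ ≤ d ^ k * b := by
  refine (ContinuousMultilinearMap.norm_le_sum_coord _).trans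
    ((Finset.sum_le_sum fun I _ => h I).trans ?_)
  simp

lemma exists_score_bound {ρ b m : ℝ} (hρ : 0 < ρ) (hb : 0 ≤ b) (hm : 0 ≤ m) :
    ∃ B : ℝ, 1 ≤ B ∧ ∀ (n : ℕ) (f : Par d → ℝ), ContDiffOn ℝ 5 f (Metric.ball θ₀ ρ) →
      (∀ I : Fin 2 → Fin d, |pd f I θ₀| ≤ n * b) → (∀ I : Fin 3 → Fin d, |pd f I θ₀| ≤ n * b) →
      (∀ I : Fin 4 → Fin d, |pd f I θ₀| ≤ n * b) →
      (∀ z ∈ Metric.ball θ₀ ρ, ‖iteratedFDeriv ℝ 5 f z‖ ≤ n * m) →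
      ∀ z ∈ Metric.ball θ₀ ρ, ‖iteratedFDeriv ℝ 2 f z‖ ≤ n * B ∧
        ‖iteratedFDeriv ℝ 3 f z‖ ≤ n * B ∧ ‖iteratedFDeriv ℝ 4 f z‖ ≤ n * B ∧
        ‖iteratedFDeriv ℝ 5 f z‖ ≤ n * B := by
  -- Descent by the mean value inequality: the d^k partial derivatives at θ₀ bound the derivative
  -- there, and the next order times ρ bounds its variation.
  obtain ⟨B₄, hB₄⟩ : ∃ B, B = d ^ 4 * b + m * ρ := ⟨_, rfl⟩
  obtain ⟨B₃, hB₃⟩ : ∃ B, B = d ^ 3 * b + B₄ * ρ := ⟨_, rfl⟩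
  obtain ⟨B₂, hB₂⟩ : ∃ B, B = d ^ 2 * b + B₃ * ρ := ⟨_, rfl⟩
  have h4 : 0 ≤ B₄ := hB₄ ▸ by positivity
  have h3 : 0 ≤ B₃ := hB₃ ▸ by positivity
  have h2 : 0 ≤ B₂ := hB₂ ▸ by positivity
  refine ⟨1 + B₂ + B₃ + B₄ + m, by linarith, fun n f hf p2 p3 p4 p5 z hz => ?_⟩
  have hn : (0 : ℝ) ≤ n := n.cast_nonneg
  have hk (k : ℕ) (hk : k + 1 ≤ 5) : ContDiffOn ℝ (k + 1 : ℕ) f (Metric.ball θ₀ ρ) :=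
    hf.of_le (by exact_mod_cast hk)
  have b4 := norm_iteratedFDeriv_le_of_center hρ (hk 4 (by norm_num)) p5
    (norm_iteratedFDeriv_le_of_pd p4)
  have b4' : ∀ z ∈ Metric.ball θ₀ ρ, ‖iteratedFDeriv ℝ 4 f z‖ ≤ n * B₄ := fun z hz =>
    (b4 z hz).trans_eq (by rw [hB₄]; ring)
  have b3 := norm_iteratedFDeriv_le_of_center hρ (hk 3 (by norm_num)) b4'
    (norm_iteratedFDeriv_le_of_pd p3)
  have b3' : ∀ z ∈ Metric.ball θ₀ ρ, ‖iteratedFDeriv ℝ 3 f z‖ ≤ n * B₃ := fun z hz =>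
    (b3 z hz).trans_eq (by rw [hB₃]; ring)
  have b2 := norm_iteratedFDeriv_le_of_center hρ (hk 2 (by norm_num)) b3'
    (norm_iteratedFDeriv_le_of_pd p2)
  have b2' : ‖iteratedFDeriv ℝ 2 f z‖ ≤ n * B₂ := (b2 z hz).trans_eq (by rw [hB₂]; ring)
  exact ⟨b2'.trans (by gcongr; linarith), (b3' z hz).trans (by gcongr; linarith),
    (b4' z hz).trans (by gcongr; linarith), (p5 z hz).trans (by gcongr; linarith)⟩

lemma abs_Hmat_sub_le {n : ℕ} {f : Par d → ℝ} {C : Matrix (Fin d) (Fin d) ℝ} {t : Par d}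
    {ρ B : ℝ} (hn : 0 < n) (hρ : 0 < ρ) (hf : ContDiffOn ℝ 5 f (Metric.ball θ₀ ρ))
    (hB : ∀ z ∈ Metric.ball θ₀ ρ, ‖iteratedFDeriv ℝ 3 f z‖ ≤ n * B)
    (ht : t ∈ Metric.ball θ₀ ρ) (i j : Fin d) :
    |Hmat n f C t i j - Hmat n f C θ₀ i j| ≤ B * ‖mulVecL C‖ ^ 2 * ‖t - θ₀‖ := by
  have hn0 : (0 : ℝ) < n := by exact_mod_cast hn
  have h := norm_iteratedFDeriv_sub_le (k := 2) (hf.of_le (by exact_mod_cast (by norm_num)))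
    (Metric.mem_ball_self hρ) ht hB
  rw [Hmat_eq, Hmat_eq, ← mul_sub, abs_mul, abs_of_pos (inv_pos.2 hn0), inv_mul_le_iff₀ hn0]
  have hop := ContinuousMultilinearMap.le_opNorm
    (iteratedFDeriv ℝ 2 f t - iteratedFDeriv ℝ 2 f θ₀)
    fun m => mulVecL C (EuclideanSpace.single (![i, j] m) 1)
  refine hop.trans ?_
  have hs (k : Fin d) : ‖mulVecL C (EuclideanSpace.single k 1)‖ ≤ ‖mulVecL C‖ := by
    simpa using (mulVecL C).le_opNorm (EuclideanSpace.single k 1)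
  have hprod : ∏ m, ‖mulVecL C (EuclideanSpace.single (![i, j] m) 1)‖ ≤ ‖mulVecL C‖ ^ 2 := by
    refine (Finset.prod_le_prod (fun _ _ => norm_nonneg _) fun m _ => hs _).trans_eq ?_
    simp
  calc _ ≤ n * B * ‖t - θ₀‖ * ‖mulVecL C‖ ^ 2 :=
        mul_le_mul h hprod (Finset.prod_nonneg fun _ _ => norm_nonneg _)
          ((norm_nonneg _).trans h)
    _ = _ := by ring

end Local

/-! ### The empirical score -/

section TotalScore

variable {Ω 𝒳 : Type*} {d : ℕ} {S : 𝒳 → (𝒳 → ℝ) → ℝ} {p : Par d → 𝒳 → ℝ} {θ₀ : Par d}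
  {ρ : ℝ} {X : ℕ → Ω → 𝒳}

lemma nat_mul_sampleAverage (X : ℕ → Ω → 𝒳) (g : 𝒳 → ℝ) (n : ℕ) (ω : Ω) :
    n * sampleAverage X g n ω = ∑ i : Fin n, g (X i ω) := by
  rcases Nat.eq_zero_or_pos n with rfl | hn
  · simp
  · rw [sampleAverage, mul_inv_cancel_left₀ (by exact_mod_cast hn.ne')]

lemma measurable_indicator_totalScore {Θ : Set (Par d)}
    (h : ∀ x, Measurable (Θ.indicator fun θ => S x (p θ))) {n : ℕ} (x : Fin n → 𝒳) :
    Measurable (Θ.indicator (totalScore S p x)) := by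
  have e : Θ.indicator (totalScore S p x) =
      fun θ => ∑ i, Θ.indicator (fun θ => S (x i) (p θ)) θ := by
    funext θ
    by_cases hθ : θ ∈ Θ <;> simp [hθ, totalScore]
  rw [e]
  exact Finset.measurable_fun_sum _ fun i _ => h (x i)

variable (hs : ∀ x, ContDiffOn ℝ 5 (fun θ => S x (p θ)) (Metric.ball θ₀ ρ))

include hs

lemma contDiffOn_totalScore {n : ℕ} (x : Fin n → 𝒳) :
    ContDiffOn ℝ 5 (totalScore S p x) (Metric.ball θ₀ ρ) :=
  ContDiffOn.sum fun i _ => hs (x i)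

lemma iteratedFDeriv_totalScore {k : ℕ} (hk : k ≤ 5) {n : ℕ} (x : Fin n → 𝒳) {z : Par d}
    (hz : z ∈ Metric.ball θ₀ ρ) : iteratedFDeriv ℝ k (totalScore S p x) z =
      ∑ i, iteratedFDeriv ℝ k (fun θ => S (x i) (p θ)) z :=
  iteratedFDeriv_fun_sum_apply fun i _ =>
    ((hs (x i)).contDiffAt (Metric.isOpen_ball.mem_nhds hz)).of_le (by exact_mod_cast hk)

lemma pd_totalScore (hρ : 0 < ρ) {k : ℕ} (hk : k ≤ 5) (I : Fin k → Fin d) (n : ℕ) (ω : Ω) :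
    pd (totalScore S p fun i : Fin n => X i ω) I θ₀ =
      n * sampleAverage X (fun x => pd (fun η => S x (p η)) I θ₀) n ω := by
  rw [pd, iteratedFDeriv_totalScore hs hk _ (Metric.mem_ball_self hρ),
    sum_apply, nat_mul_sampleAverage]
  rfl

variable {ι : Type*} {F : Filter ι} {N : ι → ℕ} {W : ι → Ω}

/-- The filter `F` is left arbitrary, to cover both events of probability tending to one and a
single sample point with n → ∞. -/
lemma exists_eventually_pd_le (hρ : 0 < ρ) {k : ℕ} (hk : k ≤ 5) {L : (Fin k → Fin d) → ℝ}
    (hlim : ∀ I : Fin k → Fin d, Tendsto (fun q => sampleAverage X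
      (fun x => pd (fun η => S x (p η)) I θ₀) (N q) (W q)) F (𝓝 (L I))) :
    ∃ b : ℝ, 0 ≤ b ∧ ∀ᶠ q in F, ∀ I : Fin k → Fin d,
      |pd (totalScore S p fun i : Fin (N q) => X i (W q)) I θ₀| ≤ N q * b := by
  refine ⟨∑ I, (|L I| + 1), by positivity, eventually_all.2 fun I => ?_⟩
  filter_upwards [(hlim I).abs.eventually_lt_const (lt_add_one _)] with q hq
  rw [pd_totalScore hs hρ hk, abs_mul, Nat.abs_cast]
  refine mul_le_mul_of_nonneg_left (hq.le.trans ?_) (Nat.cast_nonneg _)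
  exact Finset.single_le_sum (f := fun I => |L I| + 1) (fun _ _ => by positivity)
    (Finset.mem_univ I)

lemma exists_eventually_score_bound (hρ : 0 < ρ) {M : 𝒳 → ℝ}
    (hM : ∀ x, ∀ θ ∈ Metric.ball θ₀ ρ, ‖iteratedFDeriv ℝ 5 (fun η => S x (p η)) θ‖ ≤ M x)
    {L₂ : (Fin 2 → Fin d) → ℝ} {L₃ : (Fin 3 → Fin d) → ℝ} {L₄ : (Fin 4 → Fin d) → ℝ} {L : ℝ}
    (h₂ : ∀ I, Tendsto (fun q => sampleAverage X
      (fun x => pd (fun η => S x (p η)) I θ₀) (N q) (W q)) F (𝓝 (L₂ I)))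
    (h₃ : ∀ I, Tendsto (fun q => sampleAverage X
      (fun x => pd (fun η => S x (p η)) I θ₀) (N q) (W q)) F (𝓝 (L₃ I)))
    (h₄ : ∀ I, Tendsto (fun q => sampleAverage X
      (fun x => pd (fun η => S x (p η)) I θ₀) (N q) (W q)) F (𝓝 (L₄ I)))
    (h₅ : Tendsto (fun q => sampleAverage X M (N q) (W q)) F (𝓝 L)) :
    ∃ B : ℝ, 1 ≤ B ∧ ∀ᶠ q in F, ∀ z ∈ Metric.ball θ₀ ρ,
      ‖iteratedFDeriv ℝ 2 (totalScore S p fun i : Fin (N q) => X i (W q)) z‖ ≤ N q * B ∧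
      ‖iteratedFDeriv ℝ 3 (totalScore S p fun i : Fin (N q) => X i (W q)) z‖ ≤ N q * B ∧
      ‖iteratedFDeriv ℝ 4 (totalScore S p fun i : Fin (N q) => X i (W q)) z‖ ≤ N q * B ∧
      ‖iteratedFDeriv ℝ 5 (totalScore S p fun i : Fin (N q) => X i (W q)) z‖ ≤ N q * B := by
  obtain ⟨b₂, hb₂, e₂⟩ := exists_eventually_pd_le hs hρ (by norm_num) h₂
  obtain ⟨b₃, hb₃, e₃⟩ := exists_eventually_pd_le hs hρ (by norm_num) h₃
  obtain ⟨b₄, hb₄, e₄⟩ := exists_eventually_pd_le hs hρ (by norm_num) h₄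
  obtain ⟨B, hB, h⟩ := exists_score_bound (θ₀ := θ₀) hρ (b := b₂ + b₃ + b₄) (m := |L| + 1)
    (by positivity) (by positivity)
  refine ⟨B, hB, ?_⟩
  filter_upwards [e₂, e₃, e₄, h₅.abs.eventually_lt_const (lt_add_one _)] with q q₂ q₃ q₄ q₅
  have hn : (0 : ℝ) ≤ N q := Nat.cast_nonneg _
  refine h (N q) _ (contDiffOn_totalScore hs _)
    (fun I => (q₂ I).trans (by gcongr; linarith)) (fun I => (q₃ I).trans (by gcongr; linarith))
    (fun I => (q₄ I).trans (by gcongr; linarith)) fun z hz => ?_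
  rw [iteratedFDeriv_totalScore hs le_rfl _ hz]
  calc ‖∑ i : Fin (N q), iteratedFDeriv ℝ 5 (fun θ => S (X i (W q)) (p θ)) z‖
      ≤ ∑ i : Fin (N q), M (X i (W q)) := norm_sum_le_of_le _ fun i _ => hM _ z hz
    _ = N q * sampleAverage X M (N q) (W q) := (nat_mul_sampleAverage ..).symm
    _ ≤ N q * (|L| + 1) := by gcongr; exact (le_abs_self _).trans q₅.le

/-- At θ₀ this is convergence of averages; moving to the estimator costs at most a constant times ‖t
- θ₀‖, by the third-derivative bound. -/
lemma tendsto_Hmat_totalScore (hρ : 0 < ρ) (C : Matrix (Fin d) (Fin d) ℝ)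
    (hN : ∀ᶠ q in F, 0 < N q) {L₂ : Matrix (Fin d) (Fin d) ℝ}
    (h₂ : ∀ i j, Tendsto (fun q => sampleAverage X
      (fun x => pd (fun η => S x (p η)) ![i, j] θ₀) (N q) (W q)) F (𝓝 (L₂ i j)))
    {B : ℝ} (h₃ : ∀ᶠ q in F, ∀ z ∈ Metric.ball θ₀ ρ,
      ‖iteratedFDeriv ℝ 3 (totalScore S p fun i : Fin (N q) => X i (W q)) z‖ ≤ N q * B)
    {t : ι → Par d} (ht : Tendsto t F (𝓝 θ₀)) (i j : Fin d) :
    Tendsto (fun q => Hmat (N q) (totalScore S p fun i : Fin (N q) => X i (W q)) C (t q) i j) F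
      (𝓝 ((Cᵀ * L₂ * C) i j)) := by
  have h0 : Tendsto (fun q => Hmat (N q) (totalScore S p fun i : Fin (N q) => X i (W q)) C θ₀ i j)
      F (𝓝 ((Cᵀ * L₂ * C) i j)) := by
    have h1 : Tendsto (fun q => ∑ b, (∑ a, Cᵀ i a * sampleAverage X
        (fun x => pd (fun η => S x (p η)) ![a, b] θ₀) (N q) (W q)) * C b j) F
        (𝓝 ((Cᵀ * L₂ * C) i j)) := by
      simp only [Matrix.mul_apply]
      exact tendsto_finsetSum _ fun b _ =>
        (tendsto_finsetSum _ fun a _ => (h₂ a b).const_mul _).mul_const _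
    refine h1.congr' ?_
    filter_upwards [hN] with q hq
    have hq0 : (N q : ℝ) ≠ 0 := by exact_mod_cast hq.ne'
    rw [Hmat, Matrix.smul_apply, Matrix.mul_apply, smul_eq_mul, Finset.mul_sum]
    refine Finset.sum_congr rfl fun b _ => ?_
    rw [Matrix.mul_apply, ← mul_assoc, Finset.mul_sum]
    congr 1
    refine Finset.sum_congr rfl fun a _ => ?_
    rw [hessMat, Matrix.of_apply, pd_totalScore hs hρ (by norm_num)]
    field_simp
  have hd : Tendsto (fun q => B * ‖mulVecL C‖ ^ 2 * ‖t q - θ₀‖) F (𝓝 0) := by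
    have := (tendsto_iff_norm_sub_tendsto_zero.1 ht).const_mul (B * ‖mulVecL C‖ ^ 2)
    rwa [mul_zero] at this
  have hsub : Tendsto (fun q =>
      Hmat (N q) (totalScore S p fun i : Fin (N q) => X i (W q)) C (t q) i j -
        Hmat (N q) (totalScore S p fun i : Fin (N q) => X i (W q)) C θ₀ i j) F (𝓝 0) := by
    refine squeeze_zero_norm' ?_ hd
    filter_upwards [hN, h₃, ht.eventually (Metric.ball_mem_nhds θ₀ hρ)] with q q1 q2 q3
    exact abs_Hmat_sub_le q1 hρ (contDiffOn_totalScore hs _) q2 q3 i j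
  simpa using hsub.add h0

end TotalScore

lemma inv_sqrt_pow_three_eq_rpow (n : ℕ) :
    (Real.sqrt n)⁻¹ ^ 3 = (n : ℝ) ^ (-(3 : ℝ) / 2) := by
  rw [Real.sqrt_eq_rpow, ← Real.rpow_neg n.cast_nonneg, ← Real.rpow_natCast,
    ← Real.rpow_mul n.cast_nonneg]
  norm_num

lemma inv_sqrt_eq_rpow (n : ℕ) : (Real.sqrt n)⁻¹ = (n : ℝ) ^ (-(1 : ℝ) / 2) := by
  rw [Real.sqrt_eq_rpow, ← Real.rpow_neg n.cast_nonneg]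
  norm_num

end

/-- `X 0, X 1, …` are i.i.d. with density `p θ₀`; for each `n` the estimator `est n` is evaluated
at the sample `x n ω = (X 0 ω, …, X (n-1) ω)`, and `Sx n ω` is the total empirical score of that
sample. -/
theorem theorem3p1 {Ω 𝒳 : Type*} [MeasurableSpace Ω] [MeasurableSpace 𝒳] {d : ℕ}
    (Pr : Measure Ω) [IsProbabilityMeasure Pr]
    (μ : Measure 𝒳) (Θ : Set (Par d)) (hΘ : IsOpen Θ)
    -- the parametric model and a proper scoring rule
    (p : Par d → 𝒳 → ℝ) (hp : ∀ θ ∈ Θ, IsProbDensity μ (p θ))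
    (S : 𝒳 → (𝒳 → ℝ) → ℝ) (hS : IsProperScore μ S (p '' Θ))
    (hSmeas : ∀ x, Measurable (Θ.indicator fun θ => S x (p θ)))
    -- a random sample from the model at the true value
    (θ₀ : Par d) (hθ₀ : θ₀ ∈ Θ)
    (X : ℕ → Ω → 𝒳) (hX : ∀ i, Measurable (X i)) (hindep : iIndepFun X Pr)
    (hlaw : ∀ i, Pr.map (X i) = distOf μ (p θ₀))
    -- regularity of the score and of the prior
    (hreg : SmoothScore μ S p Θ θ₀)
    (prior : Par d → ℝ) (r : ℝ) (hprior : SmoothPrior Θ prior r θ₀)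
    (hsep : SeparatedScore Pr X S p Θ r θ₀)
    -- the scoring rule estimator: a consistent solution of the estimating equation
    (est : (n : ℕ) → (Fin n → 𝒳) → Par d)
    (hroot : Whp Pr fun n ω => ∀ j : Fin d,
      pd (totalScore S p fun i : Fin n => X i ω) ![j] (est n fun i => X i ω) = 0)
    (hcons : TendstoInMeasure Pr (fun n ω => est n fun i => X i ω) atTop fun _ => θ₀)
    -- the calibration matrix
    (C : Matrix (Fin d) (Fin d) ℝ)
    (hC : Cᵀ * sensitivity μ S p θ₀ * C = godambe μ S p θ₀) :
    let Sx : ℕ → Ω → Par d → ℝ := fun n ω => totalScore S p fun i : Fin n => X i ω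
    let t : ℕ → Ω → Par d := fun n ω => est n fun i => X i ω
    let H : ℕ → Ω → Matrix (Fin d) (Fin d) ℝ := fun n ω => Hmat n (Sx n ω) C (t n ω)
    -- the posterior is proper and the approximating normal law is nondegenerate
    (Whp Pr fun n ω => Integrable (srKernel Θ prior (Sx n ω) C (t n ω)) ∧
      0 < ∫ θ, srKernel Θ prior (Sx n ω) C (t n ω) θ) ∧
    (Whp Pr fun n ω => (H n ω).PosDef) ∧
    -- the expansion, uniformly over `‖w‖ ≤ δ √n`
    (∃ δ : ℝ, 0 < δ ∧ IsBigOp Pr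
      (fun n ω => ⨆ w ∈ Metric.closedBall (0 : Par d) (δ * Real.sqrt n),
        ‖srPosteriorW n Θ prior (Sx n ω) C (t n ω) w
          - srExpansion n prior (Sx n ω) C (t n ω) w‖ₑ)
      fun n => (n : ℝ) ^ (-(3 : ℝ) / 2)) ∧
    -- the expansion in `L¹`
    IsBigOp Pr
      (fun n ω => ∫⁻ w, ‖srPosteriorW n Θ prior (Sx n ω) C (t n ω) w
        - srExpansion n prior (Sx n ω) C (t n ω) w‖ₑ)
      (fun n => (n : ℝ) ^ (-(3 : ℝ) / 2)) ∧
    -- asymptotic normality with mean `t` and variance `H⁻¹ / n`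
    IsBigOp Pr
      (fun n ω => ∫⁻ θ, ‖srPosterior Θ prior (Sx n ω) C (t n ω) θ
        - gaussDensity ((n : ℝ)⁻¹ • (H n ω)⁻¹) (θ - t n ω)‖ₑ)
      (fun n => (n : ℝ) ^ (-(1 : ℝ) / 2)) ∧
    -- Godambe curvature
    (∀ i j, TendstoInMeasure Pr (fun n ω => H n ω i j) atTop fun _ => godambe μ S p θ₀ i j) ∧
    ((∀ᵐ ω ∂Pr, Tendsto (fun n => t n ω) atTop (𝓝 θ₀)) →
      ∀ᵐ ω ∂Pr, Tendsto (fun n => H n ω) atTop (𝓝 (godambe μ S p θ₀))) := by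
  intro Sx t H
  obtain ⟨ρ₀, hρ₀, hball₀, hs₀, M, hMi, hM₀⟩ := hreg.smooth_dominated
  obtain ⟨ρ₁, B₁, hρ₁, hpsm, hpb⟩ := exists_prior_bounds hprior.smooth hprior.pos
  obtain ⟨ρ, hρdef⟩ : ∃ ρ, ρ = min ρ₀ ρ₁ := ⟨_, rfl⟩
  have hρ : 0 < ρ := hρdef ▸ lt_min hρ₀ hρ₁
  have hsub₀ : Metric.ball θ₀ ρ ⊆ Metric.ball θ₀ ρ₀ :=
    Metric.ball_subset_ball (hρdef ▸ min_le_left _ _)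
  have hsub₁ : Metric.ball θ₀ ρ ⊆ Metric.ball θ₀ ρ₁ :=
    Metric.ball_subset_ball (hρdef ▸ min_le_right _ _)
  have hs : ∀ x, ContDiffOn ℝ 5 (fun θ => S x (p θ)) (Metric.ball θ₀ ρ) :=
    fun x => (hs₀ x).mono hsub₀
  have hM : ∀ x, ∀ θ ∈ Metric.ball θ₀ ρ,
      ‖iteratedFDeriv ℝ 5 (fun η => S x (p η)) θ‖ ≤ M x := fun x θ hθ => hM₀ x θ (hsub₀ hθ)
  have hG : (godambe μ S p θ₀).PosDef :=
    posDef_inv_mul_mul_inv_inv hreg.posDef_sensitivity hreg.posDef_variability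
  obtain ⟨c', hc', hGc'⟩ := exists_quadForm_ge hG
  -- Half of the curvature of G is reserved for the deviation of H from its limit.
  obtain ⟨c, hc, hGc⟩ : ∃ c : ℝ, 0 < c ∧ ∀ w, 2 * c * ‖w‖ ^ 2 ≤ quadForm (godambe μ S p θ₀) w :=
    ⟨c' / 2, half_pos hc', fun w => by rw [mul_div_cancel₀ c' two_ne_zero]; exact hGc' w⟩
  obtain ⟨Λ, hΛ, hCΛ⟩ := exists_norm_le_mul_norm_mulVecL hG hC
  have hlln {g : 𝒳 → ℝ} (hg : Integrable g (distOf μ (p θ₀))) :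
      Tendsto (fun q : ℕ × Ω => sampleAverage X g q.1 q.2) (whpFilter Pr)
        (𝓝 (∫ x, g x ∂distOf μ (p θ₀))) :=
    tendsto_whpFilter_iff.2 (sampleAverage_tendstoInMeasure hX hindep hlaw hg)
  have htF : Tendsto (fun q : ℕ × Ω => t q.1 q.2) (whpFilter Pr) (𝓝 θ₀) :=
    tendsto_whpFilter_iff.2 hcons
  have hNF : ∀ᶠ q in whpFilter Pr, 0 < q.1 :=
    tendsto_fst_whpFilter.eventually (eventually_gt_atTop 0)
  obtain ⟨B₂, hB₂, hsb⟩ := exists_eventually_score_bound (N := Prod.fst) (W := Prod.snd) hs hρ hM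
    (fun I => hlln (hreg.integrable_second I)) (fun I => hlln (hreg.integrable_third I))
    (fun I => hlln (hreg.integrable_fourth I)) (hlln hMi)
  have hHF (i j : Fin d) : Tendsto (fun q : ℕ × Ω => H q.1 q.2 i j) (whpFilter Pr)
      (𝓝 (godambe μ S p θ₀ i j)) := by
    rw [← hC]
    exact tendsto_Hmat_totalScore hs hρ C hNF
      (fun i j => hlln (hreg.integrable_second ![i, j])) (hsb.mono fun q h z hz => (h z hz).2.1)
      htF i j
  obtain ⟨B, hBdef⟩ : ∃ B, B = max B₁ B₂ := ⟨_, rfl⟩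
  have hBB₁ : B₁ ≤ B := hBdef ▸ le_max_left _ _
  have hBB₂ : B₂ ≤ B := hBdef ▸ le_max_right _ _
  have hreg_event : ∀ᶠ q in whpFilter Pr,
      LocalRegularity q.1 prior (Sx q.1 q.2) C θ₀ (t q.1 q.2) ρ B c (prior θ₀ / 2) := by
    -- The tolerance makes the total deviation of the d² entries at most c; the added 1 covers d =
    -- 0.
    have hclose : ∀ᶠ q in whpFilter Pr, ∀ i j,
        |H q.1 q.2 i j - godambe μ S p θ₀ i j| < c / (d ^ 2 + 1) :=
      eventually_all.2 fun i => eventually_all.2 fun j =>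
        (hHF i j).eventually (Metric.ball_mem_nhds _ (by positivity))
    filter_upwards [hNF, hsb, htF.eventually (Metric.ball_mem_nhds θ₀ (half_pos hρ)), hclose,
      eventually_whpFilter.2 hroot] with q q₁ q₂ q₃ q₄ q₅
    have hq : (0 : ℝ) ≤ q.1 := Nat.cast_nonneg _
    have hBn : (q.1 : ℝ) * B₂ ≤ q.1 * B := mul_le_mul_of_nonneg_left hBB₂ hq
    have hnear : ‖t q.1 q.2 - θ₀‖ < ρ / 2 := by rwa [← dist_eq_norm]
    have hmem : t q.1 q.2 ∈ Metric.ball θ₀ ρ₁ :=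
      hsub₁ (by rw [mem_ball_iff_norm]; linarith)
    exact
      { n_pos := q₁
        smooth := contDiffOn_totalScore hs _
        bound_two := fun z hz => (q₂ z hz).1.trans hBn
        bound_three := fun z hz => (q₂ z hz).2.1.trans hBn
        bound_four := fun z hz => (q₂ z hz).2.2.1.trans hBn
        bound_five := fun z hz => (q₂ z hz).2.2.2.trans hBn
        near := hnear
        critical := fun v => by
          rw [ContinuousMultilinearMap.sum_coord_one]
          exact Finset.sum_eq_zero fun i _ => mul_eq_zero_of_right _ (q₅ i)
        curvature := quadForm_ge_of_close hGc (fun i j => (q₄ i j).le) (by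
          rw [← mul_div_assoc, div_le_iff₀ (by positivity), mul_comm]
          gcongr
          exact le_add_of_nonneg_right zero_le_one)
        prior_smooth := hpsm.mono hsub₁
        prior_one := fun z hz => (hpb z (hsub₁ hz)).2.1.trans hBB₁
        prior_two := fun z hz => (hpb z (hsub₁ hz)).2.2.1.trans hBB₁
        prior_three := fun z hz => (hpb z (hsub₁ hz)).2.2.2.trans hBB₁
        prior_pos := (hpb _ hmem).1 }
  obtain ⟨δ, ν, hδ, hν, hexp⟩ := exists_posterior_expansion hΘ hprior.exponent_nonneg
    hprior.nonneg hprior.integrable C hρ (hB₂.trans hBB₂) hc (half_pos hprior.pos) hΛ hCΛ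
    (hsub₀.trans hball₀)
  -- Separation is used at this single radius only.
  obtain ⟨ε, hε, hsepε⟩ := hsep ν hν
  obtain ⟨η, K, N, hη, hmain⟩ := hexp ε hε
  have hgood := ((hreg_event.and (tendsto_fst_whpFilter.eventually (eventually_ge_atTop N))).and
    ((eventually_whpFilter.2 hsepε).and
      (htF.eventually (Metric.closedBall_mem_nhds θ₀ hη)))).mono fun q h =>
    hmain q.1 (Sx q.1 q.2) (t q.1 q.2) h.1.2 h.1.1 (measurable_indicator_totalScore hSmeas _)
      h.2.1 ((dist_eq_norm _ _).symm.trans_le h.2.2)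
  refine ⟨eventually_whpFilter.1 (hgood.mono fun q h => h.1),
    eventually_whpFilter.1 (hreg_event.mono fun q h =>
      posDef_of_quadForm (h.isSymm hρ) hc h.curvature),
    ⟨δ, hδ, IsBigOp.of_eventually K (hgood.mono fun q h => iSup₂_le fun w hw => ?_)⟩,
    IsBigOp.of_eventually K (hgood.mono fun q h => ?_),
    IsBigOp.of_eventually K (hgood.mono fun q h => ?_),
    fun i j => tendsto_whpFilter_iff.1 (hHF i j), fun hae => ?_⟩
  · rw [← inv_sqrt_pow_three_eq_rpow, ← ofReal_norm]
    exact ENNReal.ofReal_le_ofReal (h.2.1 w (by rwa [mem_closedBall_zero_iff] at hw))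
  · rw [← inv_sqrt_pow_three_eq_rpow]
    exact h.2.2.1
  · rw [← inv_sqrt_eq_rpow]
    exact h.2.2.2
  -- Almost surely all the averages converge along the sample path, so the argument for H is
  -- repeated with `ω` frozen and the filter `atTop`.
  · have hlae {g : 𝒳 → ℝ} (hg : Integrable g (distOf μ (p θ₀))) :=
      sampleAverage_tendsto_ae hX hindep hlaw hg
    filter_upwards [hae, ae_all_iff.2 fun I => hlae (hreg.integrable_second I),
      ae_all_iff.2 fun I => hlae (hreg.integrable_third I),
      ae_all_iff.2 fun I => hlae (hreg.integrable_fourth I), hlae hMi] with ω h₁ h₂ h₃ h₄ h₅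
    obtain ⟨B', -, hB'⟩ := exists_eventually_score_bound (F := atTop) (N := id)
      (W := fun _ => ω) hs hρ hM h₂ h₃ h₄ h₅
    refine tendsto_pi_nhds.2 fun i => tendsto_pi_nhds.2 fun j => ?_
    rw [← hC]
    exact tendsto_Hmat_totalScore (N := id) (W := fun _ => ω) hs hρ C (eventually_gt_atTop 0)
      (fun i j => h₂ ![i, j]) (hB'.mono fun q h z hz => (h z hz).2.1) h₁ i j
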